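/- **Setting.** Let $T^n=(\mathbb R/\mathbb Z)^n$, $\tilde M=\mathbb R^n\times T^n$, $\omega_0=\sum_i dx_i\wedge dy_i$, let $N\ge 1$ be an integer, and let $\tilde L^{\otimes N}=\tilde M\times\mathbb C$ be the trivial bundle with connection $d-2\pi\sqrt{-1}N\,x\cdot dy$. Let a group $\Gamma$ act by $$\rho_\gamma(x)=A_\gamma x+c_\gamma,\qquad \tilde\rho_\gamma(x,y)=(A_\gamma x+c_\gamma,\ {}^tA_\gamma^{-1}y+u_\gamma(x)),$$ $$(x,y,z)\mapsto\Big(\tilde\rho_\gamma(x,y),\ g_\gamma e^{2\pi\sqrt{-1}N\{\tilde g_\gamma(x)+c_\gamma\cdot({}^tA_\gamma^{-1}y)\}}z\Big)$$ on $\mathbb R^n$, $\tilde M$ and $\tilde L^{\otimes N}$, where $A_\gamma\in GL_n(\mathbb Z)$, $c_\gamma\in\frac1N\mathbb Z^n$, $g_\gamma\in U(1)$, $u_\gamma:\mathbb R^n\to T^n$ is smooth with ${}^tA_\gamma Du_\gamma$ symmetric (a smooth lift $\mathbb R^n\to\mathbb R^n$ is chosen and also denoted $u_\gamma$), and $$\tilde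 g_\gamma(x)=\rho_\gamma(x)\cdot u_\gamma(x)-c_\gamma\cdot u_\gamma(0)-\sum_{i=1}^n\Big({}^tA_\gamma\int_0^{x_i}u_\gamma(0,\dots,0,\tau,x_{i+1},\dots,x_n)\,d\tau\Big)_i .$$ Assume that $\rho$ is free and properly discontinuous on $\mathbb R^n$, and let $F\subset\mathbb R^n$ contain exactly one point of each $\rho$-orbit. Let $B=\mathbb R^n/\Gamma$, $M=\tilde M/\Gamma$ with the induced symplectic form $\omega$, and let $(L,\nabla^L)^{\otimes N}\to(M,N\omega)$ be the quotient line bundle with connection. Let $J$ be a compatible almost complex structure on $(M,\omega)$, and let $Z=X+\sqrt{-1}Y$ be the corresponding map from $\tilde M$ to the Siegel upper half space (symmetric complex matrices with positive definite imaginary part): the pullback of $J$ to $\tilde M$ has in the frame $(\partial_x,\partial_y)$ the matrix $$\begin{pmatrix}XY^{-1}&-Y-XY^{-1}X\\ Y^{-1}&-Y^{-1}X\end{pmatrix}.$$ Put $\Omega=(Y+XY^{-1}X)^{-1}ZY^{-1}$. When $Z$ depends only on $x$, put, for $m\in\mathbb Z^n$, $$a_m(x)=\exp\Big(-2\pi\sqrt{-1}\sum_{i=1}^n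 G^i_m\big(\tfrac{m_1}N,\dots,\tfrac{m_{i-1}}N,x_i,\dots,x_n\big)\Big),\qquad G^i_m(x)=\Big(\int_{m_i/N}^{x_i}\Omega(m-Nx)\,dx_i\Big)_i ;$$ for $\frac mN\in F\cap\frac1N\mathbb Z^n$ and $\gamma\in\Gamma$ define $a_{N\rho_\gamma(m/N)}$ by $$a_{N\rho_\gamma(\frac mN)}(\rho_\gamma(x))=g_\gamma\,a_m(x)\,e^{2\pi\sqrt{-1}N\{\tilde g_\gamma(x)-\rho_\gamma(\frac mN)\cdot u_\gamma(x)\}},$$ and set $$\vartheta_{\frac mN}(x,y)=\sum_{\gamma\in\Gamma}a_{N\rho_\gamma(\frac mN)}(x)\,e^{2\pi\sqrt{-1}N\rho_\gamma(\frac mN)\cdot y}.$$ A holomorphic section of $L^{\otimes N}\to(M,N\omega,J)$ is a smooth section whose covariant derivative vanishes along all vectors $v+\sqrt{-1}Jv$. **Theorem.** Suppose that $Z$ is constant. Then each $Du_\gamma$ is constant, and: (1) For each $\frac mN\in F\cap\frac1N\mathbb Z^n$, term by term in $\gamma\in\Gamma$, $$\vartheta_{\frac mN}(x,y)=\sum_{\gamma\in\Gamma}g_\gamma\,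 e^{2\pi\sqrt{-1}N\left[\frac12\left\{\left(\rho_{\gamma^{-1}}(x)-\frac mN\right)\cdot(\Omega+{}^tA_\gamma Du_\gamma)\left(\rho_{\gamma^{-1}}(x)-\frac mN\right)-\frac mN\cdot({}^tA_\gamma Du_\gamma)\frac mN\right\}-\rho_\gamma\left(\frac mN\right)\cdot u_\gamma(0)+\rho_\gamma\left(\frac mN\right)\cdot y\right]}.$$ (2) Each $\vartheta_{\frac mN}$ converges absolutely and uniformly on every compact set. (3) $J$ is integrable, i.e. $M$ has, around every point, complex coordinates for which $J$ is multiplication by $\sqrt{-1}$. Each $\vartheta_{\frac mN}$ is the pullback to $\tilde M$ of a holomorphic section of $L^{\otimes N}\to(M,N\omega,J)$, and these sections, for $\frac mN\in F\cap\frac1N\mathbb Z^n$, form a basis of the space of holomorphic sections, in the following sense: they are linearly independent; every holomorphic section has a unique expansion $\sum_{m}\alpha_m\vartheta_{\frac mN}$ with $\alpha_m\in\mathbb C$ whose pullback to $\tilde M$ converges absolutely and uniformly on compact sets; and if $B$ is compact, then $F\cap\frac1N\mathbb Z^n$ is finite and the $\vartheta_{\frac mN}$ are a vector space basis. -/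

import Mathlib

open scoped ContDiff Matrix

noncomputable section

namespace LagrangianTorus

/-! ### The standard Lagrangian torus fibration `ℝⁿ × Tⁿ → ℝⁿ` -/

/-- The torus `Tⁿ = (ℝ/ℤ)ⁿ`. -/
abbrev Torus (n : ℕ) : Type := Fin n → UnitAddCircle

/-- The total space `ℝⁿ × Tⁿ` of the standard fibration. -/
abbrev Total (n : ℕ) : Type := (Fin n → ℝ) × Torus n

/-- The universal cover `ℝⁿ × ℝⁿ` of `ℝⁿ × Tⁿ`. It also serves as the tangent space at each
point, `(v, w)` standing for `∑ i, (v i ∂/∂x_i + w i ∂/∂y_i)`. -/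
abbrev Cover (n : ℕ) : Type := (Fin n → ℝ) × (Fin n → ℝ)

/-- The class in `Tⁿ` of a vector of `ℝⁿ`. -/
def toTorus {n : ℕ} (y : Fin n → ℝ) : Torus n := fun i => (y i : UnitAddCircle)

/-- The covering map `ℝⁿ × ℝⁿ → ℝⁿ × Tⁿ`. A function on `ℝⁿ × Tⁿ` is smooth when its composition
with this map is. -/
def coverProj {n : ℕ} (p : Cover n) : Total n := (p.1, toTorus p.2)

/-- The action of an integer matrix on the torus. -/
def torusMul {n : ℕ} (B : Matrix (Fin n) (Fin n) ℤ) (y : Torus n) : Torus n :=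
  fun i => ∑ j, B i j • y j

/-- The character `y ↦ exp (2π√-1 k · y)` of `Tⁿ`, for `k ∈ ℤⁿ`. -/
def torusChar {n : ℕ} (k : Fin n → ℤ) (y : Torus n) : ℂ := ∏ i, fourier (k i) (y i)

/-- The Jacobi matrix `(Du)_x`. -/
def jacobiMatrix {n : ℕ} (u : (Fin n → ℝ) → (Fin n → ℝ)) (x : Fin n → ℝ) :
    Matrix (Fin n) (Fin n) ℝ :=
  LinearMap.toMatrix' (fderiv ℝ u x : (Fin n → ℝ) →ₗ[ℝ] (Fin n → ℝ))

/-- The vector `(b_1, …, b_{i-1}, x_i, …, x_n)`. -/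
def replaceBelow {n : ℕ} (i : Fin n) (b x : Fin n → ℝ) : Fin n → ℝ :=
  fun j => if j < i then b j else x j

/-- An endomorphism of `ℝ²ⁿ`, given by its matrix in the frame `(∂_x, ∂_y)`, applied to a tangent
vector. -/
def applyTangent {n : ℕ} (J : Matrix (Fin n ⊕ Fin n) (Fin n ⊕ Fin n) ℝ) (v : Cover n) : Cover n :=
  (fun i => (J *ᵥ Sum.elim v.1 v.2) (Sum.inl i), fun i => (J *ᵥ Sum.elim v.1 v.2) (Sum.inr i))

/-- The standard symplectic form `ω₀ = ∑ dx_i ∧ dy_i`. -/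
def stdSymplectic {n : ℕ} (u v : Cover n) : ℝ := u.1 ⬝ᵥ v.2 - u.2 ⬝ᵥ v.1

/-! ### Group actions on the standard prequantum line bundle -/

/-- The data `(A_γ, c_γ, u_γ, g_γ)`, `γ ∈ Γ`, with `A_γ ∈ GL_n(ℤ)`, `c_γ ∈ (1/N)ℤⁿ` (recorded through
the integer vector `N c_γ`), a lift `ℝⁿ → ℝⁿ` of `u_γ : ℝⁿ → Tⁿ`, and `g_γ ∈ U(1)`. -/
structure ActionData (n N : ℕ) (Γ : Type*) where
  A : Γ → Matrix.GeneralLinearGroup (Fin n) ℤ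
  Nc : Γ → Fin n → ℤ
  u : Γ → (Fin n → ℝ) → (Fin n → ℝ)
  g : Γ → Circle

namespace ActionData

variable {n N : ℕ} {Γ : Type*} (S : ActionData n N Γ)

/-- `A_γ` as a real matrix. -/
def AR (γ : Γ) : Matrix (Fin n) (Fin n) ℝ := (S.A γ : Matrix (Fin n) (Fin n) ℤ).map (Int.cast)

/-- `ᵗA_γ⁻¹` as an integer matrix. -/
def Ainvt (γ : Γ) : Matrix (Fin n) (Fin n) ℤ := ((S.A γ)⁻¹ : Matrix.GeneralLinearGroup (Fin n) ℤ).valᵀ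

/-- `c_γ`. -/
def c (γ : Γ) : Fin n → ℝ := fun i => (S.Nc γ i : ℝ) / N

/-- `Du_γ`. -/
def Du (γ : Γ) (x : Fin n → ℝ) : Matrix (Fin n) (Fin n) ℝ := jacobiMatrix (S.u γ) x

/-- `ρ_γ(x) = A_γ x + c_γ`. -/
def rho (γ : Γ) (x : Fin n → ℝ) : Fin n → ℝ := S.AR γ *ᵥ x + S.c γ

/-- `N ρ_γ(m/N) ∈ ℤⁿ` for `m ∈ ℤⁿ`. -/
def NrhoInt (γ : Γ) (m : Fin n → ℤ) : Fin n → ℤ :=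
  (S.A γ : Matrix (Fin n) (Fin n) ℤ) *ᵥ m + S.Nc γ

/-- `ρ̃_γ(x, y) = (A_γ x + c_γ, ᵗA_γ⁻¹ y + u_γ(x))`. -/
def rhoTotal (γ : Γ) (p : Total n) : Total n :=
  (S.rho γ p.1, torusMul (S.Ainvt γ) p.2 + toTorus (S.u γ p.1))

/-- The matrix of the differential of `ρ̃_γ` at a point over `x`. -/
def dRhoTotal (γ : Γ) (x : Fin n → ℝ) : Matrix (Fin n ⊕ Fin n) (Fin n ⊕ Fin n) ℝ :=
  Matrix.fromBlocks (S.AR γ) 0 (S.Du γ x) ((S.Ainvt γ).map (Int.cast))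

/-- `F^i_γ(x) = (ᵗA_γ ∫_0^{x_i} u_γ(x) dx_i)_i`. -/
def Fint (γ : Γ) (i : Fin n) (x : Fin n → ℝ) : ℝ :=
  ((S.AR γ)ᵀ *ᵥ (fun j => ∫ t in (0 : ℝ)..(x i), S.u γ (Function.update x i t) j)) i

/-- `g̃_γ(x) = ρ_γ(x) · u_γ(x) - c_γ · u_γ(0) - ∑ i, F^i_γ(0, …, 0, x_i, …, x_n)`. -/
def gTilde (γ : Γ) (x : Fin n → ℝ) : ℝ :=
  S.rho γ x ⬝ᵥ S.u γ x - S.c γ ⬝ᵥ S.u γ 0 - ∑ i, S.Fint γ i (replaceBelow i 0 x)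

/-- The factor `g_γ exp (2π√-1 N {g̃_γ(x) + c_γ · ᵗA_γ⁻¹ y})`. -/
def mult (γ : Γ) (p : Total n) : ℂ :=
  (S.g γ : ℂ) * Complex.exp (2 * Real.pi * Complex.I * N * S.gTilde γ p.1) *
    torusChar (S.Nc γ) (torusMul (S.Ainvt γ) p.2)

/-- The bundle map of `ℝⁿ × Tⁿ × ℂ` given by `γ`, covering `ρ̃_γ`. -/
def lift (γ : Γ) (q : Total n × ℂ) : Total n × ℂ := (S.rhoTotal γ q.1, S.mult γ q.1 * q.2)

end ActionData

/-- A group `Γ` acting on the prequantum line bundle `(ℝⁿ × Tⁿ × ℂ, d - 2π√-1 N x · dy)` over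
`(ℝⁿ × Tⁿ, N ω₀) → ℝⁿ`, through the maps `ActionData.lift`, such that the induced action on `ℝⁿ`
is free and properly discontinuous. -/
structure PrequantumAction (n N : ℕ) (Γ : Type*) [Group Γ] extends ActionData n N Γ where
  u_smooth : ∀ γ, ContDiff ℝ ∞ (u γ)
  symm : ∀ γ x, ((toActionData.AR γ)ᵀ * toActionData.Du γ x).IsSymm
  lift_one : ∀ q, toActionData.lift 1 q = q
  lift_mul : ∀ γ₁ γ₂ q,
    toActionData.lift (γ₁ * γ₂) q = toActionData.lift γ₁ (toActionData.lift γ₂ q)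
  free : ∀ γ x, toActionData.rho γ x = x → γ = 1
  properlyDiscontinuous : ∀ K : Set (Fin n → ℝ), IsCompact K →
    {γ : Γ | (toActionData.rho γ '' K ∩ K).Nonempty}.Finite

/-- The orbit equivalence relation of an action. -/
def orbitSetoid {Γ X : Type*} [Group Γ] (f : Γ → X → X) (h1 : ∀ x, f 1 x = x)
    (hm : ∀ a b x, f (a * b) x = f a (f b x)) : Setoid X where
  r x y := ∃ γ, f γ x = y
  iseqv :=
    { refl := fun x => ⟨1, h1 x⟩
      symm := by
        rintro x y ⟨γ, rfl⟩
        exact ⟨γ⁻¹, by rw [← hm, inv_mul_cancel, h1]⟩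
      trans := by
        rintro x y z ⟨γ, rfl⟩ ⟨δ, rfl⟩
        exact ⟨δ * γ, hm _ _ _⟩ }

namespace PrequantumAction

variable {n N : ℕ} {Γ : Type*} [Group Γ] (S : PrequantumAction n N Γ)

lemma rhoTotal_one (p : Total n) : S.rhoTotal 1 p = p :=
  congrArg Prod.fst (S.lift_one (p, 0))

lemma rhoTotal_mul (γ₁ γ₂ : Γ) (p : Total n) :
    S.rhoTotal (γ₁ * γ₂) p = S.rhoTotal γ₁ (S.rhoTotal γ₂ p) :=
  congrArg Prod.fst (S.lift_mul γ₁ γ₂ (p, 0))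

lemma rho_one (x : Fin n → ℝ) : S.rho 1 x = x :=
  congrArg Prod.fst (S.rhoTotal_one (x, 0))

lemma rho_mul (γ₁ γ₂ : Γ) (x : Fin n → ℝ) : S.rho (γ₁ * γ₂) x = S.rho γ₁ (S.rho γ₂ x) :=
  congrArg Prod.fst (S.rhoTotal_mul γ₁ γ₂ (x, 0))

/-- The base `B = ℝⁿ/Γ`. -/
abbrev Base : Type := Quotient (orbitSetoid S.rho S.rho_one S.rho_mul)

/-- The manifold `M = (ℝⁿ × Tⁿ)/Γ`. -/
abbrev Mfd : Type := Quotient (orbitSetoid S.rhoTotal S.rhoTotal_one S.rhoTotal_mul)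

/-- The total space `(ℝⁿ × Tⁿ × ℂ)/Γ` of the prequantum line bundle `L^{⊗N}` on `(M, Nω)`. -/
abbrev LineBundle : Type := Quotient (orbitSetoid S.lift S.lift_one S.lift_mul)

/-- The quotient map `ℝⁿ × Tⁿ → M`. -/
def toMfd (p : Total n) : S.Mfd := Quotient.mk _ p

/-- The class of `(p, z)` in the line bundle. -/
def toLine (p : Total n) (z : ℂ) : S.LineBundle := Quotient.mk _ (p, z)

/-- The universal covering map `ℝⁿ × ℝⁿ → M`. -/
def coverMap (p : Cover n) : S.Mfd := S.toMfd (coverProj p)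

/-- The bundle projection. -/
def lineProj : S.LineBundle → S.Mfd :=
  Quotient.map Prod.fst (by rintro a b ⟨γ, rfl⟩; exact ⟨γ, rfl⟩)

/-- Set-theoretic sections of the line bundle. -/
def Sect : Type := {σ : S.Mfd → S.LineBundle // ∀ b, S.lineProj (σ b) = b}

/-- `Γ`-equivariant functions on `ℝⁿ × Tⁿ`. -/
def equivariantFunctions : Submodule ℂ (Total n → ℂ) where
  carrier := {s | ∀ γ p, s (S.rhoTotal γ p) = S.mult γ p * s p}
  add_mem' := by
    intro a b ha hb γ p
    simp only [Pi.add_apply, ha γ p, hb γ p, mul_add]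
  zero_mem' := by intro γ p; simp
  smul_mem' := by
    intro k a ha γ p
    simp only [Pi.smul_apply, smul_eq_mul, ha γ p]
    ring

lemma toMfd_rhoTotal (γ : Γ) (p : Total n) : S.toMfd (S.rhoTotal γ p) = S.toMfd p :=
  (Quotient.sound ⟨γ, rfl⟩ : S.toMfd p = S.toMfd (S.rhoTotal γ p)).symm

lemma toLine_lift (γ : Γ) (p : Total n) (z : ℂ) :
    S.toLine (S.rhoTotal γ p) (S.mult γ p * z) = S.toLine p z :=
  (Quotient.sound ⟨γ, rfl⟩ : S.toLine p z = S.toLine (S.rhoTotal γ p) (S.mult γ p * z)).symm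

lemma toLine_injective (p : Total n) {z w : ℂ} (h : S.toLine p z = S.toLine p w) : z = w := by
  obtain ⟨γ, hγ⟩ := Quotient.exact h
  have h1 : S.rho γ p.1 = p.1 := congrArg (fun q => q.1.1) hγ
  have h2 := S.free γ _ h1
  subst h2
  have h3 := S.lift_one (p, z)
  rw [h3] at hγ
  exact congrArg Prod.snd hγ

lemma exists_toLine (σ : S.Sect) (p : Total n) : ∃ z, σ.1 (S.toMfd p) = S.toLine p z := by
  have h := σ.2 (S.toMfd p)
  obtain ⟨⟨q, w⟩, hq⟩ := Quotient.exists_rep (σ.1 (S.toMfd p))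
  rw [← hq] at h
  obtain ⟨γ, hγ⟩ := Quotient.exact h
  have hγ' : S.rhoTotal γ q = p := hγ
  refine ⟨S.mult γ q * w, ?_⟩
  rw [← hq]
  subst hγ'
  exact (S.toLine_lift γ q w).symm

/-- The pullback of a section to `ℝⁿ × Tⁿ`: the function `s` with `σ [p] = [p, s(p)]`. -/
def pullback (σ : S.Sect) (p : Total n) : ℂ := (S.exists_toLine σ p).choose

lemma pullback_spec (σ : S.Sect) (p : Total n) :
    σ.1 (S.toMfd p) = S.toLine p (S.pullback σ p) := (S.exists_toLine σ p).choose_spec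

/-- Sections of the quotient bundle are the same as equivariant functions. -/
def sectEquiv : S.Sect ≃ S.equivariantFunctions where
  toFun σ := ⟨S.pullback σ, by
    intro γ p
    refine S.toLine_injective (S.rhoTotal γ p) ?_
    rw [← S.pullback_spec, S.toLine_lift, ← S.pullback_spec, S.toMfd_rhoTotal]⟩
  invFun s := ⟨Quotient.lift (fun p => S.toLine p (s.1 p)) (by
      rintro a b ⟨γ, rfl⟩
      rw [s.2 γ a, S.toLine_lift]), by
    intro b
    induction b using Quotient.inductionOn with
    | h p => rfl⟩
  left_inv σ := by
    apply Subtype.ext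
    funext b
    induction b using Quotient.inductionOn with
    | h p => exact (S.pullback_spec σ p).symm
  right_inv s := by
    apply Subtype.ext
    funext p
    refine S.toLine_injective p ?_
    exact (S.pullback_spec _ p).symm

/-- The fibrewise operations `[p, z] + [p, w] = [p, z + w]` and `k • [p, z] = [p, k z]` make the
sections a complex vector space. -/
instance : AddCommGroup S.Sect := S.sectEquiv.addCommGroup

instance : Module ℂ S.Sect := S.sectEquiv.module ℂ

lemma pullback_add (σ τ : S.Sect) : S.pullback (σ + τ) = S.pullback σ + S.pullback τ :=
  congrArg Subtype.val (S.sectEquiv.apply_symm_apply (S.sectEquiv σ + S.sectEquiv τ))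

lemma pullback_smul (k : ℂ) (σ : S.Sect) : S.pullback (k • σ) = k • S.pullback σ :=
  congrArg Subtype.val (S.sectEquiv.apply_symm_apply (k • S.sectEquiv σ))

lemma pullback_zero : S.pullback 0 = 0 :=
  congrArg Subtype.val (S.sectEquiv.apply_symm_apply 0)

/-- A compatible almost complex structure on `(M, ω)`, given as a `Γ`-invariant one on
`(ℝⁿ × Tⁿ, ω₀)` by its matrix in the frame `(∂_x, ∂_y)`. -/
structure CompatibleACS where
  J : Total n → Matrix (Fin n ⊕ Fin n) (Fin n ⊕ Fin n) ℝ
  smooth : ∀ a b, ContDiff ℝ ∞ (fun p : Cover n => J (coverProj p) a b)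
  sq : ∀ p, J p * J p = -1
  compatible : ∀ p v w,
    stdSymplectic (applyTangent (J p) v) (applyTangent (J p) w) = stdSymplectic v w
  positive : ∀ p v, v ≠ 0 → 0 < stdSymplectic v (applyTangent (J p) v)
  invariant : ∀ γ p, S.dRhoTotal γ p.1 * J p = J (S.rhoTotal γ p) * S.dRhoTotal γ p.1

/-- `J` is integrable: around each point of `M` there are complex coordinates, smooth with invertible
differential, whose differential turns `J` into multiplication by `√-1`. -/
def IsIntegrable (J : S.CompatibleACS) : Prop :=
  ∀ b : S.Mfd, ∃ e : OpenPartialHomeomorph S.Mfd (Fin n → ℂ), b ∈ e.source ∧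
    ∀ p : Cover n, S.coverMap p ∈ e.source →
      ContDiffAt ℝ ∞ (fun q => e (S.coverMap q)) p ∧
      Function.Bijective (fderiv ℝ (fun q => e (S.coverMap q)) p) ∧
      ∀ v, fderiv ℝ (fun q => e (S.coverMap q)) p (applyTangent (J.J (coverProj p)) v) =
        Complex.I • fderiv ℝ (fun q => e (S.coverMap q)) p v

end PrequantumAction

/-- The covariant derivative `∇_v s` at `p` for the connection `d - 2π√-1 N x · dy`. -/
def covDeriv {n : ℕ} (N : ℕ) (s : Total n → ℂ) (p v : Cover n) : ℂ :=
  fderiv ℝ (fun q : Cover n => s (coverProj q)) p v -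
    2 * Real.pi * Complex.I * N * ((p.1 ⬝ᵥ v.2 : ℝ) : ℂ) * s (coverProj p)

namespace PrequantumAction

variable {n N : ℕ} {Γ : Type*} [Group Γ] (S : PrequantumAction n N Γ)

/-- The space of holomorphic sections of `L^{⊗N} → (M, Nω, J)`: the smooth sections whose covariant
derivative vanishes along all vectors `v + √-1 J v` of type `(0, 1)`. -/
def holomorphicSections (J : S.CompatibleACS) : Submodule ℂ S.Sect where
  carrier := {σ | ContDiff ℝ ∞ (fun q : Cover n => S.pullback σ (coverProj q)) ∧
    ∀ p v : Cover n, covDeriv N (S.pullback σ) p v +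
      Complex.I * covDeriv N (S.pullback σ) p (applyTangent (J.J (coverProj p)) v) = 0}
  add_mem' := by
    rintro a b ⟨ha, ha'⟩ ⟨hb, hb'⟩
    have h1 : (fun q : Cover n => S.pullback (a + b) (coverProj q)) =
        (fun q => S.pullback a (coverProj q)) + fun q => S.pullback b (coverProj q) := by
      rw [S.pullback_add]; rfl
    have h2 : ∀ p v, covDeriv N (S.pullback (a + b)) p v =
        covDeriv N (S.pullback a) p v + covDeriv N (S.pullback b) p v := by
      intro p v
      unfold covDeriv
      rw [h1, fderiv_add (ha.differentiable (by simp) p) (hb.differentiable (by simp) p),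
        S.pullback_add]
      simp only [add_apply, Pi.add_apply]
      ring
    refine ⟨by rw [h1]; exact ha.add hb, fun p v => ?_⟩
    rw [h2, h2]
    linear_combination ha' p v + hb' p v
  zero_mem' := by
    have h1 : (fun q : Cover n => S.pullback 0 (coverProj q)) = fun _ => 0 := by
      rw [S.pullback_zero]; rfl
    refine ⟨by rw [h1]; exact contDiff_const, fun p v => ?_⟩
    unfold covDeriv
    rw [h1, S.pullback_zero]
    simp
  smul_mem' := by
    rintro k a ⟨ha, ha'⟩
    have h1 : (fun q : Cover n => S.pullback (k • a) (coverProj q)) =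
        k • fun q => S.pullback a (coverProj q) := by
      rw [S.pullback_smul]; rfl
    have h2 : ∀ p v, covDeriv N (S.pullback (k • a)) p v = k * covDeriv N (S.pullback a) p v := by
      intro p v
      unfold covDeriv
      rw [h1, fderiv_const_smul (ha.differentiable (by simp) p), S.pullback_smul]
      simp only [smul_apply, Pi.smul_apply, smul_eq_mul]
      ring
    refine ⟨by rw [h1]; exact ha.const_smul k, fun p v => ?_⟩
    rw [h2, h2]
    linear_combination k * ha' p v

end PrequantumAction

/-! ### The Siegel upper half space -/

/-- The Siegel upper half space: symmetric complex matrices with positive definite imaginary part. -/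
def siegel (n : ℕ) : Set (Matrix (Fin n) (Fin n) ℂ) :=
  {Z | Z.IsSymm ∧ (Z.map Complex.im).PosDef}

/-- The matrix `Y + X Y⁻¹ X` for `Z = X + √-1 Y`. -/
def siegelP {n : ℕ} (Z : Matrix (Fin n) (Fin n) ℂ) : Matrix (Fin n) (Fin n) ℝ :=
  Z.map Complex.im + Z.map Complex.re * (Z.map Complex.im)⁻¹ * Z.map Complex.re

/-- The complex structure `J_Z` of the symplectic vector space `ℝ²ⁿ`. -/
def siegelJ {n : ℕ} (Z : Matrix (Fin n) (Fin n) ℂ) : Matrix (Fin n ⊕ Fin n) (Fin n ⊕ Fin n) ℝ :=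
  Matrix.fromBlocks (Z.map Complex.re * (Z.map Complex.im)⁻¹) (-siegelP Z)
    (Z.map Complex.im)⁻¹ (-((Z.map Complex.im)⁻¹ * Z.map Complex.re))

/-- `Ω = (Y + X Y⁻¹ X)⁻¹ Z Y⁻¹`. -/
def siegelOmega {n : ℕ} (Z : Matrix (Fin n) (Fin n) ℂ) : Matrix (Fin n) (Fin n) ℂ :=
  ((siegelP Z)⁻¹).map Complex.ofReal * Z * ((Z.map Complex.im)⁻¹).map Complex.ofReal

/-- `Ω` as a function of `x`, for a map `Z` from `ℝⁿ × Tⁿ` to the Siegel upper half space that does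
not depend on the point of `Tⁿ`. -/
def omegaField {n : ℕ} (Z : Total n → Matrix (Fin n) (Fin n) ℂ) (x : Fin n → ℝ) :
    Matrix (Fin n) (Fin n) ℂ :=
  siegelOmega (Z (x, 0))

/-! ### The sections `ϑ_{m/N}` -/

/-- The point `m/N`. -/
def ratPoint {n : ℕ} (N : ℕ) (m : Fin n → ℤ) : Fin n → ℝ := fun i => (m i : ℝ) / N

/-- The integer vectors `m` with `m/N ∈ F`, that is, the points of `F ∩ (1/N)ℤⁿ`. -/
abbrev LatticePoints {n : ℕ} (N : ℕ) (F : Set (Fin n → ℝ)) : Type :=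
  {m : Fin n → ℤ // ratPoint N m ∈ F}

/-- `G^i_m(x) = (∫_{m_i/N}^{x_i} Ω (m - N x) dx_i)_i`, for `Ω` a function of `x`. -/
def Gint {n : ℕ} (N : ℕ) (Om : (Fin n → ℝ) → Matrix (Fin n) (Fin n) ℂ) (m : Fin n → ℤ) (i : Fin n)
    (x : Fin n → ℝ) : ℂ :=
  ∫ t in ((m i : ℝ) / N)..(x i),
    (Om (Function.update x i t) *ᵥ fun j => (m j : ℂ) - N * ((Function.update x i t j : ℝ) : ℂ)) i

/-- `a_m(x) = exp (-2π√-1 ∑ i, G^i_m(m_1/N, …, m_{i-1}/N, x_i, …, x_n))`. -/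
def fourierCoeff {n : ℕ} (N : ℕ) (Om : (Fin n → ℝ) → Matrix (Fin n) (Fin n) ℂ) (m : Fin n → ℤ)
    (x : Fin n → ℝ) : ℂ :=
  Complex.exp (-(2 * Real.pi * Complex.I *
    ∑ i, Gint N Om m i (replaceBelow i (ratPoint N m) x)))

namespace PrequantumAction

variable {n N : ℕ} {Γ : Type*} [Group Γ] (S : PrequantumAction n N Γ)

/-- `F` is a fundamental domain: each orbit of `Γ` on `ℝⁿ` has exactly one point in `F`. -/
def IsFundDomain (F : Set (Fin n → ℝ)) : Prop := ∀ x, ∃! γ : Γ, S.rho γ x ∈ F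

/-- The coefficient `a_{Nρ_γ(m/N)}`, determined from `a_m` by equivariance:
`a_{Nρ_γ(m/N)}(ρ_γ(x)) = g_γ a_m(x) exp (2π√-1 N {g̃_γ(x) - ρ_γ(m/N) · u_γ(x)})`. -/
def orbitCoeff (Om : (Fin n → ℝ) → Matrix (Fin n) (Fin n) ℂ) (m : Fin n → ℤ) (γ : Γ)
    (x : Fin n → ℝ) : ℂ :=
  (S.g γ : ℂ) * fourierCoeff N Om m (S.rho γ⁻¹ x) *
    Complex.exp (2 * Real.pi * Complex.I * N *
      ((S.gTilde γ (S.rho γ⁻¹ x) - S.rho γ (ratPoint N m) ⬝ᵥ S.u γ (S.rho γ⁻¹ x) : ℝ) : ℂ))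

/-- The term `a_{Nρ_γ(m/N)}(x) exp (2π√-1 N ρ_γ(m/N) · y)` of the Fourier series `ϑ_{m/N}`. -/
def thetaTerm (Om : (Fin n → ℝ) → Matrix (Fin n) (Fin n) ℂ) (m : Fin n → ℤ) (γ : Γ)
    (p : Total n) : ℂ :=
  S.orbitCoeff Om m γ p.1 * torusChar (S.NrhoInt γ m) p.2

/-- `ϑ_{m/N}`. -/
def theta (Om : (Fin n → ℝ) → Matrix (Fin n) (Fin n) ℂ) (m : Fin n → ℤ) (p : Total n) : ℂ :=
  ∑' γ, S.thetaTerm Om m γ p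

/-- The general term of the explicit series of `ϑ_{m/N}`, for `Ω` and `Du_γ` constant:
`g_γ exp 2π√-1 N [½ {(ρ_{γ⁻¹}(x) - m/N) · (Ω + ᵗA_γ Du_γ) (ρ_{γ⁻¹}(x) - m/N) - m/N · (ᵗA_γ Du_γ) m/N}
- ρ_γ(m/N) · u_γ(0) + ρ_γ(m/N) · y]`. The matrix `Du_γ` is evaluated at the origin. -/
def gaussianTerm (Om : Matrix (Fin n) (Fin n) ℂ) (m : Fin n → ℤ) (γ : Γ) (x y : Fin n → ℝ) : ℂ :=
  let ξ : Fin n → ℂ := fun i => ((S.rho γ⁻¹ x i - ratPoint N m i : ℝ) : ℂ)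
  let D : Matrix (Fin n) (Fin n) ℝ := (S.AR γ)ᵀ * S.Du γ 0
  (S.g γ : ℂ) * Complex.exp (2 * Real.pi * Complex.I * N *
    (1 / 2 * (ξ ⬝ᵥ ((Om + D.map Complex.ofReal) *ᵥ ξ)
        - ((ratPoint N m ⬝ᵥ (D *ᵥ ratPoint N m) : ℝ) : ℂ))
      - ((S.rho γ (ratPoint N m) ⬝ᵥ S.u γ 0 : ℝ) : ℂ)
      + ((S.rho γ (ratPoint N m) ⬝ᵥ y : ℝ) : ℂ)))

end PrequantumAction

/-- The series `∑ i, f i` converges to `s` absolutely and uniformly on every compact set: on each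
compact set both the series of absolute values and the series itself converge uniformly. -/
def ConvergesOnCompacts {ι X : Type*} [TopologicalSpace X] (f : ι → X → ℂ) (s : X → ℂ) : Prop :=
  (∀ x, Summable fun i => ‖f i x‖) ∧
  ∀ K : Set X, IsCompact K →
    TendstoUniformlyOn (fun (t : Finset ι) x => ∑ i ∈ t, ‖f i x‖) (fun x => ∑' i, ‖f i x‖)
      Filter.atTop K ∧
    TendstoUniformlyOn (fun (t : Finset ι) x => ∑ i ∈ t, f i x) s Filter.atTop K

end LagrangianTorus

end

namespace LagrangianTorus

/-! ### Exponential series with rapidly decaying coefficients -/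

/-! For constant `Z`, with P = Y + X Y⁻¹ X, the matrix Ω is symmetric with Im Ω = P⁻¹ positive
definite, and ζ = y - Ω x satisfies ζ(J v) = √-1 ζ(v) (`zetaMap_siegelJ`). So ζ is a global
holomorphic coordinate on ℝⁿ × ℝⁿ, and exp (π√-1 N x · Ω x) is a holomorphic frame: factoring it out
turns the (0, 1)-part of the connection into the Cauchy-Riemann operator (`covDeriv_add_I_mul`). A
holomorphic section over ℝⁿ × Tⁿ is therefore this frame times a holomorphic function of ζ with
period lattice ℤⁿ, that is, a series ∑ b_k exp (2π√-1 k · ζ) whose coefficients decay faster than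
any exponential (`exists_expSeries`). Completing the square turns its terms into multiples of
Gaussians centred at k/N (`basicTerm_coverProj`).

Invariance of J under ρ̃_γ expresses P Du_γ through constant matrices, so Du_γ is constant
(`Du_const`), and it gives ᵗA Ω A = Ω + ᵗA Du (`omega_transform`). Hence the γ-term of ϑ_{m/N} is a
unimodular constant times the Gaussian centred at ρ_γ(m/N) (`thetaTerm_eq_basicTerm`), and
convergence and holomorphy follow from the decay of the Gaussian coefficients.

Γ permutes (1/N)ℤⁿ freely and each orbit meets F once. Equivariance of a section determines its
Gaussian coefficients along an orbit from a single one, so grouping its expansion by orbits gives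
the expansion in the ϑ_{m/N} (`exists_theta_expansion`). Different ϑ_{m/N} involve disjoint sets of
frequencies, so Fourier coefficients on one fibre give uniqueness and linear independence
(`exists_mFourierCoeff_theta`). Local inverses of the covering map followed by ζ are the complex
charts of M (`isIntegrable_of_const`). -/

lemma summable_exp_neg_l1 (n : ℕ) :
    Summable fun k : Fin n → ℤ => Real.exp (-∑ i, |(k i : ℝ)|) := by
  have h1 : Summable fun j : ℤ => Real.exp (-|(j : ℝ)|) := by
    have h0 : Summable fun j : ℕ => Real.exp (-(j : ℝ)) := Real.summable_exp_neg_nat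
    refine Summable.of_nat_of_neg ?_ ?_
    · simpa using h0
    · simpa using h0
  induction n with
  | zero => exact Summable.of_finite
  | succ n ih =>
    rw [← (Fin.consEquiv fun _ => ℤ).summable_iff]
    convert h1.mul_of_nonneg ih (fun _ => (Real.exp_pos _).le) (fun _ => (Real.exp_pos _).le)
      using 1
    ext p
    simp [Fin.sum_univ_succ, Fin.consEquiv, ← Real.exp_add]
    ring

/-- Coefficients decaying faster than any exponential. -/
def RapidDecay {n : ℕ} (b : (Fin n → ℤ) → ℂ) : Prop :=
  ∀ R : ℝ, ∃ C : ℝ, ∀ k, ‖b k‖ ≤ C * Real.exp (-(R * ∑ i, |(k i : ℝ)|))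

/-- The character `z ↦ exp (2π√-1 k · z)` of `ℂⁿ`. -/
noncomputable def expChar {n : ℕ} (k : Fin n → ℤ) (z : Fin n → ℂ) : ℂ :=
  Complex.exp (2 * Real.pi * Complex.I * ∑ i, (k i : ℂ) * z i)

/-- The series `∑ k, b_k exp (2π√-1 k · z)`. -/
noncomputable def expSeries {n : ℕ} (b : (Fin n → ℤ) → ℂ) (z : Fin n → ℂ) : ℂ :=
  ∑' k, b k * expChar k z

variable {n : ℕ}

lemma norm_expChar_le (k : Fin n → ℤ) (z : Fin n → ℂ) {r : ℝ} (hz : ‖z‖ ≤ r) :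
    ‖expChar k z‖ ≤ Real.exp (2 * Real.pi * r * ∑ i, |(k i : ℝ)|) := by
  rw [expChar, Complex.norm_exp]
  refine Real.exp_le_exp.2 ((Complex.re_le_norm _).trans ?_)
  have h1 : ‖∑ i, (k i : ℂ) * z i‖ ≤ r * ∑ i, |(k i : ℝ)| := by
    rw [Finset.mul_sum]
    refine norm_sum_le_of_le _ fun i _ => ?_
    rw [norm_mul, Complex.norm_intCast, mul_comm]
    exact mul_le_mul_of_nonneg_right ((norm_le_pi_norm z i).trans hz) (abs_nonneg _)
  rw [norm_mul]
  have h2 : ‖(2 * Real.pi * Complex.I : ℂ)‖ = 2 * Real.pi := by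
    simp [abs_of_pos Real.pi_pos]
  rw [h2, mul_assoc (2 * Real.pi) r]
  exact mul_le_mul_of_nonneg_left h1 (by positivity)

lemma RapidDecay.exists_bound {b : (Fin n → ℤ) → ℂ} (hb : RapidDecay b) (r : ℝ) :
    ∃ v : (Fin n → ℤ) → ℝ, Summable v ∧ ∀ k z, ‖z‖ ≤ r → ‖b k * expChar k z‖ ≤ v k := by
  -- The rate 2πr absorbs the growth of the characters on ‖z‖ ≤ r; the extra 1 leaves a summable
  -- majorant.
  obtain ⟨C, hC⟩ := hb (2 * Real.pi * r + 1)
  refine ⟨fun k => C * Real.exp (-∑ i, |(k i : ℝ)|), (summable_exp_neg_l1 n).mul_left C,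
    fun k z hz => ?_⟩
  rw [norm_mul]
  refine (mul_le_mul (hC k) (norm_expChar_le k z hz) (norm_nonneg _)
    ((norm_nonneg _).trans (hC k))).trans_eq ?_
  rw [mul_assoc, ← Real.exp_add]
  congr 2
  ring

/-- Differentiating the series termwise along v multiplies b_k by 2π√-1 k · v; stability under this
operation is what makes the sum smooth. -/
lemma RapidDecay.mul_linear {b : (Fin n → ℤ) → ℂ} (hb : RapidDecay b) (v : Fin n → ℂ) :
    RapidDecay fun k => b k * (2 * Real.pi * Complex.I * ∑ i, (k i : ℂ) * v i) := by
  intro R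
  -- One unit of rate pays for the linear factor, because |k|₁ ≤ exp |k|₁.
  obtain ⟨C, hC⟩ := hb (R + 1)
  refine ⟨C * (2 * Real.pi * ‖v‖), fun k => ?_⟩
  have h1 : ‖(2 * Real.pi * Complex.I * ∑ i, (k i : ℂ) * v i : ℂ)‖ ≤
      2 * Real.pi * ‖v‖ * ∑ i, |(k i : ℝ)| := by
    rw [norm_mul, mul_assoc (2 * Real.pi)]
    have h2 : ‖(2 * Real.pi * Complex.I : ℂ)‖ = 2 * Real.pi := by
      simp [abs_of_pos Real.pi_pos]
    rw [h2]
    refine mul_le_mul_of_nonneg_left ?_ (by positivity)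
    rw [Finset.mul_sum]
    refine norm_sum_le_of_le _ fun i _ => ?_
    rw [norm_mul, Complex.norm_intCast, mul_comm]
    exact mul_le_mul_of_nonneg_right (norm_le_pi_norm v i) (abs_nonneg _)
  have h3 : ∑ i, |(k i : ℝ)| ≤ Real.exp (∑ i, |(k i : ℝ)|) :=
    (by linarith : _ ≤ ∑ i, |(k i : ℝ)| + 1).trans (Real.add_one_le_exp _)
  have hC0 := (norm_nonneg _).trans (hC k)
  rw [norm_mul]
  refine (mul_le_mul (hC k) (h1.trans (mul_le_mul_of_nonneg_left h3 (by positivity)))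
    (norm_nonneg _) hC0).trans_eq ?_
  rw [show -(R * ∑ i, |(k i : ℝ)|) = -((R + 1) * ∑ i, |(k i : ℝ)|) + ∑ i, |(k i : ℝ)| by ring,
    Real.exp_add]
  ring

lemma RapidDecay.mul_bounded {b c : (Fin n → ℤ) → ℂ} (hb : RapidDecay b) (hc : ∀ k, ‖c k‖ ≤ 1) :
    RapidDecay fun k => c k * b k := by
  intro R
  obtain ⟨C, hC⟩ := hb R
  refine ⟨C, fun k => (le_trans ?_ (hC k))⟩
  rw [norm_mul]
  exact mul_le_of_le_one_left (norm_nonneg _) (hc k)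

lemma RapidDecay.summable {b : (Fin n → ℤ) → ℂ} (hb : RapidDecay b) (z : Fin n → ℂ) :
    Summable fun k => b k * expChar k z := by
  obtain ⟨v, hv, hv'⟩ := hb.exists_bound ‖z‖
  exact Summable.of_norm_bounded hv fun k => hv' k z le_rfl

/-- The linear form `2π√-1 k · z`. -/
noncomputable def charForm (k : Fin n → ℤ) : (Fin n → ℂ) →L[ℂ] ℂ :=
  (2 * Real.pi * Complex.I : ℂ) • ∑ i, (k i : ℂ) • ContinuousLinearMap.proj i

lemma charForm_apply (k : Fin n → ℤ) (z : Fin n → ℂ) :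
    charForm k z = 2 * Real.pi * Complex.I * ∑ i, (k i : ℂ) * z i := by
  simp [charForm]

lemma hasFDerivAt_expChar (k : Fin n → ℤ) (z : Fin n → ℂ) :
    HasFDerivAt (expChar k) (expChar k z • charForm k) z := by
  have h := (charForm k).hasFDerivAt (x := z) |>.cexp
  simp only [charForm_apply] at h
  exact h

/-- Termwise differentiation on a ball around z. Summability of the differentials is kept in the
conclusion so that the sum can be evaluated at a vector. -/
lemma RapidDecay.hasFDerivAt {b : (Fin n → ℤ) → ℂ} (hb : RapidDecay b) (z : Fin n → ℂ) :
    HasFDerivAt (expSeries b) (∑' k, (b k * expChar k z) • charForm k) z ∧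
      Summable fun k => (b k * expChar k z) • charForm k := by
  have key : ∃ u : (Fin n → ℤ) → ℝ, Summable u ∧ ∀ k, ∀ w ∈ Metric.ball (0 : Fin n → ℂ) (‖z‖ + 1),
      ‖(b k * expChar k w) • charForm k‖ ≤ u k := by
    -- For the sup norm, the operator norm of the differential is at most the sum of its values on
    -- the coordinate vectors, each majorized through `mul_linear`.
    have h0 := fun i : Fin n => (hb.mul_linear (Pi.single i 1)).exists_bound (‖z‖ + 1)
    choose v hv hv' using h0
    refine ⟨fun k => ∑ i, v i k, summable_sum fun i _ => hv i, fun k w hw => ?_⟩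
    have hw' : ‖w‖ ≤ ‖z‖ + 1 := (mem_ball_zero_iff.1 hw).le
    have hv0 : ∀ i, 0 ≤ v i k := fun i => (norm_nonneg _).trans (hv' i k w hw')
    refine ContinuousLinearMap.opNorm_le_bound _ (Finset.sum_nonneg fun i _ => hv0 i) fun x => ?_
    have hx : ((b k * expChar k w) • charForm k) x =
        ∑ i, (b k * (2 * Real.pi * Complex.I * ∑ j, (k j : ℂ) * (Pi.single i 1 : Fin n → ℂ) j) *
          expChar k w) * x i := by
      simp only [smul_apply, charForm_apply, smul_eq_mul, Pi.single_apply, mul_ite,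
        mul_one, mul_zero, Finset.sum_ite_eq', Finset.mem_univ, if_true, Finset.mul_sum]
      exact Finset.sum_congr rfl fun i _ => by ring
    rw [hx, Finset.sum_mul]
    refine norm_sum_le_of_le _ fun i _ => ?_
    rw [norm_mul]
    exact mul_le_mul (hv' i k w hw') (norm_le_pi_norm x i) (norm_nonneg _) (hv0 i)
  obtain ⟨u, hu, hu'⟩ := key
  have hz : z ∈ Metric.ball (0 : Fin n → ℂ) (‖z‖ + 1) := by simp
  refine ⟨hasFDerivAt_tsum_of_isPreconnected hu Metric.isOpen_ball
    (convex_ball _ _).isPreconnected (fun k w _ => ?_) hu' hz (hb.summable z) hz,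
    Summable.of_norm_bounded hu fun k => hu' k z hz⟩
  have := (hasFDerivAt_expChar k w).const_mul (b k)
  rwa [smul_smul] at this

lemma RapidDecay.fderiv_apply {b : (Fin n → ℤ) → ℂ} (hb : RapidDecay b) (z v : Fin n → ℂ) :
    fderiv ℂ (expSeries b) z v =
      expSeries (fun k => b k * (2 * Real.pi * Complex.I * ∑ i, (k i : ℂ) * v i)) z := by
  obtain ⟨h1, h2⟩ := hb.hasFDerivAt z
  rw [h1.fderiv, expSeries]
  have h3 := (ContinuousLinearMap.apply ℂ ℂ v).map_tsum h2
  simp only [ContinuousLinearMap.apply_apply] at h3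
  rw [h3]
  refine tsum_congr fun k => ?_
  simp only [smul_apply, charForm_apply, smul_eq_mul]
  ring

/-- Every directional derivative is again the series of a rapidly decaying family, so induction on
the order applies with b varying. -/
lemma RapidDecay.contDiff {b : (Fin n → ℤ) → ℂ} (hb : RapidDecay b) :
    ContDiff ℂ ∞ (expSeries b) := by
  rw [contDiff_infty]
  intro m
  induction m generalizing b with
  | zero =>
    exact contDiff_zero.2
      (continuous_iff_continuousAt.2 fun z => (hb.hasFDerivAt z).1.continuousAt)
  | succ m ih =>
    rw [Nat.cast_add, Nat.cast_one, contDiff_succ_iff_fderiv_apply]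
    refine ⟨fun z => (hb.hasFDerivAt z).1.differentiableAt, fun h => by simp at h, fun v => ?_⟩
    simp only [hb.fderiv_apply]
    exact ih (hb.mul_linear v)

/-! ### Fourier coefficients on the torus -/

section Fourier

open MeasureTheory

variable {n : ℕ}

/-- Transfers continuity from the cover ℝⁿ × ℝⁿ, where smoothness is defined, to ℝⁿ × Tⁿ. -/
lemma isOpenQuotientMap_coverProj : IsOpenQuotientMap (coverProj (n := n)) := by
  have h : IsOpenQuotientMap (toTorus (n := n)) :=
    IsOpenQuotientMap.piMap (f := fun (_ : Fin n) (y : ℝ) => (y : UnitAddCircle))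
      fun _ => QuotientAddGroup.isOpenQuotientMap_mk
  exact IsOpenQuotientMap.id.prodMap h

lemma continuous_toTorus : Continuous (toTorus (n := n)) :=
  continuous_pi fun i => (AddCircle.continuous_mk' 1).comp (continuous_apply i)

lemma toTorus_surjective : Function.Surjective (toTorus (n := n)) := fun y =>
  ⟨fun i => (QuotientAddGroup.mk_surjective (y i)).choose,
    funext fun i => (QuotientAddGroup.mk_surjective (y i)).choose_spec⟩

lemma toTorus_add (y z : Fin n → ℝ) : toTorus (y + z) = toTorus y + toTorus z := by
  ext i; simp [toTorus]

lemma toTorus_zero : toTorus (0 : Fin n → ℝ) = 0 := by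
  ext i; simp [toTorus]

lemma toTorus_eq_iff (y z : Fin n → ℝ) :
    toTorus y = toTorus z ↔ ∃ k : Fin n → ℤ, ∀ i, y i = z i + k i := by
  constructor
  · intro h
    have h1 : ∀ i, ∃ k : ℤ, y i = z i + k := fun i => by
      have h2 : ((y i : ℝ) : UnitAddCircle) = ((z i : ℝ) : UnitAddCircle) := congrFun h i
      obtain ⟨k, hk⟩ := (QuotientAddGroup.eq_iff_sub_mem.1 h2)
      refine ⟨k, ?_⟩
      simp only [mul_one, zsmul_eq_mul] at hk
      linarith
    choose k hk using h1
    exact ⟨k, hk⟩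
  · rintro ⟨k, hk⟩
    ext i
    simp only [toTorus, hk i, AddCircle.coe_add]
    rw [add_eq_left]
    exact (AddCircle.coe_eq_zero_iff 1).2 ⟨k i, by simp⟩

lemma torusMul_toTorus (B : Matrix (Fin n) (Fin n) ℤ) (y : Fin n → ℝ) :
    torusMul B (toTorus y) = toTorus (B.map (Int.cast : ℤ → ℝ) *ᵥ y) := by
  ext i
  simp only [torusMul, toTorus, Matrix.mulVec, dotProduct, Matrix.map_apply]
  have h := map_sum (QuotientAddGroup.mk' (AddSubgroup.zmultiples (1 : ℝ)))
    (fun j => (B i j : ℝ) * y j) Finset.univ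
  refine Eq.trans ?_ h.symm
  refine Finset.sum_congr rfl fun j _ => ?_
  rw [← zsmul_eq_mul, map_zsmul]
  rfl

lemma continuous_torusChar (k : Fin n → ℤ) : Continuous (torusChar k) :=
  (UnitAddTorus.mFourier k).continuous

lemma norm_torusChar (k : Fin n → ℤ) (y : Torus n) : ‖torusChar k y‖ = 1 := by
  simp only [torusChar, norm_prod, fourier_apply, Circle.norm_coe, Finset.prod_const_one]

lemma torusChar_toTorus (k : Fin n → ℤ) (y : Fin n → ℝ) :
    torusChar k (toTorus y) = Complex.exp (2 * Real.pi * Complex.I * ∑ i, (k i : ℂ) * y i) := by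
  simp only [torusChar, toTorus, fourier_coe_apply, Finset.mul_sum, Complex.exp_sum]
  refine Finset.prod_congr rfl fun i _ => ?_
  congr 1
  push_cast
  ring

lemma torusChar_add (k : Fin n → ℤ) (y z : Torus n) :
    torusChar k (y + z) = torusChar k y * torusChar k z := by
  simp only [torusChar, fourier_apply, Pi.add_apply, smul_add, AddCircle.toCircle_add,
    Circle.coe_mul, Finset.prod_mul_distrib]

lemma torusChar_add_left (k l : Fin n → ℤ) (y : Torus n) :
    torusChar (k + l) y = torusChar k y * torusChar l y := by
  simp only [torusChar, Pi.add_apply, fourier_add, Finset.prod_mul_distrib]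

/-- The normalized Haar measure of the torus. -/
noncomputable def torusHaar (n : ℕ) : Measure (Torus n) :=
  Measure.pi fun _ => AddCircle.haarAddCircle

instance : IsProbabilityMeasure (torusHaar n) := by
  unfold torusHaar; infer_instance

instance : (torusHaar n).IsAddHaarMeasure := by
  unfold torusHaar; infer_instance

lemma mFourierCoeff_eq (f : Torus n → ℂ) (k : Fin n → ℤ) :
    UnitAddTorus.mFourierCoeff f k = ∫ y, torusChar (-k) y * f y ∂torusHaar n := rfl

lemma integrable_of_continuous {f : Torus n → ℂ} (hf : Continuous f) :
    Integrable f (torusHaar n) := by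
  obtain ⟨C, hC⟩ := isCompact_univ.exists_bound_of_continuousOn hf.continuousOn
  exact Integrable.of_bound hf.aestronglyMeasurable C
    (Filter.Eventually.of_forall fun y => hC y (Set.mem_univ y))

lemma norm_mFourierCoeff_le {f : Torus n → ℂ} {C : ℝ} (hf : ∀ y, ‖f y‖ ≤ C) (k : Fin n → ℤ) :
    ‖UnitAddTorus.mFourierCoeff f k‖ ≤ C := by
  rw [mFourierCoeff_eq]
  refine (norm_integral_le_of_norm_le_const (C := C)
    (Filter.Eventually.of_forall fun y => ?_)).trans_eq (by simp)
  rw [norm_mul, norm_torusChar, one_mul]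
  exact hf y

lemma mFourierCoeff_const_mul (c : ℂ) (f : Torus n → ℂ) (k : Fin n → ℤ) :
    UnitAddTorus.mFourierCoeff (fun y => c * f y) k = c * UnitAddTorus.mFourierCoeff f k := by
  simp only [mFourierCoeff_eq]
  rw [← integral_const_mul]
  congr 1
  ext y
  ring

lemma mFourierCoeff_sum {ι : Type*} (t : Finset ι) (f : ι → Torus n → ℂ)
    (hf : ∀ i, Continuous (f i)) (k : Fin n → ℤ) :
    UnitAddTorus.mFourierCoeff (fun y => ∑ i ∈ t, f i y) k =
      ∑ i ∈ t, UnitAddTorus.mFourierCoeff (f i) k := by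
  simp only [mFourierCoeff_eq, Finset.mul_sum]
  exact integral_finsetSum _ fun i _ =>
    integrable_of_continuous ((continuous_torusChar _).mul (hf i))

/-- Orthonormality of the characters, read off as the coordinates of a vector of the Hilbert basis
`mFourierBasis`. -/
lemma mFourierCoeff_torusChar (k l : Fin n → ℤ) :
    UnitAddTorus.mFourierCoeff (torusChar k) l = if k = l then 1 else 0 := by
  refine (UnitAddTorus.mFourierCoeff_toLp (UnitAddTorus.mFourier k) l).symm.trans ?_
  refine (UnitAddTorus.mFourierBasis_repr _ _).symm.trans ?_
  have h : UnitAddTorus.mFourierLp 2 k = UnitAddTorus.mFourierBasis (d := Fin n) k := by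
    rw [UnitAddTorus.coe_mFourierBasis]
  change (UnitAddTorus.mFourierBasis (d := Fin n)).repr (UnitAddTorus.mFourierLp 2 k) l = _
  rw [h, HilbertBasis.repr_self]
  simp [lp.single_apply, Pi.single_apply, eq_comm]

lemma tendsto_mFourierCoeff {ι : Type*} {l : Filter ι} [l.NeBot] {G : ι → Torus n → ℂ}
    {f : Torus n → ℂ} (hG : ∀ i, Continuous (G i)) (h : TendstoUniformly G f l) (k : Fin n → ℤ) :
    Filter.Tendsto (fun i => UnitAddTorus.mFourierCoeff (G i) k) l
      (nhds (UnitAddTorus.mFourierCoeff f k)) := by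
  have hf : Continuous f := h.continuous (Filter.Frequently.of_forall hG)
  rw [Metric.tendsto_nhds]
  intro ε hε
  filter_upwards [Metric.tendstoUniformly_iff.1 h (ε / 2) (half_pos hε)] with i hi
  have h1 : Continuous fun y => torusChar (-k) y * G i y := (continuous_torusChar _).mul (hG i)
  have h2 : Continuous fun y => torusChar (-k) y * f y := (continuous_torusChar _).mul hf
  rw [dist_eq_norm, mFourierCoeff_eq, mFourierCoeff_eq, ← integral_sub
    (integrable_of_continuous h1) (integrable_of_continuous h2)]
  refine lt_of_le_of_lt (norm_integral_le_of_norm_le_const (C := ε / 2)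
    (Filter.Eventually.of_forall fun y => ?_)) (by simpa using half_lt_self hε)
  rw [← mul_sub, norm_mul, norm_torusChar, one_mul, ← dist_eq_norm, dist_comm]
  exact (hi y).le

lemma hasSum_mFourierCoeff {ι : Type*} {F : ι → Torus n → ℂ} {f : Torus n → ℂ}
    (hF : ∀ i, Continuous (F i)) (h : TendstoUniformly (fun t y => ∑ i ∈ t, F i y) f Filter.atTop)
    (k : Fin n → ℤ) :
    HasSum (fun i => UnitAddTorus.mFourierCoeff (F i) k) (UnitAddTorus.mFourierCoeff f k) := by
  have h1 := tendsto_mFourierCoeff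
    (fun t => continuous_finsetSum t fun i _ => hF i) h k
  rw [HasSum]
  simpa only [mFourierCoeff_sum _ _ hF, SummationFilter.unconditional_filter] using h1

/-- The Fourier coefficients of an absolutely convergent series of distinct characters. -/
lemma mFourierCoeff_tsum {ι : Type*} {κ : ι → Fin n → ℤ} {c : ι → ℂ} (hc : Summable fun i => ‖c i‖)
    (k : Fin n → ℤ) :
    HasSum (fun i => c i * if κ i = k then 1 else 0)
      (UnitAddTorus.mFourierCoeff (fun y => ∑' i, c i * torusChar (κ i) y) k) := by
  have h := hasSum_mFourierCoeff (F := fun i y => c i * torusChar (κ i) y)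
    (f := fun y => ∑' i, c i * torusChar (κ i) y)
    (fun i => continuous_const.mul (continuous_torusChar _)) (by
      rw [← tendstoUniformlyOn_univ]
      refine tendstoUniformlyOn_tsum hc fun i y _ => ?_
      rw [norm_mul, norm_torusChar, mul_one]) k
  simpa only [mFourierCoeff_const_mul, mFourierCoeff_torusChar] using h

/-! ### Means of periodic holomorphic functions -/

lemma continuous_of_comp_coverProj {X : Type*} [TopologicalSpace X] {f : Total n → X}
    (hf : Continuous fun p => f (coverProj p)) : Continuous f :=
  isOpenQuotientMap_coverProj.continuous_comp_iff.1 hf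

/-- If `∂_V f = √-1 ∂_{y_j} f`, then the mean of `f` over the fibres is constant along `V`. -/
lemma integral_fibre_translate {f : Total n → ℂ}
    (hf : Differentiable ℝ fun p : Cover n => f (coverProj p)) (j : Fin n) (V : Cover n)
    (hV : ∀ p, fderiv ℝ (fun p : Cover n => f (coverProj p)) p V =
      Complex.I * fderiv ℝ (fun p : Cover n => f (coverProj p)) p (0, Pi.single j 1))
    (x : Fin n → ℝ) (b : ℝ) :
    ∫ y, f (x + b • V.1, y) ∂torusHaar n = ∫ y, f (x, y) ∂torusHaar n := by
  have hfc : Continuous f := continuous_of_comp_coverProj hf.continuous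
  set W : Cover n := (0, Pi.single j 1) with hW
  -- Cauchy's theorem on a rectangle with sides 1 and b in the complex line through e_j and V, for
  -- each fixed starting point y.
  have key : ∀ y : Torus n,
      ∫ a in (0 : ℝ)..1, f (x, y + toTorus (a • Pi.single j 1)) =
        ∫ a in (0 : ℝ)..1, f (x + b • V.1, y + toTorus (a • Pi.single j 1 + b • V.2)) := by
    intro y
    obtain ⟨y, rfl⟩ := toTorus_surjective y
    -- 1 goes to ∂_{y_j} and √-1 to V, so `hV` is the Cauchy-Riemann equation for φ.
    let A : ℂ →L[ℝ] Cover n := Complex.reCLM.smulRight W + Complex.imCLM.smulRight V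
    let φ : ℂ → ℂ := fun ζ => f (coverProj ((x, y) + A ζ))
    have hA : ∀ ζ, A ζ = ζ.re • W + ζ.im • V := fun ζ => rfl
    have hφ' : ∀ ζ, HasFDerivAt φ
        ((fderiv ℝ (fun p : Cover n => f (coverProj p)) ((x, y) + A ζ)).comp A) ζ := fun ζ =>
      (hf _).hasFDerivAt.comp ζ (A.hasFDerivAt.const_add (x, y))
    have hφ : Differentiable ℂ φ := by
      intro ζ
      rw [differentiableAt_complex_iff_differentiableAt_real]
      refine ⟨(hφ' ζ).differentiableAt, ?_⟩
      rw [(hφ' ζ).fderiv]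
      simp only [ContinuousLinearMap.comp_apply, hA, Complex.I_re, Complex.I_im, Complex.one_re,
        Complex.one_im, zero_smul, one_smul, zero_add, add_zero, hV, smul_eq_mul]
    have hper : ∀ ζ, φ (ζ + 1) = φ ζ := by
      intro ζ
      have h1 : coverProj ((x, y) + A (ζ + 1)) = coverProj ((x, y) + A ζ) := by
        refine Prod.ext ?_ ?_
        · simp [coverProj, hA, hW]
        · refine (toTorus_eq_iff _ _).2 ⟨Pi.single j 1, fun i => ?_⟩
          by_cases h : i = j
          · subst h; simp [hA, hW]; ring
          · simp [hA, hW, h]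
      simp only [φ, h1]
    have hrect := Complex.integral_boundary_rect_eq_zero_of_differentiableOn φ 0 (1 + b * Complex.I)
      hφ.differentiableOn
    -- By the period 1 in the direction e_j, the two vertical sides of the contour cancel.
    have hside : ∀ t : ℝ, φ (((1 + b * Complex.I : ℂ).re : ℂ) + t * Complex.I) =
        φ (((0 : ℂ).re : ℂ) + t * Complex.I) := by
      intro t
      refine Eq.trans ?_ (hper _)
      congr 1
      simp
      ring
    simp only [hside, add_sub_cancel_right] at hrect
    have h2 := sub_eq_zero.1 hrect
    have hre : (1 + b * Complex.I : ℂ).re = 1 := by simp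
    have him : (1 + b * Complex.I : ℂ).im = b := by simp
    have e1 : ∀ a : ℝ, φ ((a : ℂ) + ((0 : ℂ).im : ℂ) * Complex.I) =
        f (x, toTorus y + toTorus (a • Pi.single j 1)) := by
      intro a
      simp [φ, hA, hW, coverProj, toTorus_add, toTorus_zero]
    have e2 : ∀ a : ℝ, φ ((a : ℂ) + (b : ℂ) * Complex.I) =
        f (x + b • V.1, toTorus y + toTorus (a • Pi.single j 1 + b • V.2)) := by
      intro a
      simp [φ, hA, hW, coverProj, toTorus_add]
    rw [hre, him, Complex.zero_re] at h2
    simpa only [e1, e2] using h2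
  -- After Fubini, translation invariance of Haar measure removes the shift by a e_j + c, so the
  -- average over a disappears.
  have swap : ∀ (x' c : Fin n → ℝ),
      ∫ y, (∫ a in (0 : ℝ)..1, f (x', y + toTorus (a • Pi.single j 1 + c))) ∂torusHaar n =
        ∫ y, f (x', y) ∂torusHaar n := by
    intro x' c
    have hc : Continuous (Function.uncurry fun (a : ℝ) (y : Torus n) =>
        f (x', y + toTorus (a • Pi.single j 1 + c))) := by
      refine hfc.comp (continuous_const.prodMk (continuous_snd.add (continuous_toTorus.comp ?_)))
      fun_prop
    obtain ⟨C, hC⟩ := isCompact_univ.exists_bound_of_continuousOn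
      (hfc.comp (continuous_const.prodMk continuous_id : Continuous fun y : Torus n => (x', y))
        ).continuousOn
    rw [← intervalIntegral_integral_swap]
    · simp only [integral_add_right_eq_self (fun y => f (x', y))]
      simp
    · rw [Set.uIoc_of_le zero_le_one]
      refine Integrable.of_bound hc.aestronglyMeasurable C
        (Filter.Eventually.of_forall fun p => hC _ (Set.mem_univ _))
  have h1 := swap x 0
  have h2 := swap (x + b • V.1) (b • V.2)
  simp only [add_zero] at h1
  rw [← h1, ← h2]
  exact integral_congr_ae (Filter.Eventually.of_forall fun y => (key y).symm)

end Fourier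

/-! ### Linear algebra of the Siegel upper half space -/

section Siegel

variable {n : ℕ} {Z : Matrix (Fin n) (Fin n) ℂ}

lemma siegel_re_symm (hZ : Z ∈ siegel n) : (Z.map Complex.re)ᵀ = Z.map Complex.re := by
  rw [← Matrix.transpose_map, hZ.1]

lemma siegel_im_symm (hZ : Z ∈ siegel n) : (Z.map Complex.im)ᵀ = Z.map Complex.im := by
  rw [← Matrix.transpose_map, hZ.1]

lemma siegelP_posDef (hZ : Z ∈ siegel n) : (siegelP Z).PosDef := by
  have h := (hZ.2.inv.posSemidef).mul_mul_conjTranspose_same (Z.map Complex.re)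
  rw [Matrix.conjTranspose_eq_transpose_of_trivial, siegel_re_symm hZ] at h
  exact hZ.2.add_posSemidef h

lemma siegelP_symm (hZ : Z ∈ siegel n) : (siegelP Z)ᵀ = siegelP Z := by
  have h := (siegelP_posDef hZ).1
  rwa [Matrix.IsHermitian, Matrix.conjTranspose_eq_transpose_of_trivial] at h

lemma posDef_isUnit_det {M : Matrix (Fin n) (Fin n) ℝ} (h : M.PosDef) : IsUnit M.det :=
  (Matrix.isUnit_iff_isUnit_det _).1 h.isUnit

/-- `P⁻¹ X Y⁻¹ = Y⁻¹ X P⁻¹`. -/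
lemma siegel_comm (hZ : Z ∈ siegel n) :
    (siegelP Z)⁻¹ * Z.map Complex.re * (Z.map Complex.im)⁻¹ =
      (Z.map Complex.im)⁻¹ * Z.map Complex.re * (siegelP Z)⁻¹ := by
  have hY := posDef_isUnit_det hZ.2
  have hP := posDef_isUnit_det (siegelP_posDef hZ)
  set X := Z.map Complex.re
  set Y := Z.map Complex.im
  -- Both sides equal X + X Y⁻¹ X Y⁻¹ X; the claim follows on multiplying by P⁻¹ on the left and on
  -- the right.
  have h : X * Y⁻¹ * siegelP Z = siegelP Z * (Y⁻¹ * X) := by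
    simp only [siegelP, Matrix.mul_add, Matrix.add_mul]
    rw [Matrix.nonsing_inv_mul_cancel_right _ _ hY, Matrix.mul_nonsing_inv_cancel_left _ _ hY]
    simp only [Matrix.mul_assoc]
    rfl
  calc (siegelP Z)⁻¹ * X * Y⁻¹
      = (siegelP Z)⁻¹ * (X * Y⁻¹ * siegelP Z) * (siegelP Z)⁻¹ := by
        rw [Matrix.mul_assoc, Matrix.mul_assoc, Matrix.mul_nonsing_inv_cancel_right _ _ hP]
    _ = _ := by rw [h, Matrix.nonsing_inv_mul_cancel_left _ _ hP]

/-- Z Y⁻¹ = X Y⁻¹ + √-1 splits Ω into its real part P⁻¹ X Y⁻¹ and its imaginary part P⁻¹. -/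
lemma siegelOmega_eq (hZ : Z ∈ siegel n) :
    siegelOmega Z = ((siegelP Z)⁻¹ * Z.map Complex.re * (Z.map Complex.im)⁻¹).map Complex.ofReal +
      Complex.I • ((siegelP Z)⁻¹).map Complex.ofReal := by
  have hY := posDef_isUnit_det hZ.2
  have h1 : Z = (Z.map Complex.re).map Complex.ofReal +
      Complex.I • (Z.map Complex.im).map Complex.ofReal := by
    ext i j
    simp only [Matrix.add_apply, Matrix.smul_apply, Matrix.map_apply, smul_eq_mul]
    rw [mul_comm]
    exact (Complex.re_add_im _).symm
  have hmul : ∀ A B : Matrix (Fin n) (Fin n) ℝ,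
      (A * B).map Complex.ofReal = A.map Complex.ofReal * B.map Complex.ofReal := fun A B =>
    Matrix.map_mul (f := Complex.ofRealHom)
  have h2 : (Z.map Complex.im).map Complex.ofReal * ((Z.map Complex.im)⁻¹).map Complex.ofReal =
      1 := by
    rw [← hmul, Matrix.mul_nonsing_inv _ hY]
    exact Matrix.map_one _ Complex.ofReal_zero Complex.ofReal_one
  have h3 : siegelOmega Z = ((siegelP Z)⁻¹).map Complex.ofReal *
      ((Z.map Complex.re).map Complex.ofReal + Complex.I • (Z.map Complex.im).map Complex.ofReal) *
        ((Z.map Complex.im)⁻¹).map Complex.ofReal := by rw [← h1, siegelOmega]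
  rw [h3, hmul, hmul]
  simp only [Matrix.mul_add, Matrix.add_mul, Matrix.smul_mul, Matrix.mul_smul]
  rw [Matrix.mul_assoc _ ((Z.map Complex.im).map Complex.ofReal), h2, Matrix.mul_one]

/-- Transposition exchanges the two sides of `siegel_comm`, so the real part is symmetric; the
imaginary part P⁻¹ is too. -/
lemma siegelOmega_symm (hZ : Z ∈ siegel n) : (siegelOmega Z)ᵀ = siegelOmega Z := by
  rw [siegelOmega_eq hZ, Matrix.transpose_add, Matrix.transpose_smul, ← Matrix.transpose_map,
    ← Matrix.transpose_map, Matrix.transpose_nonsing_inv, siegelP_symm hZ, Matrix.transpose_mul,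
    Matrix.transpose_mul, Matrix.transpose_nonsing_inv, Matrix.transpose_nonsing_inv,
    siegelP_symm hZ, siegel_re_symm hZ, siegel_im_symm hZ, siegel_comm hZ, Matrix.mul_assoc]

lemma siegelOmega_im (hZ : Z ∈ siegel n) : (siegelOmega Z).map Complex.im = (siegelP Z)⁻¹ := by
  rw [siegelOmega_eq hZ]
  ext i j
  simp

lemma siegelOmega_im_posDef (hZ : Z ∈ siegel n) : ((siegelOmega Z).map Complex.im).PosDef := by
  rw [siegelOmega_im hZ]
  exact (siegelP_posDef hZ).inv

/-- `Ω P = Y⁻¹ X + √-1`. -/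
lemma siegelOmega_mul_P (hZ : Z ∈ siegel n) :
    siegelOmega Z * (siegelP Z).map Complex.ofReal =
      ((Z.map Complex.im)⁻¹ * Z.map Complex.re).map Complex.ofReal + Complex.I • 1 := by
  have hP := posDef_isUnit_det (siegelP_posDef hZ)
  have hmul : ∀ A B : Matrix (Fin n) (Fin n) ℝ,
      (A * B).map Complex.ofReal = A.map Complex.ofReal * B.map Complex.ofReal := fun A B =>
    Matrix.map_mul (f := Complex.ofRealHom)
  rw [siegelOmega_eq hZ, siegel_comm hZ, Matrix.add_mul, Matrix.smul_mul, ← hmul, ← hmul,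
    Matrix.nonsing_inv_mul_cancel_right _ _ hP, Matrix.nonsing_inv_mul _ hP]
  congr 2
  exact Matrix.map_one _ Complex.ofReal_zero Complex.ofReal_one

/-- `Y⁻¹ - Ω X Y⁻¹ = -√-1 Ω`. -/
lemma siegelOmega_mul_re (hZ : Z ∈ siegel n) :
    ((Z.map Complex.im)⁻¹).map Complex.ofReal -
      siegelOmega Z * (Z.map Complex.re * (Z.map Complex.im)⁻¹).map Complex.ofReal =
      -(Complex.I • siegelOmega Z) := by
  have hP := posDef_isUnit_det (siegelP_posDef hZ)
  have hY := posDef_isUnit_det hZ.2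
  have hmul : ∀ A B : Matrix (Fin n) (Fin n) ℝ,
      (A * B).map Complex.ofReal = A.map Complex.ofReal * B.map Complex.ofReal := fun A B =>
    Matrix.map_mul (f := Complex.ofRealHom)
  -- This is P Y⁻¹ = 1 + (X Y⁻¹)² multiplied by P⁻¹; its second summand cancels against the real
  -- part of Ω times X Y⁻¹.
  have h1 : (Z.map Complex.im)⁻¹ = (siegelP Z)⁻¹ +
      (siegelP Z)⁻¹ * Z.map Complex.re * (Z.map Complex.im)⁻¹ *
        (Z.map Complex.re * (Z.map Complex.im)⁻¹) := by
    have h2 : siegelP Z * (Z.map Complex.im)⁻¹ = 1 + Z.map Complex.re * (Z.map Complex.im)⁻¹ *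
        (Z.map Complex.re * (Z.map Complex.im)⁻¹) := by
      rw [siegelP, Matrix.add_mul, Matrix.mul_nonsing_inv _ hY]
      simp only [Matrix.mul_assoc]
    conv_lhs => rw [← Matrix.nonsing_inv_mul_cancel_left _ (Z.map Complex.im)⁻¹ hP, h2, Matrix.mul_add,
      Matrix.mul_one]
    simp only [Matrix.mul_assoc]
  rw [siegelOmega_eq hZ, Matrix.add_mul, ← hmul, Matrix.smul_mul, ← hmul]
  conv_lhs => enter [1]; rw [h1]
  rw [Matrix.map_add _ Complex.ofReal_add, smul_add, smul_smul, Complex.I_mul_I]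
  simp only [Matrix.mul_assoc]
  ext i j
  simp
  ring

end Siegel

/-! ### The complex coordinate `ζ = y - Ω x` -/

section Zeta

variable {n : ℕ}

/-- A real vector as a complex one. -/
def toComplex (x : Fin n → ℝ) : Fin n → ℂ := fun i => (x i : ℂ)

lemma toComplex_mulVec (M : Matrix (Fin n) (Fin n) ℝ) (x : Fin n → ℝ) :
    toComplex (M *ᵥ x) = M.map Complex.ofReal *ᵥ toComplex x := by
  ext i
  simp [toComplex, Matrix.mulVec, dotProduct]

lemma toComplex_add (x y : Fin n → ℝ) : toComplex (x + y) = toComplex x + toComplex y := by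
  ext i; simp [toComplex]

lemma toComplex_sub (x y : Fin n → ℝ) : toComplex (x - y) = toComplex x - toComplex y := by
  ext i; simp [toComplex]

lemma toComplex_neg (x : Fin n → ℝ) : toComplex (-x) = -toComplex x := by
  ext i; simp [toComplex]

lemma toComplex_smul (r : ℝ) (x : Fin n → ℝ) : toComplex (r • x) = (r : ℂ) • toComplex x := by
  ext i; simp [toComplex]

lemma toComplex_dotProduct (x y : Fin n → ℝ) :
    toComplex x ⬝ᵥ toComplex y = ((x ⬝ᵥ y : ℝ) : ℂ) := by
  simp [toComplex, dotProduct]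

lemma im_mulVec_toComplex (M : Matrix (Fin n) (Fin n) ℂ) (x : Fin n → ℝ) (i : Fin n) :
    ((M *ᵥ toComplex x) i).im = (M.map Complex.im *ᵥ x) i := by
  simp [toComplex, Matrix.mulVec, dotProduct]

/-- The complex coordinates `y - Ω x` of `ℝⁿ × ℝⁿ`. -/
noncomputable def zetaMap (Om : Matrix (Fin n) (Fin n) ℂ) : Cover n →L[ℝ] (Fin n → ℂ) :=
  LinearMap.toContinuousLinearMap
    { toFun := fun v => toComplex v.2 - Om *ᵥ toComplex v.1
      map_add' := fun v w => by
        simp only [Prod.snd_add, Prod.fst_add, toComplex_add, Matrix.mulVec_add]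
        abel
      map_smul' := fun r v => by
        simp only [Prod.smul_snd, Prod.smul_fst, toComplex_smul, Matrix.mulVec_smul, RingHom.id_apply,
          smul_sub]
        rfl }

lemma zetaMap_apply (Om : Matrix (Fin n) (Fin n) ℂ) (v : Cover n) :
    zetaMap Om v = toComplex v.2 - Om *ᵥ toComplex v.1 := rfl

/-- The imaginary part of y - Ω x is -(Im Ω) x, so a zero of ζ has x = 0 and then y = 0; both spaces
have real dimension 2n. -/
lemma zetaMap_bijective {Om : Matrix (Fin n) (Fin n) ℂ} (hOm : (Om.map Complex.im).PosDef) :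
    Function.Bijective (zetaMap Om) := by
  have hinj : Function.Injective (zetaMap Om) := by
    refine (injective_iff_map_eq_zero _).2 fun v hv => ?_
    rw [zetaMap_apply] at hv
    have h1 : Om.map Complex.im *ᵥ v.1 = 0 := by
      ext i
      have := congrArg Complex.im (congrFun hv i)
      simp only [Pi.sub_apply, Complex.sub_im, im_mulVec_toComplex] at this
      simpa [toComplex] using this
    have h2 : v.1 = 0 := by
      have h3 := congrArg ((Om.map Complex.im)⁻¹ *ᵥ ·) h1
      simpa [Matrix.mulVec_mulVec, Matrix.nonsing_inv_mul _ (posDef_isUnit_det hOm)] using h3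
    have h4 : v.2 = 0 := by
      ext i
      have := congrFun hv i
      rw [h2] at this
      simpa [toComplex, Matrix.mulVec, dotProduct] using this
    exact Prod.ext h2 h4
  refine ⟨hinj, ?_⟩
  have hd : Module.finrank ℝ (Cover n) = Module.finrank ℝ (Fin n → ℂ) := by
    simp [Module.finrank_pi_fintype, Complex.finrank_real_complex, mul_two]
  exact (LinearMap.injective_iff_surjective_of_finrank_eq_finrank
    (f := (zetaMap Om : Cover n →ₗ[ℝ] (Fin n → ℂ))) hd).1 hinj

lemma applyTangent_fst (a b c d : Matrix (Fin n) (Fin n) ℝ) (v : Cover n) :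
    (applyTangent (Matrix.fromBlocks a b c d) v).1 = a *ᵥ v.1 + b *ᵥ v.2 := by
  ext i
  simp [applyTangent, Matrix.fromBlocks_mulVec]

lemma applyTangent_snd (a b c d : Matrix (Fin n) (Fin n) ℝ) (v : Cover n) :
    (applyTangent (Matrix.fromBlocks a b c d) v).2 = c *ᵥ v.1 + d *ᵥ v.2 := by
  ext i
  simp [applyTangent, Matrix.fromBlocks_mulVec]

lemma applyTangent_mul (J K : Matrix (Fin n ⊕ Fin n) (Fin n ⊕ Fin n) ℝ) (v : Cover n) :
    applyTangent (J * K) v = applyTangent J (applyTangent K v) := by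
  have h : K *ᵥ Sum.elim v.1 v.2 =
      Sum.elim (applyTangent K v).1 (applyTangent K v).2 := by
    ext i
    cases i <;> rfl
  simp only [applyTangent, ← Matrix.mulVec_mulVec]
  rw [h]
  rfl

/-- The coordinates `y - Ω x` turn `J_Z` into multiplication by `√-1`. -/
lemma zetaMap_siegelJ {Z : Matrix (Fin n) (Fin n) ℂ} (hZ : Z ∈ siegel n) (v : Cover n) :
    zetaMap (siegelOmega Z) (applyTangent (siegelJ Z) v) =
      Complex.I • zetaMap (siegelOmega Z) v := by
  -- The two matrix identities are the ∂_y and ∂_x components of the claim.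
  have e1 := congrArg (· *ᵥ toComplex v.2) (siegelOmega_mul_P hZ)
  have e2 := congrArg (· *ᵥ toComplex v.1) (siegelOmega_mul_re hZ)
  simp only [Matrix.add_mulVec, Matrix.sub_mulVec, Matrix.neg_mulVec, Matrix.smul_mulVec,
    Matrix.one_mulVec, ← Matrix.mulVec_mulVec, ← toComplex_mulVec] at e1 e2
  rw [zetaMap_apply, zetaMap_apply, siegelJ, applyTangent_fst, applyTangent_snd]
  simp only [toComplex_add, Matrix.mulVec_add, Matrix.neg_mulVec, toComplex_neg, Matrix.mulVec_neg,
    smul_sub, e1]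
  simp only [Matrix.mulVec_mulVec] at e2 ⊢
  rw [sub_eq_add_neg (Complex.I • toComplex v.2), ← e2]
  abel

end Zeta

/-! ### Gaussian solutions and the decay of their coefficients -/

section BasicTerms

variable {n : ℕ}

/-- The quadratic form `ξ · Ω ξ`. -/
def quadForm (Om : Matrix (Fin n) (Fin n) ℂ) (ξ : Fin n → ℂ) : ℂ := ξ ⬝ᵥ (Om *ᵥ ξ)

lemma dotProduct_mulVec_comm_of_symm {R : Type*} [CommRing R] {M : Matrix (Fin n) (Fin n) R}
    (hM : Mᵀ = M) (a b : Fin n → R) : a ⬝ᵥ (M *ᵥ b) = b ⬝ᵥ (M *ᵥ a) := by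
  rw [Matrix.dotProduct_mulVec, ← Matrix.mulVec_transpose, hM, dotProduct_comm]

lemma quadForm_sub {Om : Matrix (Fin n) (Fin n) ℂ} (hs : Omᵀ = Om) (a b : Fin n → ℂ) :
    quadForm Om (a - b) = quadForm Om a - 2 * (b ⬝ᵥ (Om *ᵥ a)) + quadForm Om b := by
  simp only [quadForm, Matrix.mulVec_sub, sub_dotProduct, dotProduct_sub,
    dotProduct_mulVec_comm_of_symm hs a b]
  ring

lemma quadForm_smul (Om : Matrix (Fin n) (Fin n) ℂ) (c : ℂ) (a : Fin n → ℂ) :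
    quadForm Om (c • a) = c ^ 2 * quadForm Om a := by
  simp only [quadForm, Matrix.mulVec_smul, smul_dotProduct, dotProduct_smul, smul_eq_mul]
  ring

lemma quadForm_toComplex_im (Om : Matrix (Fin n) (Fin n) ℂ) (x : Fin n → ℝ) :
    (quadForm Om (toComplex x)).im = x ⬝ᵥ (Om.map Complex.im *ᵥ x) := by
  simp only [quadForm, dotProduct, Complex.im_sum]
  refine Finset.sum_congr rfl fun i _ => ?_
  rw [Complex.mul_im, im_mulVec_toComplex]
  simp [toComplex]

/-- The solutions `exp (2π√-1 {N/2 (x - k/N) · Ω (x - k/N) + k · y})` of the equation of holomorphic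
sections. -/
noncomputable def basicTerm (N : ℕ) (Om : Matrix (Fin n) (Fin n) ℂ) (k : Fin n → ℤ) (p : Total n) :
    ℂ :=
  Complex.exp (2 * Real.pi * Complex.I * N * (1 / 2 * quadForm Om (toComplex (p.1 - ratPoint N k)))) *
    torusChar k p.2

/-- The function `exp (π√-1 N x · Ω x)`. -/
noncomputable def vacuum (N : ℕ) (Om : Matrix (Fin n) (Fin n) ℂ) (x : Fin n → ℝ) : ℂ :=
  Complex.exp (Real.pi * Complex.I * N * quadForm Om (toComplex x))

/-- The constants `exp (π√-1 k · Ω k / N)`. -/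
noncomputable def gaussCoeff (N : ℕ) (Om : Matrix (Fin n) (Fin n) ℂ) (k : Fin n → ℤ) : ℂ :=
  Complex.exp (Real.pi * Complex.I / N * quadForm Om (fun i => (k i : ℂ)))

lemma vacuum_ne_zero (N : ℕ) (Om : Matrix (Fin n) (Fin n) ℂ) (x : Fin n → ℝ) :
    vacuum N Om x ≠ 0 := Complex.exp_ne_zero _

lemma gaussCoeff_ne_zero (N : ℕ) (Om : Matrix (Fin n) (Fin n) ℂ) (k : Fin n → ℤ) :
    gaussCoeff N Om k ≠ 0 := Complex.exp_ne_zero _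

/-- Expanding the square, the cross term -k · Ω x combines with k · y into k · ζ. Symmetry of Ω
merges the two cross terms. -/
lemma basicTerm_coverProj {N : ℕ} (hN : 0 < N) {Om : Matrix (Fin n) (Fin n) ℂ} (hs : Omᵀ = Om)
    (k : Fin n → ℤ) (p : Cover n) :
    basicTerm N Om k (coverProj p) =
      vacuum N Om p.1 * (gaussCoeff N Om k * expChar k (zetaMap Om p)) := by
  have hN' : (N : ℂ) ≠ 0 := by exact_mod_cast hN.ne'
  have h1 : toComplex (ratPoint N k) = (1 / N : ℂ) • fun i => (k i : ℂ) := by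
    ext i; simp [toComplex, ratPoint]; ring
  have h2 : ∑ i, (k i : ℂ) * zetaMap Om p i = (∑ i, (k i : ℂ) * p.2 i) -
      (fun i => (k i : ℂ)) ⬝ᵥ (Om *ᵥ toComplex p.1) := by
    simp [zetaMap_apply, dotProduct, mul_sub, toComplex]
  simp only [basicTerm, vacuum, gaussCoeff, expChar, coverProj, torusChar_toTorus]
  rw [← Complex.exp_add, ← Complex.exp_add, ← Complex.exp_add, toComplex_sub, quadForm_sub hs, h1,
    quadForm_smul, smul_dotProduct, h2]
  congr 1
  simp only [smul_eq_mul]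
  field_simp
  ring

lemma norm_basicTerm_le {N : ℕ} {Om : Matrix (Fin n) (Fin n) ℂ}
    (hOm : (Om.map Complex.im).PosDef) (k : Fin n → ℤ) (p : Total n) : ‖basicTerm N Om k p‖ ≤ 1 := by
  have h0 := hOm.posSemidef.dotProduct_mulVec_nonneg (p.1 - ratPoint N k)
  simp only [star_trivial] at h0
  rw [← quadForm_toComplex_im] at h0
  rw [basicTerm, norm_mul, norm_torusChar, mul_one, Complex.norm_exp]
  refine Real.exp_le_one_iff.2 ?_
  have h1 : (2 * Real.pi * Complex.I * N *
      (1 / 2 * quadForm Om (toComplex (p.1 - ratPoint N k))) : ℂ) =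
      ((Real.pi * N : ℝ) : ℂ) * (Complex.I * quadForm Om (toComplex (p.1 - ratPoint N k))) := by
    push_cast; ring
  rw [h1, Complex.re_ofReal_mul, Complex.I_mul_re, mul_neg]
  exact neg_nonpos.2 (mul_nonneg (by positivity) h0)

lemma norm_expChar_zetaMap (Om : Matrix (Fin n) (Fin n) ℂ) (k : Fin n → ℤ) (p : Cover n) :
    ‖expChar k (zetaMap Om p)‖ =
      Real.exp (2 * Real.pi * ∑ i, (k i : ℝ) * (Om.map Complex.im *ᵥ p.1) i) := by
  rw [expChar, Complex.norm_exp]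
  congr 1
  have h1 : (2 * Real.pi * Complex.I * ∑ i, (k i : ℂ) * zetaMap Om p i : ℂ) =
      ((2 * Real.pi : ℝ) : ℂ) * (Complex.I * ∑ i, (k i : ℂ) * zetaMap Om p i) := by
    push_cast; ring
  rw [h1, Complex.re_ofReal_mul, Complex.I_mul_re, Complex.im_sum, ← Finset.sum_neg_distrib]
  congr 1
  refine Finset.sum_congr rfl fun i _ => ?_
  rw [Complex.mul_im, zetaMap_apply, Pi.sub_apply, Complex.sub_im, im_mulVec_toComplex]
  simp [toComplex]

/-- At (x, 0) the k-th character has norm exp (2π k · (Im Ω) x). Solving 2π (Im Ω) x = R sign(k)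
makes this exp (R |k|₁), so the bound at that x is a decay estimate of rate R. -/
lemma rapidDecay_of_bound {Om : Matrix (Fin n) (Fin n) ℂ} (hOm : (Om.map Complex.im).PosDef)
    {b : (Fin n → ℤ) → ℂ} (M : (Fin n → ℝ) → ℝ)
    (h : ∀ x k, ‖b k * expChar k (zetaMap Om (x, 0))‖ ≤ M x) : RapidDecay b := by
  intro R
  -- There are only finitely many sign vectors, so summing the bounds at these points gives a
  -- constant independent of k.
  let pt : (Fin n → SignType) → Fin n → ℝ := fun σ =>
    (Om.map Complex.im)⁻¹ *ᵥ fun i => R / (2 * Real.pi) * (σ i : ℝ)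
  refine ⟨∑ σ, |M (pt σ)|, fun k => ?_⟩
  have h1 := h (pt fun i => SignType.sign (k i : ℝ)) k
  rw [norm_mul, norm_expChar_zetaMap] at h1
  simp only [pt, Matrix.mulVec_mulVec, Matrix.mul_nonsing_inv _ (posDef_isUnit_det hOm),
    Matrix.one_mulVec] at h1
  have h2 : 2 * Real.pi * ∑ i, (k i : ℝ) * (R / (2 * Real.pi) * (SignType.sign (k i : ℝ) : ℝ)) =
      R * ∑ i, |(k i : ℝ)| := by
    rw [Finset.mul_sum, Finset.mul_sum]
    refine Finset.sum_congr rfl fun i _ => ?_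
    rw [← sign_mul_self (k i : ℝ)]
    field_simp
  rw [h2] at h1
  have h3 : M (pt fun i => SignType.sign (k i : ℝ)) ≤ ∑ σ, |M (pt σ)| :=
    (le_abs_self _).trans (Finset.single_le_sum (f := fun σ => |M (pt σ)|)
      (fun _ _ => abs_nonneg _) (Finset.mem_univ _))
  rw [Real.exp_neg, ← div_eq_mul_inv, le_div_iff₀ (Real.exp_pos _)]
  exact h1.trans h3

/-- No estimate of the quadratic form is needed: basic solutions have norm at most 1, and dividing
by the frame gives a bound at each x, which suffices by `rapidDecay_of_bound`. -/
lemma rapidDecay_gaussCoeff {N : ℕ} (hN : 0 < N) {Om : Matrix (Fin n) (Fin n) ℂ} (hs : Omᵀ = Om)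
    (hOm : (Om.map Complex.im).PosDef) : RapidDecay (gaussCoeff N Om) := by
  refine rapidDecay_of_bound hOm (fun x => ‖vacuum N Om x‖⁻¹) fun x k => ?_
  have h := norm_basicTerm_le (N := N) hOm k (coverProj (x, 0))
  rw [basicTerm_coverProj hN hs, norm_mul] at h
  rwa [inv_eq_one_div, le_div_iff₀' (norm_pos_iff.2 (vacuum_ne_zero N Om x))]

end BasicTerms

/-! ### Periodic holomorphic functions -/

section Periodic

open MeasureTheory

variable {n : ℕ} {Z : Matrix (Fin n) (Fin n) ℂ}

/-- The vectors J ∂_{y_j} have x-components -P e_j, which span ℝⁿ; the mean is constant along each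
of them by `integral_fibre_translate`. -/
lemma integral_fibre_const (hZ : Z ∈ siegel n) {f : Total n → ℂ}
    (hf : Differentiable ℝ fun p : Cover n => f (coverProj p))
    (hJ : ∀ p v, fderiv ℝ (fun p : Cover n => f (coverProj p)) p (applyTangent (siegelJ Z) v) =
      Complex.I * fderiv ℝ (fun p : Cover n => f (coverProj p)) p v) (x : Fin n → ℝ) :
    ∫ y, f (x, y) ∂torusHaar n = ∫ y, f (0, y) ∂torusHaar n := by
  have hP := posDef_isUnit_det (siegelP_posDef hZ)
  let V : Fin n → Cover n := fun j => applyTangent (siegelJ Z) (0, Pi.single j 1)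
  have h1 : ∀ (c : Fin n → ℝ) (s : Finset (Fin n)),
      ∫ y, f (∑ j ∈ s, c j • (V j).1, y) ∂torusHaar n = ∫ y, f (0, y) ∂torusHaar n := by
    intro c s
    induction s using Finset.induction_on with
    | empty => simp
    | insert j s hj ih =>
      rw [Finset.sum_insert hj, add_comm, ← ih]
      exact integral_fibre_translate hf j (V j) (fun p => hJ p _) _ _
  have h2 : x = ∑ j, (-((siegelP Z)⁻¹ *ᵥ x)) j • (V j).1 := by
    have h3 : ∀ j, (V j).1 = -(siegelP Z *ᵥ Pi.single j 1) := fun j => by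
      simp only [V, siegelJ, applyTangent_fst, Matrix.mulVec_zero, zero_add, Matrix.neg_mulVec]
    have h4 : x = siegelP Z *ᵥ ((siegelP Z)⁻¹ *ᵥ x) := by
      rw [Matrix.mulVec_mulVec, Matrix.mul_nonsing_inv _ hP, Matrix.one_mulVec]
    conv_lhs => rw [h4]
    ext i
    simp only [h3, Finset.sum_apply, Pi.smul_apply, Pi.neg_apply, smul_eq_mul,
      Matrix.mulVec_single_one, neg_mul_neg, Matrix.col_apply]
    simp only [Matrix.mulVec, dotProduct]
    exact Finset.sum_congr rfl fun j _ => mul_comm _ _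
  rw [h2]
  exact h1 _ _

lemma fderiv_expChar_zetaMap (Om : Matrix (Fin n) (Fin n) ℂ) (k : Fin n → ℤ) (p : Cover n) :
    HasFDerivAt (fun p => expChar k (zetaMap Om p))
      ((((expChar k (zetaMap Om p)) • charForm k).restrictScalars ℝ).comp (zetaMap Om)) p :=
  ((hasFDerivAt_expChar k (zetaMap Om p)).restrictScalars ℝ).comp p (zetaMap Om).hasFDerivAt

lemma expChar_add (k l : Fin n → ℤ) (z : Fin n → ℂ) :
    expChar (k + l) z = expChar k z * expChar l z := by
  simp only [expChar, Pi.add_apply, Int.cast_add, add_mul, Finset.sum_add_distrib, mul_add,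
    Complex.exp_add]

lemma expChar_zero (z : Fin n → ℂ) : expChar 0 z = 1 := by simp [expChar]

lemma expChar_zetaMap (Om : Matrix (Fin n) (Fin n) ℂ) (k : Fin n → ℤ) (x y : Fin n → ℝ) :
    expChar k (zetaMap Om (x, y)) = expChar k (zetaMap Om (x, 0)) * torusChar k (toTorus y) := by
  rw [torusChar_toTorus, expChar, expChar, ← Complex.exp_add, ← mul_add, ← Finset.sum_add_distrib]
  congr 2
  refine Finset.sum_congr rfl fun i _ => ?_
  simp [zetaMap_apply, toComplex]
  ring

/-- A function on `ℝⁿ × Tⁿ` that is holomorphic for `J_Z` is an exponential series in `y - Ω x`. -/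
lemma exists_expSeries (hZ : Z ∈ siegel n) {h : Total n → ℂ}
    (hd : Differentiable ℝ fun p : Cover n => h (coverProj p))
    (hJ : ∀ p v, fderiv ℝ (fun p : Cover n => h (coverProj p)) p (applyTangent (siegelJ Z) v) =
      Complex.I * fderiv ℝ (fun p : Cover n => h (coverProj p)) p v) :
    ∃ b, RapidDecay b ∧
      ∀ p : Cover n, h (coverProj p) = expSeries b (zetaMap (siegelOmega Z) p) := by
  set Om := siegelOmega Z with hOm
  have hc : Continuous h := continuous_of_comp_coverProj hd.continuous
  -- f_k = h exp (-2π√-1 k · ζ) is again holomorphic and periodic. Its fibre mean is the k-th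
  -- Fourier coefficient of h on the fibre, divided by the character at (x, 0).
  let f : (Fin n → ℤ) → Total n → ℂ := fun k q =>
    h q * (expChar (-k) (zetaMap Om (q.1, 0)) * torusChar (-k) q.2)
  have hf : ∀ k, (fun p : Cover n => f k (coverProj p)) =
      fun p => h (coverProj p) * expChar (-k) (zetaMap Om p) := fun k => by
    ext p
    rw [← Prod.mk.eta (p := p), expChar_zetaMap]
    rfl
  have hfd : ∀ k p, HasFDerivAt (fun p : Cover n => f k (coverProj p)) _ p := fun k p => by
    rw [hf]
    exact (hd p).hasFDerivAt.mul (fderiv_expChar_zetaMap Om (-k) p)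
  have hconst : ∀ k x, ∫ y, f k (x, y) ∂torusHaar n = ∫ y, f k (0, y) ∂torusHaar n := fun k x => by
    refine integral_fibre_const hZ (fun p => (hfd k p).differentiableAt) (fun p v => ?_) x
    rw [(hfd k p).fderiv]
    simp only [add_apply, smul_apply, ContinuousLinearMap.comp_apply,
      ContinuousLinearMap.coe_restrictScalars', hJ, smul_eq_mul, hOm, zetaMap_siegelJ hZ, map_smul]
    ring
  let b : (Fin n → ℤ) → ℂ := fun k => ∫ y, f k (0, y) ∂torusHaar n
  -- Independence of the mean from x fixes how the Fourier coefficients of h vary with x.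
  have hcoeff : ∀ x k, UnitAddTorus.mFourierCoeff (fun y => h (x, y)) k =
      b k * expChar k (zetaMap Om (x, 0)) := fun x k => by
    have h1 : expChar (-k) (zetaMap Om (x, 0)) * expChar k (zetaMap Om (x, 0)) = 1 := by
      rw [← expChar_add, neg_add_cancel, expChar_zero]
    have h2 : b k = expChar (-k) (zetaMap Om (x, 0)) *
        UnitAddTorus.mFourierCoeff (fun y => h (x, y)) k := by
      rw [mFourierCoeff_eq, ← integral_const_mul]
      simp only [b]
      rw [← hconst k x]
      congr 1
      ext y
      simp only [f]
      ring
    rw [h2, mul_right_comm, h1, one_mul]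
  have hxc : ∀ x, Continuous fun y => h (x, y) := fun x =>
    hc.comp (continuous_const.prodMk continuous_id)
  have hb : RapidDecay b := by
    -- A bound of |h| on the compact fibre over x bounds all its Fourier coefficients there, as
    -- `rapidDecay_of_bound` requires.
    have hM : ∀ x, ∃ M, ∀ y, ‖h (x, y)‖ ≤ M := fun x => by
      obtain ⟨M, hM⟩ := isCompact_univ.exists_bound_of_continuousOn (hxc x).continuousOn
      exact ⟨M, fun y => hM y (Set.mem_univ y)⟩
    choose M hM using hM
    refine rapidDecay_of_bound (siegelOmega_im_posDef hZ) M fun x k => ?_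
    rw [← hcoeff]
    exact norm_mFourierCoeff_le (hM x) k
  refine ⟨b, hb, fun p => ?_⟩
  have hs : Summable (UnitAddTorus.mFourierCoeff (fun y => h (p.1, y))) := by
    rw [show UnitAddTorus.mFourierCoeff (fun y => h (p.1, y)) = _ from funext (hcoeff p.1)]
    exact hb.summable _
  have h3 := UnitAddTorus.hasSum_mFourier_series_apply_of_summable
    (f := ⟨fun y => h (p.1, y), hxc p.1⟩) hs (toTorus p.2)
  refine h3.tsum_eq.symm.trans (tsum_congr fun k => ?_)
  rw [← Prod.mk.eta (p := p), expChar_zetaMap]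
  change UnitAddTorus.mFourierCoeff (fun y => h (p.1, y)) k * torusChar k (toTorus p.2) = _
  rw [hcoeff, mul_assoc]

end Periodic

/-! ### Holomorphic sections and holomorphic functions -/

section CovDeriv

variable {n : ℕ}

lemma hasFDerivAt_quadForm {Om : Matrix (Fin n) (Fin n) ℂ} (hs : Omᵀ = Om) (p : Cover n) :
    ∃ L : Cover n →L[ℝ] ℂ,
      HasFDerivAt (fun q : Cover n => quadForm Om (toComplex q.1)) L p ∧
      ∀ v, L v = 2 * (toComplex p.1 ⬝ᵥ (Om *ᵥ toComplex v.1)) := by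
  have h1 : ∀ i, HasFDerivAt (fun q : Cover n => (q.1 i : ℂ))
      (Complex.ofRealCLM.comp ((ContinuousLinearMap.proj i).comp
        (ContinuousLinearMap.fst ℝ (Fin n → ℝ) (Fin n → ℝ)))) p := fun i =>
    (Complex.ofRealCLM.comp ((ContinuousLinearMap.proj i).comp
      (ContinuousLinearMap.fst ℝ (Fin n → ℝ) (Fin n → ℝ)))).hasFDerivAt
  have h2 := HasFDerivAt.fun_sum (u := Finset.univ) fun (i : Fin n) _ =>
    (h1 i).mul (HasFDerivAt.fun_sum (u := Finset.univ) fun (j : Fin n) _ =>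
      (h1 j).const_mul (Om i j))
  refine ⟨_, h2, fun v => ?_⟩
  have h3 : 2 * (toComplex p.1 ⬝ᵥ (Om *ᵥ toComplex v.1)) =
      toComplex p.1 ⬝ᵥ (Om *ᵥ toComplex v.1) + toComplex v.1 ⬝ᵥ (Om *ᵥ toComplex p.1) := by
    rw [dotProduct_mulVec_comm_of_symm hs (toComplex v.1)]
    ring
  rw [h3]
  simp [dotProduct, Matrix.mulVec, toComplex, Finset.sum_add_distrib, mul_comm]

lemma contDiff_vacuum (N : ℕ) (Om : Matrix (Fin n) (Fin n) ℂ) :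
    ContDiff ℝ ∞ fun p : Cover n => vacuum N Om p.1 := by
  have h1 : ∀ i, ContDiff ℝ ∞ fun q : Cover n => (q.1 i : ℂ) := fun i =>
    (Complex.ofRealCLM.comp ((ContinuousLinearMap.proj i).comp
        (ContinuousLinearMap.fst ℝ (Fin n → ℝ) (Fin n → ℝ)))).contDiff
  unfold vacuum quadForm toComplex
  simp only [dotProduct, Matrix.mulVec]
  refine ContDiff.cexp (contDiff_const.mul (ContDiff.sum fun i _ => (h1 i).mul
    (ContDiff.sum fun j _ => contDiff_const.mul (h1 j))))

lemma hasFDerivAt_vacuum (N : ℕ) {Om : Matrix (Fin n) (Fin n) ℂ} (hs : Omᵀ = Om) (p : Cover n) :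
    ∃ L : Cover n →L[ℝ] ℂ, HasFDerivAt (fun q : Cover n => vacuum N Om q.1) L p ∧
      ∀ v, L v = vacuum N Om p.1 *
        (2 * Real.pi * Complex.I * N * (toComplex p.1 ⬝ᵥ (Om *ᵥ toComplex v.1))) := by
  obtain ⟨L, hL, hL'⟩ := hasFDerivAt_quadForm hs p
  refine ⟨_, (hL.const_mul (Real.pi * Complex.I * N : ℂ)).cexp, fun v => ?_⟩
  simp only [smul_apply, hL', smul_eq_mul, vacuum]
  ring

/-- The derivative of the frame contributes N x · Ω v₁ and the connection form -N x · v₂, up to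
2π√-1; together they are -N x · ζ(v). -/
lemma covDeriv_vacuum_mul (N : ℕ) {Om : Matrix (Fin n) (Fin n) ℂ} (hs : Omᵀ = Om) {h : Total n → ℂ}
    {p : Cover n} (hd : DifferentiableAt ℝ (fun q : Cover n => h (coverProj q)) p) (v : Cover n) :
    covDeriv N (fun q => vacuum N Om q.1 * h q) p v =
      vacuum N Om p.1 * (fderiv ℝ (fun q : Cover n => h (coverProj q)) p v -
        2 * Real.pi * Complex.I * N * (toComplex p.1 ⬝ᵥ zetaMap Om v) * h (coverProj p)) := by
  obtain ⟨L, hL, hL'⟩ := hasFDerivAt_vacuum N hs p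
  have h1 : HasFDerivAt (fun q : Cover n => vacuum N Om (coverProj q).1 * h (coverProj q)) _ p :=
    hL.mul hd.hasFDerivAt
  rw [covDeriv, h1.fderiv, zetaMap_apply, dotProduct_sub, toComplex_dotProduct]
  simp only [add_apply, smul_apply, hL', smul_eq_mul, coverProj]
  ring

/-- Since ζ(J v) = √-1 ζ(v), the zeroth-order terms at v and J v cancel: the frame `vacuum` is
holomorphic. -/
lemma covDeriv_add_I_mul (N : ℕ) {Z : Matrix (Fin n) (Fin n) ℂ} (hZ : Z ∈ siegel n)
    {h : Total n → ℂ} {p : Cover n}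
    (hd : DifferentiableAt ℝ (fun q : Cover n => h (coverProj q)) p) (v : Cover n) :
    covDeriv N (fun q => vacuum N (siegelOmega Z) q.1 * h q) p v +
      Complex.I * covDeriv N (fun q => vacuum N (siegelOmega Z) q.1 * h q) p
        (applyTangent (siegelJ Z) v) =
      vacuum N (siegelOmega Z) p.1 * (fderiv ℝ (fun q : Cover n => h (coverProj q)) p v +
        Complex.I * fderiv ℝ (fun q : Cover n => h (coverProj q)) p
          (applyTangent (siegelJ Z) v)) := by
  rw [covDeriv_vacuum_mul N (siegelOmega_symm hZ) hd, covDeriv_vacuum_mul N (siegelOmega_symm hZ) hd,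
    zetaMap_siegelJ hZ, dotProduct_smul, smul_eq_mul]
  linear_combination (-(vacuum N (siegelOmega Z) p.1 * (2 * Real.pi * Complex.I * N *
    (toComplex p.1 ⬝ᵥ zetaMap (siegelOmega Z) v) * h (coverProj p)))) * Complex.I_sq

/-- A smooth function annihilated by the `(0, 1)`-part of the connection is an exponential series. -/
lemma exists_expSeries_of_covDeriv (N : ℕ) {Z : Matrix (Fin n) (Fin n) ℂ} (hZ : Z ∈ siegel n)
    {s : Total n → ℂ} (hs : ContDiff ℝ ∞ fun p : Cover n => s (coverProj p))
    (h : ∀ p v : Cover n, covDeriv N s p v +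
      Complex.I * covDeriv N s p (applyTangent (siegelJ Z) v) = 0) :
    ∃ b, RapidDecay b ∧ ∀ p : Cover n, s (coverProj p) =
      vacuum N (siegelOmega Z) p.1 * expSeries b (zetaMap (siegelOmega Z) p) := by
  set Om := siegelOmega Z with hOm
  let f : Total n → ℂ := fun q => (vacuum N Om q.1)⁻¹ * s q
  have hsf : s = fun q => vacuum N Om q.1 * f q := by
    ext q
    simp only [f, mul_inv_cancel_left₀ (vacuum_ne_zero N Om q.1)]
  have hfd : Differentiable ℝ fun p : Cover n => f (coverProj p) :=
    (((contDiff_vacuum N Om).inv fun p => vacuum_ne_zero N Om p.1).mul hs).differentiable (by simp)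
  obtain ⟨b, hb, hb'⟩ := exists_expSeries hZ hfd fun p v => by
    have h1 := h p v
    rw [hsf, covDeriv_add_I_mul N hZ (hfd p)] at h1
    have h2 := (mul_eq_zero.1 h1).resolve_left (vacuum_ne_zero _ _ _)
    linear_combination (-Complex.I) * h2 + (fderiv ℝ (fun q : Cover n => f (coverProj q)) p
      (applyTangent (siegelJ Z) v)) * Complex.I_sq
  refine ⟨b, hb, fun p => ?_⟩
  rw [← hb', hsf]
  rfl

/-- Conversely, exponential series give solutions of the equation of holomorphic sections. -/
lemma contDiff_covDeriv_of_expSeries (N : ℕ) {Z : Matrix (Fin n) (Fin n) ℂ} (hZ : Z ∈ siegel n)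
    {b : (Fin n → ℤ) → ℂ} (hb : RapidDecay b) {s : Total n → ℂ}
    (hs : ∀ p : Cover n, s (coverProj p) =
      vacuum N (siegelOmega Z) p.1 * expSeries b (zetaMap (siegelOmega Z) p)) :
    ContDiff ℝ ∞ (fun p : Cover n => s (coverProj p)) ∧ ∀ p v : Cover n, covDeriv N s p v +
      Complex.I * covDeriv N s p (applyTangent (siegelJ Z) v) = 0 := by
  set Om := siegelOmega Z with hOm
  let f : Total n → ℂ := fun q => (vacuum N Om q.1)⁻¹ * s q
  have hsf : s = fun q => vacuum N Om q.1 * f q := by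
    ext q
    simp only [f, mul_inv_cancel_left₀ (vacuum_ne_zero N Om q.1)]
  have hf : (fun p : Cover n => f (coverProj p)) = fun p => expSeries b (zetaMap Om p) := by
    ext p
    simp only [f, hs]
    exact inv_mul_cancel_left₀ (vacuum_ne_zero N Om p.1) _
  have hE : ContDiff ℝ ∞ fun p : Cover n => expSeries b (zetaMap Om p) :=
    (hb.contDiff.restrict_scalars ℝ).comp (zetaMap Om).contDiff
  refine ⟨?_, fun p v => ?_⟩
  · simp only [hs]
    exact (contDiff_vacuum N Om).mul hE
  · have hfd : DifferentiableAt ℝ (fun p : Cover n => f (coverProj p)) p := by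
      rw [hf]
      exact hE.differentiable (by simp) p
    rw [hsf, covDeriv_add_I_mul N hZ hfd, hf]
    have h1 : HasFDerivAt (fun p => expSeries b (zetaMap Om p))
        (((fderiv ℂ (expSeries b) (zetaMap Om p)).restrictScalars ℝ).comp (zetaMap Om)) p :=
      ((hb.contDiff.differentiable (by simp) _).hasFDerivAt.restrictScalars ℝ).comp p
        (zetaMap Om).hasFDerivAt
    rw [h1.fderiv]
    simp only [ContinuousLinearMap.comp_apply, ContinuousLinearMap.coe_restrictScalars', hOm,
      zetaMap_siegelJ hZ, map_smul, smul_eq_mul]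
    linear_combination (vacuum N (siegelOmega Z) p.1 * fderiv ℂ (expSeries b)
      (zetaMap (siegelOmega Z) p) (zetaMap (siegelOmega Z) v)) * Complex.I_sq

end CovDeriv

/-! ### The action of `Γ` for a constant complex structure -/

section Integrals

variable {n : ℕ}

/-- For a symmetric matrix, half the full double sum is the triangular sum with half the diagonal. -/
lemma sum_triangular {R : Type*} [Field R] [CharZero R] {M : Matrix (Fin n) (Fin n) R}
    (hM : Mᵀ = M) (ξ : Fin n → R) :
    ∑ i, ∑ j, (if j < i then 0 else if j = i then M i j * ξ i * ξ j / 2 else M i j * ξ i * ξ j) =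
      1 / 2 * (ξ ⬝ᵥ (M *ᵥ ξ)) := by
  set g : Fin n → Fin n → R := fun i j =>
    if j < i then 0 else if j = i then M i j * ξ i * ξ j / 2 else M i j * ξ i * ξ j
  have h1 : ∑ i, ∑ j, g i j = ∑ i, ∑ j, g j i := Finset.sum_comm
  -- Off the diagonal exactly one summand is nonzero, and on it two halves are added.
  have h2 : ∀ i j, g i j + g j i = ξ i * (M i j * ξ j) := by
    intro i j
    have hij : M j i = M i j := congrFun (congrFun hM i) j
    rcases lt_trichotomy i j with h | h | h
    · simp [g, h, h.not_gt, h.ne']; ring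
    · subst h; simp [g]; ring
    · simp [g, h, h.not_gt, h.ne', hij]; ring
  have h3 : ξ ⬝ᵥ (M *ᵥ ξ) = ∑ i, ∑ j, (g i j + g j i) := by
    simp only [h2, dotProduct, Matrix.mulVec, Finset.mul_sum]
  rw [h3]
  simp only [Finset.sum_add_distrib]
  rw [← h1]
  ring

lemma integral_affine_complex (a b : ℝ) (α β : ℂ) :
    ∫ t in a..b, (α + β * (t : ℂ)) = α * (b - a) + β * ((b : ℂ) ^ 2 - (a : ℂ) ^ 2) / 2 := by
  rw [intervalIntegral.integral_add (by simp) (Continuous.intervalIntegrable (by fun_prop) _ _),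
    intervalIntegral.integral_const_mul, intervalIntegral.integral_ofReal, integral_id]
  simp
  ring

lemma update_replaceBelow (i : Fin n) (b x : Fin n → ℝ) (t : ℝ) (j : Fin n) :
    Function.update (replaceBelow i b x) i t j = if j < i then b j else if j = i then t else x j := by
  by_cases h : j = i
  · subst h; simp
  · simp [replaceBelow, h]

/-- The integrals follow a path parallel to the axes between m/N and x. For a linear integrand they
give a triangular sum with halved diagonal, which symmetry of Ω turns into half the quadratic form.
-/
lemma fourierCoeff_const {N : ℕ} (hN : 0 < N) {Om : Matrix (Fin n) (Fin n) ℂ} (hs : Omᵀ = Om)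
    (m : Fin n → ℤ) (x : Fin n → ℝ) :
    fourierCoeff N (fun _ => Om) m x = Complex.exp (2 * Real.pi * Complex.I * N *
      (1 / 2 * quadForm Om (toComplex (x - ratPoint N m)))) := by
  have hN' : (N : ℂ) ≠ 0 := by exact_mod_cast hN.ne'
  set ξ := toComplex (x - ratPoint N m) with hξ
  have hξi : ∀ i, ξ i = (x i : ℂ) - m i / N := fun i => by simp [hξ, toComplex, ratPoint]
  have h1 : ∀ i, Gint N (fun _ => Om) m i (replaceBelow i (ratPoint N m) x) =
      -(N * ∑ j, (if j < i then 0 else if j = i then Om i j * ξ i * ξ j / 2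
        else Om i j * ξ i * ξ j)) := by
    intro i
    -- Coordinates below i sit at m_j/N and contribute nothing, those above i are constant, and only
    -- the i-th one depends on t.
    have h2 : ∀ t : ℝ, (Om *ᵥ fun j => (m j : ℂ) - N * ((Function.update
        (replaceBelow i (ratPoint N m) x) i t j : ℝ) : ℂ)) i =
        (∑ j, if j < i then 0 else if j = i then Om i j * m j else -(N * (Om i j * ξ j))) +
          (-(N * Om i i)) * (t : ℂ) := by
      intro t
      rw [← Finset.sum_ite_eq' Finset.univ i (fun j => (-(N * Om i j)) * (t : ℂ))|>.trans
        (if_pos (Finset.mem_univ i)), ← Finset.sum_add_distrib]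
      simp only [Matrix.mulVec, dotProduct, update_replaceBelow]
      refine Finset.sum_congr rfl fun j _ => ?_
      rcases lt_trichotomy j i with h | h | h
      · simp [h, h.ne, ratPoint, mul_div_cancel₀ _ hN']
      · subst h; simp; ring
      · simp only [h.not_gt, h.ne', if_false, hξi]
        field_simp
        ring
    have h3 : replaceBelow i (ratPoint N m) x i = x i := by simp [replaceBelow]
    rw [Gint]
    simp only [h2]
    rw [integral_affine_complex, h3, Finset.mul_sum, Finset.sum_mul, ← Finset.sum_neg_distrib]
    rw [← Finset.sum_ite_eq' Finset.univ i (fun j => -(N * Om i j) *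
      ((x i : ℂ) ^ 2 - (((m i : ℝ) / N : ℝ) : ℂ) ^ 2) / 2)|>.trans
        (if_pos (Finset.mem_univ i)), ← Finset.sum_add_distrib]
    refine Finset.sum_congr rfl fun j _ => ?_
    rcases lt_trichotomy j i with h | h | h
    · simp [h, h.ne]
    · subst h
      simp only [lt_irrefl, if_false, if_true, hξi]
      push_cast
      field_simp
      ring
    · simp only [h.not_gt, h.ne', if_false, hξi]
      push_cast
      field_simp
      ring
  rw [fourierCoeff]
  congr 1
  simp only [h1]
  rw [Finset.sum_neg_distrib, ← Finset.mul_sum, sum_triangular hs, quadForm]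
  ring

lemma integral_affine (a b α β : ℝ) :
    ∫ t in a..b, (α + β * t) = α * (b - a) + β * (b ^ 2 - a ^ 2) / 2 := by
  rw [intervalIntegral.integral_add (by simp) (Continuous.intervalIntegrable (by fun_prop) _ _),
    intervalIntegral.integral_const_mul, integral_id]
  simp
  ring

end Integrals

namespace PrequantumAction

variable {n N : ℕ} {Γ : Type*} [Group Γ] (S : PrequantumAction n N Γ)

lemma AR_transpose_mul_Ainvt (γ : Γ) :
    (S.AR γ)ᵀ * (S.Ainvt γ).map (Int.cast : ℤ → ℝ) = 1 := by
  have h : ((S.A γ : Matrix (Fin n) (Fin n) ℤ))ᵀ * S.Ainvt γ = 1 := by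
    rw [ActionData.Ainvt, ← Matrix.transpose_mul, ← Units.val_mul, inv_mul_cancel, Units.val_one,
      Matrix.transpose_one]
  have h2 := congrArg (fun M : Matrix (Fin n) (Fin n) ℤ => M.map (Int.castRingHom ℝ)) h
  simp only [Matrix.map_mul] at h2
  rw [ActionData.AR, ← Matrix.transpose_map]
  refine h2.trans ?_
  exact Matrix.map_one _ (map_zero _) (map_one _)

section Constant

variable {Z : Matrix (Fin n) (Fin n) ℂ}

/-- The matrix identities expressing that `ρ̃_γ` preserves `J_Z`. -/
lemma invariant_blocks {γ : Γ} {x : Fin n → ℝ}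
    (h : S.dRhoTotal γ x * siegelJ Z = siegelJ Z * S.dRhoTotal γ x) :
    siegelP Z * S.Du γ x = Z.map Complex.re * (Z.map Complex.im)⁻¹ * S.AR γ -
        S.AR γ * (Z.map Complex.re * (Z.map Complex.im)⁻¹) ∧
      S.AR γ * siegelP Z = siegelP Z * (S.Ainvt γ).map Int.cast := by
  rw [ActionData.dRhoTotal, siegelJ, Matrix.fromBlocks_multiply, Matrix.fromBlocks_multiply,
    Matrix.fromBlocks_inj] at h
  -- Both identities come from the upper row of blocks.
  obtain ⟨h1, h2, -, -⟩ := h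
  simp only [Matrix.zero_mul, Matrix.mul_zero, add_zero, zero_add, Matrix.neg_mul,
    Matrix.mul_neg, neg_zero, neg_inj] at h1 h2
  exact ⟨by rw [h1]; abel, h2⟩

/-- By invariance P Du_γ(x) is an expression in A, X and Y alone, and P is invertible. -/
lemma Du_const (hZ : Z ∈ siegel n)
    (h : ∀ γ x, S.dRhoTotal γ x * siegelJ Z = siegelJ Z * S.dRhoTotal γ x) (γ : Γ)
    (x : Fin n → ℝ) : S.Du γ x = S.Du γ 0 := by
  have hP := posDef_isUnit_det (siegelP_posDef hZ)
  have h1 := (S.invariant_blocks (h γ x)).1.trans (S.invariant_blocks (h γ 0)).1.symm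
  have h2 := congrArg ((siegelP Z)⁻¹ * ·) h1
  simpa only [Matrix.nonsing_inv_mul_cancel_left _ _ hP] using h2

/-- `ᵗA Ω A = Ω + ᵗA Du`. -/
lemma omega_transform (hZ : Z ∈ siegel n)
    (h : ∀ γ x, S.dRhoTotal γ x * siegelJ Z = siegelJ Z * S.dRhoTotal γ x) (γ : Γ) :
    ((S.AR γ).map Complex.ofReal)ᵀ * siegelOmega Z * (S.AR γ).map Complex.ofReal =
      siegelOmega Z + ((S.AR γ)ᵀ * S.Du γ 0).map Complex.ofReal := by
  have hP := posDef_isUnit_det (siegelP_posDef hZ)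
  obtain ⟨h1, h2⟩ := S.invariant_blocks (h γ 0)
  have hmul : ∀ A B : Matrix (Fin n) (Fin n) ℝ,
      (A * B).map Complex.ofReal = A.map Complex.ofReal * B.map Complex.ofReal := fun A B =>
    Matrix.map_mul (f := Complex.ofRealHom)
  -- The imaginary part of the identity, from A P = P ᵗA⁻¹; the formula for Du below gives the real
  -- part.
  have h3 : (S.AR γ)ᵀ * (siegelP Z)⁻¹ * S.AR γ = (siegelP Z)⁻¹ := by
    have h4 : (siegelP Z)⁻¹ * S.AR γ = (S.Ainvt γ).map Int.cast * (siegelP Z)⁻¹ := by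
      calc (siegelP Z)⁻¹ * S.AR γ = (siegelP Z)⁻¹ * (S.AR γ * siegelP Z) * (siegelP Z)⁻¹ := by
            rw [Matrix.mul_assoc, Matrix.mul_nonsing_inv_cancel_right _ _ hP]
        _ = _ := by rw [h2, Matrix.nonsing_inv_mul_cancel_left _ _ hP]
    rw [Matrix.mul_assoc, h4, ← Matrix.mul_assoc, S.AR_transpose_mul_Ainvt, Matrix.one_mul]
  have h5 : S.Du γ 0 = (siegelP Z)⁻¹ * Z.map Complex.re * (Z.map Complex.im)⁻¹ * S.AR γ -
      (siegelP Z)⁻¹ * S.AR γ * (Z.map Complex.re * (Z.map Complex.im)⁻¹) := by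
    have h6 := congrArg ((siegelP Z)⁻¹ * ·) h1
    simp only [Matrix.nonsing_inv_mul_cancel_left _ _ hP] at h6
    rw [h6, Matrix.mul_sub]
    simp only [Matrix.mul_assoc]
  have h7 : (S.AR γ)ᵀ * S.Du γ 0 =
      (S.AR γ)ᵀ * ((siegelP Z)⁻¹ * Z.map Complex.re * (Z.map Complex.im)⁻¹) * S.AR γ -
        (siegelP Z)⁻¹ * Z.map Complex.re * (Z.map Complex.im)⁻¹ := by
    rw [h5, Matrix.mul_sub, ← Matrix.mul_assoc _ ((siegelP Z)⁻¹ * S.AR γ),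
      ← Matrix.mul_assoc _ (siegelP Z)⁻¹ (S.AR γ), h3]
    simp only [Matrix.mul_assoc]
  rw [h7, siegelOmega_eq hZ, Matrix.mul_add, Matrix.add_mul, Matrix.mul_smul, Matrix.smul_mul,
    ← Matrix.transpose_map, ← hmul, ← hmul, ← hmul, ← hmul, h3, Matrix.map_sub _ Complex.ofReal_sub]
  abel

end Constant

section Affine

variable {γ : Γ}

lemma u_affine (hD : ∀ x, S.Du γ x = S.Du γ 0) (x : Fin n → ℝ) :
    S.u γ x = S.u γ 0 + S.Du γ 0 *ᵥ x := by
  have hd : Differentiable ℝ (S.u γ) := (S.u_smooth γ).differentiable (by simp)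
  let L : (Fin n → ℝ) →L[ℝ] (Fin n → ℝ) := LinearMap.toContinuousLinearMap (S.Du γ 0).mulVecLin
  have hL : ∀ x, fderiv ℝ (S.u γ) x = L := fun x => by
    apply ContinuousLinearMap.coe_injective
    have h1 : LinearMap.toMatrix' (fderiv ℝ (S.u γ) x : (Fin n → ℝ) →ₗ[ℝ] (Fin n → ℝ)) =
      S.Du γ 0 := hD x
    change (fderiv ℝ (S.u γ) x : (Fin n → ℝ) →ₗ[ℝ] (Fin n → ℝ)) = (S.Du γ 0).mulVecLin
    rw [← h1, ← Matrix.toLin'_apply', Matrix.toLin'_toMatrix']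
  have h2 := is_const_of_fderiv_eq_zero (𝕜 := ℝ) (f := fun x => S.u γ x - L x)
    (hd.sub L.differentiable) (fun x => by
      have h3 : HasFDerivAt (fun x => S.u γ x - L x) (fderiv ℝ (S.u γ) x - L) x :=
        (hd x).hasFDerivAt.sub L.hasFDerivAt
      rw [h3.fderiv, hL, sub_self]) x 0
  rw [map_zero, sub_zero] at h2
  rw [← h2]
  exact (sub_add_cancel _ _).symm

/-- For affine u, the integrals remove the linear terms in u(0) and, as ᵗA Du is symmetric, half of
the quadratic form that comes from ρ(x) · u(x). -/
lemma gTilde_eq (hD : ∀ x, S.Du γ x = S.Du γ 0) (x : Fin n → ℝ) :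
    S.gTilde γ x = 1 / 2 * (x ⬝ᵥ (((S.AR γ)ᵀ * S.Du γ 0) *ᵥ x)) + S.c γ ⬝ᵥ (S.Du γ 0 *ᵥ x) := by
  set D := S.Du γ 0
  have hF : ∀ i, S.Fint γ i (replaceBelow i 0 x) = x i * ((S.AR γ)ᵀ *ᵥ S.u γ 0) i +
      ∑ j, (if j < i then 0 else if j = i then ((S.AR γ)ᵀ * D) i j * x i * x j / 2
        else ((S.AR γ)ᵀ * D) i j * x i * x j) := by
    intro i
    -- The integrals of the coordinates along the i-th segment, from 0 to x_i.
    let w : Fin n → ℝ := fun l => if l < i then 0 else if l = i then x i * x l / 2 else x i * x l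
    have h3 : replaceBelow i 0 x i = x i := by simp [replaceBelow]
    have h1 : (fun j => ∫ t in (0 : ℝ)..(x i), S.u γ (Function.update (replaceBelow i 0 x) i t) j) =
        x i • S.u γ 0 + D *ᵥ w := by
      ext j
      have h2 : ∀ t : ℝ, S.u γ (Function.update (replaceBelow i 0 x) i t) j =
          (S.u γ 0 j + ∑ l, if l < i then 0 else if l = i then 0 else D j l * x l) + D j i * t := by
        intro t
        rw [S.u_affine hD, Pi.add_apply, add_assoc, ← Finset.sum_ite_eq' Finset.univ i
          (fun l => D j l * t)|>.trans (if_pos (Finset.mem_univ i)), ← Finset.sum_add_distrib]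
        simp only [Matrix.mulVec, dotProduct, update_replaceBelow]
        congr 1
        refine Finset.sum_congr rfl fun l _ => ?_
        rcases lt_trichotomy l i with h | h | h
        · simp [h, h.ne]
        · subst h; simp [D]
        · simp [h.not_gt, h.ne', D]
      simp only [h2]
      rw [integral_affine, add_mul, Pi.add_apply, Pi.smul_apply, smul_eq_mul, add_assoc,
        ← Finset.sum_ite_eq' Finset.univ i (fun l => D j l * (x i ^ 2 - 0 ^ 2) / 2)|>.trans
          (if_pos (Finset.mem_univ i)), Finset.sum_mul, ← Finset.sum_add_distrib]
      simp only [Matrix.mulVec, dotProduct]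
      congr 1
      · ring
      refine Finset.sum_congr rfl fun l _ => ?_
      rcases lt_trichotomy l i with h | h | h
      · simp [h, h.ne, w]
      · subst h; simp [w]; ring
      · simp [h.not_gt, h.ne', w]; ring
    rw [ActionData.Fint, h3, h1, Matrix.mulVec_add, Matrix.mulVec_smul, Matrix.mulVec_mulVec,
      Pi.add_apply, Pi.smul_apply, smul_eq_mul]
    congr 1
    rw [Matrix.mulVec, dotProduct]
    refine Finset.sum_congr rfl fun j _ => ?_
    simp only [w]
    split_ifs <;> ring
  have hsym : ((S.AR γ)ᵀ * D)ᵀ = (S.AR γ)ᵀ * D := S.symm γ 0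
  have h4 : ∀ v, (S.AR γ *ᵥ x) ⬝ᵥ v = x ⬝ᵥ ((S.AR γ)ᵀ *ᵥ v) := fun v => by
    rw [Matrix.dotProduct_mulVec, Matrix.vecMul_transpose]
  rw [ActionData.gTilde]
  simp only [hF]
  rw [Finset.sum_add_distrib, sum_triangular hsym, S.u_affine hD x, ActionData.rho,
    add_dotProduct, dotProduct_add, dotProduct_add, h4, h4, Matrix.mulVec_mulVec]
  have h5 : ∑ i, x i * ((S.AR γ)ᵀ *ᵥ S.u γ 0) i = x ⬝ᵥ ((S.AR γ)ᵀ *ᵥ S.u γ 0) := rfl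
  rw [h5]
  ring

end Affine

lemma ratPoint_NrhoInt (hN : 0 < N) (γ : Γ) (m : Fin n → ℤ) :
    ratPoint N (S.NrhoInt γ m) = S.rho γ (ratPoint N m) := by
  have hN' : (N : ℝ) ≠ 0 := by exact_mod_cast hN.ne'
  ext i
  simp only [ratPoint, ActionData.NrhoInt, ActionData.rho, ActionData.AR, ActionData.c,
    Matrix.mulVec, dotProduct, Pi.add_apply, Matrix.map_apply]
  push_cast
  rw [add_div, Finset.sum_div]
  congr 1
  exact Finset.sum_congr rfl fun j _ => by ring

lemma rho_inv_cancel (γ : Γ) (x : Fin n → ℝ) : S.rho γ⁻¹ (S.rho γ x) = x := by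
  rw [← S.rho_mul, inv_mul_cancel, S.rho_one]

lemma rho_cancel_inv (γ : Γ) (x : Fin n → ℝ) : S.rho γ (S.rho γ⁻¹ x) = x := by
  rw [← S.rho_mul, mul_inv_cancel, S.rho_one]

lemma AR_mulVec_sub (γ : Γ) (x y : Fin n → ℝ) :
    S.AR γ *ᵥ (x - y) = S.rho γ x - S.rho γ y := by
  simp only [ActionData.rho, Matrix.mulVec_sub]
  abel

/-- The unimodular constant relating `ϑ`-terms and basic solutions. -/
noncomputable def phase (m : Fin n → ℤ) (γ : Γ) : ℂ :=
  (S.g γ : ℂ) * Complex.exp (((2 * Real.pi * N *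
    (-(1 / 2 * (ratPoint N m ⬝ᵥ (((S.AR γ)ᵀ * S.Du γ 0) *ᵥ ratPoint N m))) -
      S.rho γ (ratPoint N m) ⬝ᵥ S.u γ 0) : ℝ) : ℂ) * Complex.I)

lemma norm_phase (m : Fin n → ℤ) (γ : Γ) : ‖S.phase m γ‖ = 1 := by
  rw [phase, norm_mul, Complex.norm_exp_ofReal_mul_I, Circle.norm_coe, one_mul]

lemma phase_ne_zero (m : Fin n → ℤ) (γ : Γ) : S.phase m γ ≠ 0 :=
  norm_ne_zero_iff.1 (by rw [S.norm_phase]; exact one_ne_zero)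

variable {Z : Matrix (Fin n) (Fin n) ℂ}

lemma thetaTerm_eq_gaussianTerm (hN : 0 < N) {Om : Matrix (Fin n) (Fin n) ℂ} (hs : Omᵀ = Om)
    (hD : ∀ γ x, S.Du γ x = S.Du γ 0) (m : Fin n → ℤ) (γ : Γ) (x y : Fin n → ℝ) :
    S.thetaTerm (fun _ => Om) m γ (x, toTorus y) = S.gaussianTerm Om m γ x y := by
  have hN' : (N : ℂ) ≠ 0 := by exact_mod_cast hN.ne'
  set x' := S.rho γ⁻¹ x with hx'
  set D := (S.AR γ)ᵀ * S.Du γ 0 with hDdef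
  have hsym : Dᵀ = D := S.symm γ 0
  have hchar : ∑ i, (S.NrhoInt γ m i : ℂ) * y i =
      N * ((S.rho γ (ratPoint N m) ⬝ᵥ y : ℝ) : ℂ) := by
    rw [← S.ratPoint_NrhoInt hN, dotProduct, Complex.ofReal_sum, Finset.mul_sum]
    refine Finset.sum_congr rfl fun i _ => ?_
    simp only [ratPoint]
    push_cast
    field_simp
  have hξ : (fun i => ((x' i - ratPoint N m i : ℝ) : ℂ)) = toComplex (x' - ratPoint N m) := rfl
  -- The terms c · Du x' cancel, and completing the square in x' - m/N leaves only constants.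
  have hreal : S.gTilde γ x' - S.rho γ (ratPoint N m) ⬝ᵥ S.u γ x' =
      1 / 2 * ((x' - ratPoint N m) ⬝ᵥ (D *ᵥ (x' - ratPoint N m)) -
        ratPoint N m ⬝ᵥ (D *ᵥ ratPoint N m)) - S.rho γ (ratPoint N m) ⬝ᵥ S.u γ 0 := by
    have h4 : ∀ v, (S.AR γ *ᵥ ratPoint N m) ⬝ᵥ v = ratPoint N m ⬝ᵥ ((S.AR γ)ᵀ *ᵥ v) := fun v => by
      rw [Matrix.dotProduct_mulVec, Matrix.vecMul_transpose]
    have h5 : S.rho γ (ratPoint N m) ⬝ᵥ (S.Du γ 0 *ᵥ x') =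
        ratPoint N m ⬝ᵥ (D *ᵥ x') + S.c γ ⬝ᵥ (S.Du γ 0 *ᵥ x') := by
      rw [ActionData.rho, add_dotProduct, h4, Matrix.mulVec_mulVec]
    rw [S.gTilde_eq (hD γ), S.u_affine (hD γ) x', dotProduct_add, h5, Matrix.mulVec_sub,
      sub_dotProduct, dotProduct_sub, dotProduct_sub,
      dotProduct_mulVec_comm_of_symm hsym x' (ratPoint N m)]
    ring
  have hq : toComplex (x' - ratPoint N m) ⬝ᵥ
      ((Om + D.map Complex.ofReal) *ᵥ toComplex (x' - ratPoint N m)) =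
      quadForm Om (toComplex (x' - ratPoint N m)) +
        (((x' - ratPoint N m) ⬝ᵥ (D *ᵥ (x' - ratPoint N m)) : ℝ) : ℂ) := by
    rw [Matrix.add_mulVec, dotProduct_add, ← toComplex_mulVec, toComplex_dotProduct, quadForm]
  simp only [thetaTerm, orbitCoeff, gaussianTerm]
  rw [← hx', fourierCoeff_const hN hs, torusChar_toTorus, hchar, hreal, hξ, hq, mul_assoc,
    mul_assoc, ← Complex.exp_add, ← Complex.exp_add]
  congr 2
  push_cast
  ring

/-- By `omega_transform`, the form Ω + ᵗA Du at ρ_{γ⁻¹}(x) - m/N is the form Ω at A (ρ_{γ⁻¹}(x) -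
m/N) = x - ρ_γ(m/N). What remains is unimodular. -/
lemma gaussianTerm_eq_basicTerm (hN : 0 < N) (hZ : Z ∈ siegel n)
    (h : ∀ γ x, S.dRhoTotal γ x * siegelJ Z = siegelJ Z * S.dRhoTotal γ x)
    (m : Fin n → ℤ) (γ : Γ) (x y : Fin n → ℝ) :
    S.gaussianTerm (siegelOmega Z) m γ x y =
      S.phase m γ * basicTerm N (siegelOmega Z) (S.NrhoInt γ m) (x, toTorus y) := by
  have hN' : (N : ℂ) ≠ 0 := by exact_mod_cast hN.ne'
  have hchar : ∑ i, (S.NrhoInt γ m i : ℂ) * y i =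
      N * ((S.rho γ (ratPoint N m) ⬝ᵥ y : ℝ) : ℂ) := by
    rw [← S.ratPoint_NrhoInt hN, dotProduct, Complex.ofReal_sum, Finset.mul_sum]
    refine Finset.sum_congr rfl fun i _ => ?_
    simp only [ratPoint]
    push_cast
    field_simp
  have hξ : (fun i => ((S.rho γ⁻¹ x i - ratPoint N m i : ℝ) : ℂ)) =
      toComplex (S.rho γ⁻¹ x - ratPoint N m) := rfl
  have hq : toComplex (S.rho γ⁻¹ x - ratPoint N m) ⬝ᵥ
      ((siegelOmega Z + ((S.AR γ)ᵀ * S.Du γ 0).map Complex.ofReal) *ᵥ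
        toComplex (S.rho γ⁻¹ x - ratPoint N m)) =
      quadForm (siegelOmega Z) (toComplex (x - S.rho γ (ratPoint N m))) := by
    have h1 : x - S.rho γ (ratPoint N m) = S.AR γ *ᵥ (S.rho γ⁻¹ x - ratPoint N m) := by
      rw [S.AR_mulVec_sub, S.rho_cancel_inv]
    rw [h1, ← S.omega_transform hZ h, toComplex_mulVec, quadForm, ← Matrix.mulVec_mulVec,
      ← Matrix.mulVec_mulVec, Matrix.dotProduct_mulVec, Matrix.vecMul_transpose]
  simp only [gaussianTerm, basicTerm, phase]
  rw [hξ, hq, torusChar_toTorus, hchar, S.ratPoint_NrhoInt hN, mul_assoc (S.g γ : ℂ), ← Complex.exp_add,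
    ← Complex.exp_add]
  congr 2
  push_cast
  ring

lemma thetaTerm_eq_basicTerm (hN : 0 < N) (hZ : Z ∈ siegel n)
    (h : ∀ γ x, S.dRhoTotal γ x * siegelJ Z = siegelJ Z * S.dRhoTotal γ x)
    (m : Fin n → ℤ) (γ : Γ) (p : Total n) :
    S.thetaTerm (fun _ => siegelOmega Z) m γ p =
      S.phase m γ * basicTerm N (siegelOmega Z) (S.NrhoInt γ m) p := by
  obtain ⟨x, y⟩ := p
  obtain ⟨y, rfl⟩ := toTorus_surjective y
  rw [S.thetaTerm_eq_gaussianTerm hN (siegelOmega_symm hZ) (S.Du_const hZ h),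
    S.gaussianTerm_eq_basicTerm hN hZ h]

end PrequantumAction

/-! ### Convergence and uniqueness for series of Gaussian solutions -/

section Convergence

lemma hasSum_of_eq {ι : Type*} {f g : ι → ℂ} {a : ℂ} (hg : HasSum g a) (h : ∀ i, f i = g i) :
    HasSum f a := by
  rwa [funext h]

lemma convergesOnCompacts_of_bound {ι X : Type*} [TopologicalSpace X] {f : ι → X → ℂ}
    (h : ∀ K : Set X, IsCompact K → ∃ v : ι → ℝ, Summable v ∧ ∀ i, ∀ x ∈ K, ‖f i x‖ ≤ v i) :
    ConvergesOnCompacts f fun x => ∑' i, f i x := by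
  refine ⟨fun x => ?_, fun K hK => ?_⟩
  · obtain ⟨v, hv, hv'⟩ := h {x} isCompact_singleton
    exact Summable.of_nonneg_of_le (fun i => norm_nonneg _) (fun i => hv' i x rfl) hv
  · obtain ⟨v, hv, hv'⟩ := h K hK
    exact ⟨tendstoUniformlyOn_tsum hv fun i x hx => by rw [norm_norm]; exact hv' i x hx,
      tendstoUniformlyOn_tsum hv hv'⟩

lemma ConvergesOnCompacts.hasSum {ι X : Type*} [TopologicalSpace X] {f : ι → X → ℂ} {s : X → ℂ}
    (h : ConvergesOnCompacts f s) (x : X) : HasSum (fun i => f i x) (s x) := by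
  have h1 := ((h.2 {x} isCompact_singleton).2).tendsto_at (Set.mem_singleton x)
  simpa [HasSum, SummationFilter.unconditional_filter] using h1

variable {n : ℕ}

lemma ratPoint_injective {N : ℕ} (hN : 0 < N) :
    Function.Injective (ratPoint N : (Fin n → ℤ) → Fin n → ℝ) := by
  have hN' : (N : ℝ) ≠ 0 := by exact_mod_cast hN.ne'
  intro k l h
  ext i
  have h1 : (k i : ℝ) / N = l i / N := congrFun h i
  exact_mod_cast (div_left_inj' hN').1 h1

lemma norm_basicTerm_fst (N : ℕ) (Om : Matrix (Fin n) (Fin n) ℂ) (k : Fin n → ℤ) (x : Fin n → ℝ)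
    (y y' : Torus n) : ‖basicTerm N Om k (x, y)‖ = ‖basicTerm N Om k (x, y')‖ := by
  simp [basicTerm, norm_torusChar]

lemma basicTerm_bound {N : ℕ} (hN : 0 < N) {Om : Matrix (Fin n) (Fin n) ℂ} (hs : Omᵀ = Om)
    {c : (Fin n → ℤ) → ℂ} (hc : RapidDecay fun k => c k * gaussCoeff N Om k) {K : Set (Total n)}
    (hK : IsCompact K) : ∃ v : (Fin n → ℤ) → ℝ, Summable v ∧
      ∀ k, ∀ p ∈ K, ‖c k * basicTerm N Om k p‖ ≤ v k := by
  -- The norm of a basic solution does not depend on the torus variable, so only the projection of K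
  -- to ℝⁿ matters.
  have hK' := hK.image continuous_fst
  have hcont : Continuous fun x : Fin n → ℝ => ((x, 0) : Cover n) := by fun_prop
  obtain ⟨C, hC⟩ := hK'.exists_bound_of_continuousOn
    ((contDiff_vacuum N Om).continuous.comp hcont).continuousOn
  obtain ⟨r, hr⟩ := hK'.exists_bound_of_continuousOn
    ((zetaMap Om).continuous.comp hcont).continuousOn
  obtain ⟨v, hv, hv'⟩ := hc.exists_bound r
  refine ⟨fun k => C * v k, hv.mul_left C, fun k p hp => ?_⟩
  have hp1 : p.1 ∈ Prod.fst '' K := ⟨p, hp, rfl⟩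
  have h1 : ‖c k * basicTerm N Om k p‖ = ‖vacuum N Om p.1‖ *
      ‖c k * gaussCoeff N Om k * expChar k (zetaMap Om (p.1, 0))‖ := by
    rw [norm_mul, show p = (p.1, p.2) from rfl, norm_basicTerm_fst N Om k p.1 p.2 (toTorus 0),
      show (p.1, toTorus 0) = coverProj (p.1, (0 : Fin n → ℝ)) from rfl,
      basicTerm_coverProj hN hs]
    simp only [norm_mul]
    ring
  rw [h1]
  exact mul_le_mul (hC _ hp1) (hv' k _ (hr _ hp1)) (norm_nonneg _)
    ((norm_nonneg _).trans (hC _ hp1))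

/-- The value of a basic solution on the zero section of the torus. -/
lemma basicTerm_eq_mul_torusChar (N : ℕ) (Om : Matrix (Fin n) (Fin n) ℂ) (k : Fin n → ℤ)
    (x : Fin n → ℝ) (y : Torus n) :
    basicTerm N Om k (x, y) = basicTerm N Om k (x, 0) * torusChar k y := by
  have h : torusChar k (0 : Torus n) = 1 := by
    rw [← toTorus_zero, torusChar_toTorus]; simp
  simp only [basicTerm, h, mul_one]

lemma basicTerm_ne_zero (N : ℕ) (Om : Matrix (Fin n) (Fin n) ℂ) (k : Fin n → ℤ) (p : Total n) :
    basicTerm N Om k p ≠ 0 :=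
  mul_ne_zero (Complex.exp_ne_zero _) (norm_ne_zero_iff.1 (by rw [norm_torusChar]; exact one_ne_zero))

/-- The Fourier coefficients of a series of distinct basic solutions. -/
lemma hasSum_mFourierCoeff_basicTerm {N : ℕ} {Om : Matrix (Fin n) (Fin n) ℂ} {ι : Type*}
    {κ : ι → Fin n → ℤ} {c : ι → ℂ} {f : Torus n → ℂ} {x : Fin n → ℝ}
    (h : ∀ y, HasSum (fun i => c i * basicTerm N Om (κ i) (x, y)) (f y)) (k : Fin n → ℤ) :
    HasSum (fun i => c i * basicTerm N Om (κ i) (x, 0) * if κ i = k then 1 else 0)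
      (UnitAddTorus.mFourierCoeff f k) := by
  have h1 := mFourierCoeff_tsum (κ := κ) (c := fun i => c i * basicTerm N Om (κ i) (x, 0))
    (h 0).summable.norm k
  convert h1 using 2
  ext y
  rw [← (h y).tsum_eq]
  exact tsum_congr fun i => by rw [basicTerm_eq_mul_torusChar, mul_assoc]

/-- On a single fibre the k-th Fourier coefficient of the sum is c_k times the nonzero value of the
k-th solution at y = 0. -/
lemma basicTerm_coeff_unique {N : ℕ} {Om : Matrix (Fin n) (Fin n) ℂ}
    {c c' : (Fin n → ℤ) → ℂ} {f : Torus n → ℂ} {x : Fin n → ℝ}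
    (h : ∀ y, HasSum (fun k => c k * basicTerm N Om k (x, y)) (f y))
    (h' : ∀ y, HasSum (fun k => c' k * basicTerm N Om k (x, y)) (f y)) : c = c' := by
  have key : ∀ {d : (Fin n → ℤ) → ℂ}, (∀ y, HasSum (fun k => d k * basicTerm N Om k (x, y)) (f y)) →
      ∀ k, UnitAddTorus.mFourierCoeff f k = d k * basicTerm N Om k (x, 0) := by
    intro d hd k
    have h1 := hasSum_mFourierCoeff_basicTerm (κ := id) hd k
    refine h1.unique ?_
    convert hasSum_ite_eq k (d k * basicTerm N Om k (x, 0)) using 2 with l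
    by_cases hl : l = k
    · subst hl; simp
    · simp [hl]
  ext k
  exact mul_right_cancel₀ (basicTerm_ne_zero N Om k (x, 0)) ((key h k).symm.trans (key h' k))

end Convergence

namespace PrequantumAction

variable {n N : ℕ} {Γ : Type*} [Group Γ] (S : PrequantumAction n N Γ)

/-! ### Equivariance -/

lemma mult_mul (γ δ : Γ) (p : Total n) :
    S.mult (γ * δ) p = S.mult γ (S.rhoTotal δ p) * S.mult δ p := by
  have h := congrArg Prod.snd (S.lift_mul γ δ (p, 1))
  simpa [ActionData.lift] using h

lemma mult_ne_zero (γ : Γ) (p : Total n) : S.mult γ p ≠ 0 := by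
  refine mul_ne_zero (mul_ne_zero (Circle.coe_ne_zero _) (Complex.exp_ne_zero _)) ?_
  exact norm_ne_zero_iff.1 (by rw [norm_torusChar]; exact one_ne_zero)

lemma torusChar_torusMul (γ : Γ) (m : Fin n → ℤ) (y : Torus n) :
    torusChar ((S.A γ : Matrix (Fin n) (Fin n) ℤ) *ᵥ m) (torusMul (S.Ainvt γ) y) =
      torusChar m y := by
  obtain ⟨y, rfl⟩ := toTorus_surjective y
  rw [torusMul_toTorus, torusChar_toTorus, torusChar_toTorus]
  congr 2
  have h1 : (fun i => ((((S.A γ : Matrix (Fin n) (Fin n) ℤ) *ᵥ m) i : ℤ) : ℝ)) =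
      S.AR γ *ᵥ fun i => (m i : ℝ) := by
    ext i
    simp [ActionData.AR, Matrix.mulVec, dotProduct]
  have h2 : ∑ i, ((((S.A γ : Matrix (Fin n) (Fin n) ℤ) *ᵥ m) i : ℤ) : ℝ) *
      ((S.Ainvt γ).map (Int.cast : ℤ → ℝ) *ᵥ y) i = ∑ i, (m i : ℝ) * y i := by
    change (fun i => ((((S.A γ : Matrix (Fin n) (Fin n) ℤ) *ᵥ m) i : ℤ) : ℝ)) ⬝ᵥ
      ((S.Ainvt γ).map (Int.cast : ℤ → ℝ) *ᵥ y) = (fun i => (m i : ℝ)) ⬝ᵥ y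
    rw [h1, ← Matrix.vecMul_transpose, ← Matrix.dotProduct_mulVec, Matrix.mulVec_mulVec,
      S.AR_transpose_mul_Ainvt, Matrix.one_mulVec]
  exact_mod_cast congrArg (fun t : ℝ => (t : ℂ)) h2

/-- The defining relation of a_{Nρ_γ(m/N)} says that the γ-term is the transform by γ of the m-th
solution. -/
lemma thetaTerm_rhoTotal (hN : 0 < N) {Om : Matrix (Fin n) (Fin n) ℂ} (hs : Omᵀ = Om)
    (m : Fin n → ℤ) (γ : Γ) (p : Total n) :
    S.thetaTerm (fun _ => Om) m γ (S.rhoTotal γ p) = S.mult γ p * basicTerm N Om m p := by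
  have hN' : (N : ℂ) ≠ 0 := by exact_mod_cast hN.ne'
  have hchar : torusChar (S.NrhoInt γ m) (toTorus (S.u γ p.1)) =
      Complex.exp (2 * Real.pi * Complex.I * N *
        ((S.rho γ (ratPoint N m) ⬝ᵥ S.u γ p.1 : ℝ) : ℂ)) := by
    rw [torusChar_toTorus, ← S.ratPoint_NrhoInt hN, dotProduct, Complex.ofReal_sum,
      mul_assoc _ (N : ℂ), Finset.mul_sum (a := (N : ℂ))]
    congr 2
    refine Finset.sum_congr rfl fun i _ => ?_
    simp only [ratPoint]
    push_cast
    field_simp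
  simp only [thetaTerm, orbitCoeff, ActionData.rhoTotal, S.rho_inv_cancel, torusChar_add, hchar,
    ActionData.mult, basicTerm, fourierCoeff_const hN hs]
  rw [ActionData.NrhoInt, torusChar_add_left, S.torusChar_torusMul]
  -- The character at u_γ(x) restores the factor with ρ_γ(m/N) · u_γ(x) that the definition of the
  -- coefficient divides out.
  have h1 : Complex.exp (2 * Real.pi * Complex.I * N * (S.gTilde γ p.1 : ℂ)) =
      Complex.exp (2 * Real.pi * Complex.I * N *
        ((S.gTilde γ p.1 - S.rho γ (ratPoint N m) ⬝ᵥ S.u γ p.1 : ℝ) : ℂ)) *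
      Complex.exp (2 * Real.pi * Complex.I * N *
        ((S.rho γ (ratPoint N m) ⬝ᵥ S.u γ p.1 : ℝ) : ℂ)) := by
    rw [← Complex.exp_add]
    congr 1
    push_cast
    ring
  rw [h1]
  ring

lemma thetaTerm_mul_rhoTotal (hN : 0 < N) {Om : Matrix (Fin n) (Fin n) ℂ} (hs : Omᵀ = Om)
    (m : Fin n → ℤ) (γ δ : Γ) (p : Total n) :
    S.thetaTerm (fun _ => Om) m (γ * δ) (S.rhoTotal γ p) =
      S.mult γ p * S.thetaTerm (fun _ => Om) m δ p := by
  obtain ⟨q, rfl⟩ : ∃ q, S.rhoTotal δ q = p :=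
    ⟨S.rhoTotal δ⁻¹ p, by rw [← S.rhoTotal_mul, mul_inv_cancel, S.rhoTotal_one]⟩
  rw [← S.rhoTotal_mul, S.thetaTerm_rhoTotal hN hs, S.thetaTerm_rhoTotal hN hs, S.mult_mul,
    mul_assoc]

/-- Left multiplication by γ permutes the terms up to the common factor `mult`. Pulling a constant
out of a `tsum` over a field requires no convergence. -/
lemma theta_mem_equivariantFunctions (hN : 0 < N) {Om : Matrix (Fin n) (Fin n) ℂ} (hs : Omᵀ = Om)
    (m : Fin n → ℤ) : S.theta (fun _ => Om) m ∈ S.equivariantFunctions := by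
  intro γ p
  rw [theta, ← (Equiv.mulLeft γ).tsum_eq]
  simp only [Equiv.coe_mulLeft, S.thetaTerm_mul_rhoTotal hN hs]
  exact tsum_mul_left

/-! ### The orbits of the lattice points -/

lemma NrhoInt_bijective (hN : 0 < N) (γ : Γ) : Function.Bijective (S.NrhoInt γ) := by
  constructor
  · intro k l h
    have h1 := congrArg (ratPoint N) h
    rw [S.ratPoint_NrhoInt hN, S.ratPoint_NrhoInt hN] at h1
    have h2 := congrArg (S.rho γ⁻¹) h1
    rw [S.rho_inv_cancel, S.rho_inv_cancel] at h2
    exact ratPoint_injective hN h2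
  · intro k
    refine ⟨S.NrhoInt γ⁻¹ k, ratPoint_injective hN ?_⟩
    rw [S.ratPoint_NrhoInt hN, S.ratPoint_NrhoInt hN, S.rho_cancel_inv]

/-- Both γ'⁻¹γ and 1 carry m/N into F, and the group element doing so is unique. -/
lemma orbit_injective (hN : 0 < N) {F : Set (Fin n → ℝ)} (hF : S.IsFundDomain F)
    {m m' : LatticePoints N F} {γ γ' : Γ} (h : S.NrhoInt γ m.1 = S.NrhoInt γ' m'.1) :
    m = m' ∧ γ = γ' := by
  have h1 := congrArg (ratPoint N) h
  rw [S.ratPoint_NrhoInt hN, S.ratPoint_NrhoInt hN] at h1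
  have h2 : S.rho (γ'⁻¹ * γ) (ratPoint N m.1) = ratPoint N m'.1 := by
    rw [S.rho_mul, h1, S.rho_inv_cancel]
  have h3 : γ'⁻¹ * γ = 1 := (hF (ratPoint N m.1)).unique (by rw [h2]; exact m'.2)
    (by rw [S.rho_one]; exact m.2)
  rw [h3, S.rho_one] at h2
  exact ⟨Subtype.ext (ratPoint_injective hN h2), (inv_mul_eq_one.1 h3).symm⟩

lemma orbit_bijective (hN : 0 < N) {F : Set (Fin n → ℝ)} (hF : S.IsFundDomain F) :
    Function.Bijective fun q : LatticePoints N F × Γ => S.NrhoInt q.2 q.1.1 := by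
  constructor
  · rintro ⟨m, γ⟩ ⟨m', γ'⟩ h
    obtain ⟨h1, h2⟩ := S.orbit_injective hN hF h
    exact Prod.ext h1 h2
  · intro k
    obtain ⟨γ, hγ, -⟩ := hF (ratPoint N k)
    -- γ moves k/N into F, so k is recovered from its representative by γ⁻¹.
    refine ⟨(⟨S.NrhoInt γ k, by rw [S.ratPoint_NrhoInt hN]; exact hγ⟩, γ⁻¹), ?_⟩
    refine ratPoint_injective hN ?_
    change ratPoint N (S.NrhoInt γ⁻¹ (S.NrhoInt γ k)) = ratPoint N k
    rw [S.ratPoint_NrhoInt hN, S.ratPoint_NrhoInt hN, S.rho_inv_cancel]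

lemma NrhoInt_injective_left (hN : 0 < N) (m : Fin n → ℤ) :
    Function.Injective fun γ => S.NrhoInt γ m := by
  intro γ γ' h
  have h1 := congrArg (ratPoint N) h
  simp only [S.ratPoint_NrhoInt hN] at h1
  have h2 : S.rho (γ'⁻¹ * γ) (ratPoint N m) = ratPoint N m := by
    rw [S.rho_mul, h1, S.rho_inv_cancel]
  exact (inv_mul_eq_one.1 (S.free _ _ h2)).symm

/-! ### The sections `ϑ_{m/N}` for constant `Z` -/

section Theta

variable {S} {Z : Matrix (Fin n) (Fin n) ℂ} (hN : 0 < N) (hZ : Z ∈ siegel n)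
  (hinv : ∀ γ x, S.dRhoTotal γ x * siegelJ Z = siegelJ Z * S.dRhoTotal γ x)

lemma one_mul_gaussCoeff_rapidDecay {n N : ℕ} (hN : 0 < N) {Z : Matrix (Fin n) (Fin n) ℂ}
    (hZ : Z ∈ siegel n) :
    RapidDecay fun k => (1 : ℂ) * gaussCoeff N (siegelOmega Z) k := by
  simpa only [one_mul] using rapidDecay_gaussCoeff hN (siegelOmega_symm hZ) (siegelOmega_im_posDef hZ)

include hN hZ hinv

/-- Up to unimodular factors the terms are basic solutions with distinct frequencies, so the
majorant over ℤⁿ restricts to the orbit. -/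
lemma convergesOnCompacts_theta (m : Fin n → ℤ) :
    ConvergesOnCompacts (S.thetaTerm (fun _ => siegelOmega Z) m)
      (S.theta (fun _ => siegelOmega Z) m) := by
  refine convergesOnCompacts_of_bound fun K hK => ?_
  obtain ⟨v, hv, hv'⟩ := basicTerm_bound hN (siegelOmega_symm hZ)
    (one_mul_gaussCoeff_rapidDecay hN hZ) hK
  refine ⟨fun γ => v (S.NrhoInt γ m), hv.comp_injective (S.NrhoInt_injective_left hN m),
    fun γ p hp => ?_⟩
  rw [S.thetaTerm_eq_basicTerm hN hZ hinv, norm_mul, S.norm_phase]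
  simpa using hv' (S.NrhoInt γ m) p hp

lemma hasSum_theta (m : Fin n → ℤ) (p : Total n) :
    HasSum (fun γ => S.phase m γ * basicTerm N (siegelOmega Z) (S.NrhoInt γ m) p)
      (S.theta (fun _ => siegelOmega Z) m p) := by
  simpa only [S.thetaTerm_eq_basicTerm hN hZ hinv] using
    (convergesOnCompacts_theta hN hZ hinv m).hasSum p

lemma theta_eq_expSeries (m : Fin n → ℤ) : ∃ b, RapidDecay b ∧ ∀ p : Cover n,
    S.theta (fun _ => siegelOmega Z) m (coverProj p) =
      vacuum N (siegelOmega Z) p.1 * expSeries b (zetaMap (siegelOmega Z) p) := by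
  have hinj := S.NrhoInt_injective_left hN m
  -- Phases on the orbit of m and zero elsewhere: coefficients of norm at most 1, which preserve the
  -- decay of `gaussCoeff`.
  let c : (Fin n → ℤ) → ℂ := Function.extend (fun γ => S.NrhoInt γ m) (S.phase m) 0
  have hcγ : ∀ γ, c (S.NrhoInt γ m) = S.phase m γ := fun γ => hinj.extend_apply _ _ γ
  have hc0 : ∀ k, k ∉ Set.range (fun γ => S.NrhoInt γ m) → c k = 0 := fun k hk =>
    Function.extend_apply' _ _ _ hk
  have hc1 : ∀ k, ‖c k‖ ≤ 1 := fun k => by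
    by_cases hk : k ∈ Set.range (fun γ => S.NrhoInt γ m)
    · obtain ⟨γ, rfl⟩ := hk
      rw [hcγ, S.norm_phase]
    · rw [hc0 k hk, norm_zero]
      exact zero_le_one
  refine ⟨fun k => c k * gaussCoeff N (siegelOmega Z) k,
    (rapidDecay_gaussCoeff hN (siegelOmega_symm hZ) (siegelOmega_im_posDef hZ)).mul_bounded hc1,
    fun p => ?_⟩
  rw [← (hasSum_theta hN hZ hinv m _).tsum_eq, expSeries, ← tsum_mul_left,
    ← hinj.tsum_eq (f := fun k => vacuum N (siegelOmega Z) p.1 *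
      (c k * gaussCoeff N (siegelOmega Z) k * expChar k (zetaMap (siegelOmega Z) p)))]
  · refine tsum_congr fun γ => ?_
    rw [basicTerm_coverProj hN (siegelOmega_symm hZ), hcγ]
    ring
  · intro k hk
    by_contra hk'
    exact hk (by simp [hc0 k hk'])

lemma continuous_theta (m : Fin n → ℤ) : Continuous (S.theta (fun _ => siegelOmega Z) m) := by
  obtain ⟨b, hb, hb'⟩ := theta_eq_expSeries hN hZ hinv m
  exact continuous_of_comp_coverProj (contDiff_covDeriv_of_expSeries N hZ hb hb').1.continuous

/-- The Fourier coefficients of `ϑ_{m/N}` at the points of the fundamental domain. -/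
lemma exists_mFourierCoeff_theta {F : Set (Fin n → ℝ)} (hF : S.IsFundDomain F)
    (l : LatticePoints N F) : ∃ d : ℂ, d ≠ 0 ∧ ∀ m : LatticePoints N F,
      UnitAddTorus.mFourierCoeff (fun y => S.theta (fun _ => siegelOmega Z) m.1 (0, y)) l.1 =
        if m = l then d else 0 := by
  classical
  have hl : S.NrhoInt 1 l.1 = l.1 := ratPoint_injective hN (by
    rw [S.ratPoint_NrhoInt hN, S.rho_one])
  refine ⟨S.phase l.1 1 * basicTerm N (siegelOmega Z) l.1 (0, 0),
    mul_ne_zero (S.phase_ne_zero _ _) (basicTerm_ne_zero _ _ _ _), fun m => ?_⟩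
  have h1 := hasSum_mFourierCoeff_basicTerm (κ := fun γ => S.NrhoInt γ m.1)
    (fun y => hasSum_theta hN hZ hinv m.1 (0, y)) l.1
  refine h1.unique ?_
  -- The frequency l occurs only in the series of l itself, and there only for γ = 1.
  have h2 : ∀ γ, S.NrhoInt γ m.1 = l.1 → m = l ∧ γ = 1 := fun γ h =>
    S.orbit_injective hN hF (h.trans hl.symm)
  by_cases hm : m = l
  · subst hm
    simp only [if_true]
    convert hasSum_ite_eq (1 : Γ) (S.phase m.1 1 * basicTerm N (siegelOmega Z) m.1 (0, 0))
      using 2 with γ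
    by_cases hγ : γ = 1
    · subst hγ; simp [hl]
    · rw [if_neg hγ, if_neg fun h => hγ (h2 γ h).2, mul_zero]
  · simp only [hm, if_false]
    convert hasSum_zero using 2 with γ
    rw [if_neg fun h => hm (h2 γ h).1, mul_zero]

/-- The coefficients of an expansion in the `ϑ_{m/N}` are determined by its sum. -/
lemma theta_expansion_unique {F : Set (Fin n → ℝ)} (hF : S.IsFundDomain F) {s : Total n → ℂ}
    {a a' : LatticePoints N F → ℂ}
    (h : ConvergesOnCompacts (fun (m : LatticePoints N F) p =>
      a m * S.theta (fun _ => siegelOmega Z) m.1 p) s)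
    (h' : ConvergesOnCompacts (fun (m : LatticePoints N F) p =>
      a' m * S.theta (fun _ => siegelOmega Z) m.1 p) s) : a = a' := by
  classical
  ext l
  obtain ⟨d, hd, hd'⟩ := exists_mFourierCoeff_theta hN hZ hinv hF l
  have key : ∀ {a : LatticePoints N F → ℂ}, ConvergesOnCompacts (fun (m : LatticePoints N F) p =>
      a m * S.theta (fun _ => siegelOmega Z) m.1 p) s →
      UnitAddTorus.mFourierCoeff (fun y => s (0, y)) l.1 = a l * d := by
    intro a ha
    -- Uniform convergence on the compact fibre over 0 allows Fourier coefficients to be taken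
    -- termwise.
    have hK : IsCompact (({0} : Set (Fin n → ℝ)) ×ˢ (Set.univ : Set (Torus n))) :=
      isCompact_singleton.prod isCompact_univ
    have h1 : TendstoUniformly (fun (t : Finset (LatticePoints N F)) y =>
        ∑ m ∈ t, a m * S.theta (fun _ => siegelOmega Z) m.1 (0, y)) (fun y => s (0, y))
        Filter.atTop := by
      rw [← tendstoUniformlyOn_univ]
      refine ((ha.2 _ hK).2.comp fun y => ((0, y) : Total n)).mono fun y _ => ?_
      simp
    have h2 := hasSum_mFourierCoeff
      (F := fun (m : LatticePoints N F) y => a m * S.theta (fun _ => siegelOmega Z) m.1 (0, y))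
      (f := fun y => s (0, y)) (fun m => continuous_const.mul
        ((continuous_theta hN hZ hinv m.1).comp (by fun_prop))) h1 l.1
    refine h2.unique (hasSum_of_eq (hasSum_ite_eq l (a l * d)) fun m => ?_)
    rw [mFourierCoeff_const_mul, hd']
    by_cases hm : m = l
    · subst hm; simp
    · simp [hm]
  exact mul_right_cancel₀ hd ((key h).symm.trans (key h'))

/-- Existence of the expansion of a holomorphic section in the `ϑ_{m/N}`. -/
lemma exists_theta_expansion {F : Set (Fin n → ℝ)} (hF : S.IsFundDomain F) {s : Total n → ℂ}
    (hs : ContDiff ℝ ∞ fun p : Cover n => s (coverProj p))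
    (hcov : ∀ p v : Cover n, covDeriv N s p v +
      Complex.I * covDeriv N s p (applyTangent (siegelJ Z) v) = 0)
    (heq : s ∈ S.equivariantFunctions) :
    ∃ a : LatticePoints N F → ℂ, ConvergesOnCompacts (fun (m : LatticePoints N F) p =>
      a m * S.theta (fun _ => siegelOmega Z) m.1 p) s := by
  set Om := siegelOmega Z with hOm
  have hsym : Omᵀ = Om := siegelOmega_symm hZ
  obtain ⟨b, hb, hb'⟩ := exists_expSeries_of_covDeriv N hZ hs hcov
  -- Coefficients with respect to the basic solutions rather than the characters.
  let c : (Fin n → ℤ) → ℂ := fun k => b k / gaussCoeff N Om k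
  have hcb : ∀ k, c k * gaussCoeff N Om k = b k := fun k =>
    div_mul_cancel₀ _ (gaussCoeff_ne_zero N Om k)
  have hc : RapidDecay fun k => c k * gaussCoeff N Om k := by simpa only [hcb] using hb
  have hsum : ∀ p, HasSum (fun k => c k * basicTerm N Om k p) (s p) := by
    intro p
    obtain ⟨p, rfl⟩ := isOpenQuotientMap_coverProj.surjective p
    rw [hb']
    refine hasSum_of_eq ((hb.summable (zetaMap Om p)).hasSum.mul_left (vacuum N Om p.1)) fun k => ?_
    rw [basicTerm_coverProj hN hsym, ← hcb]
    ring
  -- Expanding s at ρ̃_γ(0, y), dividing by the multiplier and reindexing by k ↦ Nρ_γ(k/N) gives a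
  -- second expansion of s on the fibre over 0; its coefficients must agree with c.
  have hcoeff : ∀ γ k, c (S.NrhoInt γ k) = c k * S.phase k γ := by
    intro γ k
    have h1 : c = fun k => c (S.NrhoInt γ k) * (S.phase k γ)⁻¹ := by
      refine basicTerm_coeff_unique (x := 0) (fun y => hsum (0, y)) fun y => ?_
      have h2 := (Equiv.ofBijective _ (S.NrhoInt_bijective hN γ)).hasSum_iff.2
        (hsum (S.rhoTotal γ (0, y)))
      rw [heq γ (0, y)] at h2
      have h3 := h2.mul_left (S.mult γ (0, y))⁻¹
      rw [inv_mul_cancel_left₀ (S.mult_ne_zero γ (0, y))] at h3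
      refine hasSum_of_eq h3 fun k => ?_
      have h4 : S.phase k γ * basicTerm N Om (S.NrhoInt γ k) (S.rhoTotal γ (0, y)) =
          S.mult γ (0, y) * basicTerm N Om k (0, y) := by
        rw [← S.thetaTerm_eq_basicTerm hN hZ hinv, S.thetaTerm_rhoTotal hN hsym]
      have h5 : basicTerm N Om (S.NrhoInt γ k) (S.rhoTotal γ (0, y)) =
          (S.phase k γ)⁻¹ * (S.mult γ (0, y) * basicTerm N Om k (0, y)) := by
        rw [← h4, inv_mul_cancel_left₀ (S.phase_ne_zero k γ)]
      simp only [Function.comp_apply, Equiv.ofBijective_apply]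
      rw [h5]
      field_simp [S.mult_ne_zero γ (0, y)]
    rw [congrFun h1 k, inv_mul_cancel_right₀ (S.phase_ne_zero k γ)]
  -- Regroups ℤⁿ into Γ-orbits indexed by F ∩ (1/N)ℤⁿ; by `hcoeff`, the orbit of m sums to c_m
  -- ϑ_{m/N}.
  let e := Equiv.ofBijective _ (S.orbit_bijective hN hF)
  have hterm : ∀ (m : LatticePoints N F) p, HasSum
      (fun γ => c (e (m, γ)) * basicTerm N Om (e (m, γ)) p)
      (c m.1 * S.theta (fun _ => Om) m.1 p) := by
    intro m p
    refine hasSum_of_eq ((hasSum_theta hN hZ hinv m.1 p).mul_left (c m.1)) fun γ => ?_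
    change c (S.NrhoInt γ m.1) * basicTerm N Om (S.NrhoInt γ m.1) p = _
    rw [hcoeff, mul_assoc]
  refine ⟨fun m => c m.1, ?_⟩
  have hs' : s = fun p => ∑' m : LatticePoints N F, c m.1 * S.theta (fun _ => Om) m.1 p := by
    ext p
    have h1 := e.hasSum_iff.2 (hsum p)
    exact (h1.prod_fiberwise fun m => hterm m p).tsum_eq.symm
  rw [hs']
  refine convergesOnCompacts_of_bound fun K hK => ?_
  obtain ⟨v, hv, hv'⟩ := basicTerm_bound hN hsym hc hK
  have hve : Summable fun q => v (e q) := e.summable_iff.2 hv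
  -- The majorant of a whole orbit is the sum of the majorants of its points.
  refine ⟨fun m => ∑' γ, v (e (m, γ)), hve.prod, fun m p hp => ?_⟩
  rw [← (hterm m p).tsum_eq]
  exact tsum_of_norm_bounded (hve.prod_factor m).hasSum fun γ => hv' _ p hp

end Theta

end PrequantumAction

/-! ### Quotient maps and complex coordinates -/

lemma isOpenQuotientMap_orbit {Γ X : Type*} [Group Γ] [TopologicalSpace X] (f : Γ → X → X)
    (h1 : ∀ x, f 1 x = x) (hm : ∀ a b x, f (a * b) x = f a (f b x)) (hc : ∀ γ, Continuous (f γ)) :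
    IsOpenQuotientMap (Quotient.mk (orbitSetoid f h1 hm)) := by
  refine ⟨Quotient.mk_surjective, continuous_quot_mk, fun U hU => ?_⟩
  -- The saturation of U is the union of its preimages under the group elements, hence open.
  have h : Quotient.mk (orbitSetoid f h1 hm) ⁻¹' (Quotient.mk (orbitSetoid f h1 hm) '' U) =
      ⋃ γ, f γ ⁻¹' U := by
    ext x
    simp only [Set.mem_preimage, Set.mem_image, Set.mem_iUnion]
    constructor
    · rintro ⟨y, hy, hyx⟩
      obtain ⟨γ, hγ⟩ := Quotient.exact hyx.symm
      exact ⟨γ, by rwa [hγ]⟩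
    · rintro ⟨γ, hγ⟩
      exact ⟨f γ x, hγ, (Quotient.sound (⟨γ, rfl⟩ : ∃ γ', f γ' x = f γ x)).symm⟩
  change IsOpen (Quotient.mk (orbitSetoid f h1 hm) ⁻¹' _)
  rw [h]
  exact isOpen_iUnion fun γ => hU.preimage (hc γ)

namespace PrequantumAction

variable {n N : ℕ} {Γ : Type*} [Group Γ] (S : PrequantumAction n N Γ)

lemma continuous_rho (γ : Γ) : Continuous (S.rho γ) := by
  unfold ActionData.rho
  fun_prop

/-- The lift of `ρ̃_γ` to `ℝⁿ × ℝⁿ`. -/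
noncomputable def coverAction (γ : Γ) (p : Cover n) : Cover n :=
  (S.rho γ p.1, (S.Ainvt γ).map (Int.cast : ℤ → ℝ) *ᵥ p.2 + S.u γ p.1)

lemma coverProj_coverAction (γ : Γ) (p : Cover n) :
    coverProj (S.coverAction γ p) = S.rhoTotal γ (coverProj p) := by
  simp only [coverProj, coverAction, ActionData.rhoTotal, torusMul_toTorus, toTorus_add]

lemma contDiff_coverAction (γ : Γ) : ContDiff ℝ ∞ (S.coverAction γ) := by
  have h1 : ContDiff ℝ ∞ fun x => S.AR γ *ᵥ x :=
    (LinearMap.toContinuousLinearMap (S.AR γ).mulVecLin).contDiff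
  have h2 : ContDiff ℝ ∞ fun x => (S.Ainvt γ).map (Int.cast : ℤ → ℝ) *ᵥ x :=
    (LinearMap.toContinuousLinearMap ((S.Ainvt γ).map (Int.cast : ℤ → ℝ)).mulVecLin).contDiff
  exact ((h1.comp contDiff_fst).add contDiff_const).prodMk
    ((h2.comp contDiff_snd).add ((S.u_smooth γ).comp contDiff_fst))

/-- Identifies the matrix in `CompatibleACS.invariant` with the actual differential of the lifted
action. -/
lemma fderiv_coverAction (γ : Γ) (p v : Cover n) :
    fderiv ℝ (S.coverAction γ) p v = applyTangent (S.dRhoTotal γ p.1) v := by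
  have hu : HasFDerivAt (S.u γ) (fderiv ℝ (S.u γ) p.1) p.1 :=
    ((S.u_smooth γ).differentiable (by simp) _).hasFDerivAt
  have h1 : HasFDerivAt (fun x => S.AR γ *ᵥ x)
    (LinearMap.toContinuousLinearMap (S.AR γ).mulVecLin) p.1 :=
    (LinearMap.toContinuousLinearMap (S.AR γ).mulVecLin).hasFDerivAt
  have h2 : HasFDerivAt (fun x => (S.Ainvt γ).map (Int.cast : ℤ → ℝ) *ᵥ x)
    (LinearMap.toContinuousLinearMap ((S.Ainvt γ).map (Int.cast : ℤ → ℝ)).mulVecLin) p.2 :=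
    (LinearMap.toContinuousLinearMap ((S.Ainvt γ).map (Int.cast : ℤ → ℝ)).mulVecLin).hasFDerivAt
  have h3 : HasFDerivAt (S.coverAction γ) _ p :=
    ((h1.comp p hasFDerivAt_fst).add_const (S.c γ)).prodMk
      ((h2.comp p hasFDerivAt_snd).add (hu.comp p hasFDerivAt_fst))
  have h4 : S.Du γ p.1 *ᵥ v.1 = fderiv ℝ (S.u γ) p.1 v.1 := by
    rw [ActionData.Du, jacobiMatrix, LinearMap.toMatrix'_mulVec]
    rfl
  rw [h3.fderiv, ActionData.dRhoTotal]
  refine Prod.ext ?_ ?_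
  · rw [applyTangent_fst, Matrix.zero_mulVec, add_zero]
    rfl
  · rw [applyTangent_snd, h4, add_comm]
    rfl

lemma continuous_rhoTotal (γ : Γ) : Continuous (S.rhoTotal γ) := by
  refine continuous_of_comp_coverProj ?_
  simp only [← S.coverProj_coverAction]
  exact isOpenQuotientMap_coverProj.continuous.comp (S.contDiff_coverAction γ).continuous

lemma isOpenQuotientMap_coverMap : IsOpenQuotientMap S.coverMap :=
  (isOpenQuotientMap_orbit S.rhoTotal S.rhoTotal_one S.rhoTotal_mul S.continuous_rhoTotal).comp
    isOpenQuotientMap_coverProj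

lemma coverMap_eq_iff (p q : Cover n) : S.coverMap p = S.coverMap q ↔
    ∃ (γ : Γ) (k : Fin n → ℤ), q = S.coverAction γ p + (0, fun i => (k i : ℝ)) := by
  constructor
  · intro h
    obtain ⟨γ, hγ⟩ := Quotient.exact h
    rw [← S.coverProj_coverAction] at hγ
    obtain ⟨k, hk⟩ := (toTorus_eq_iff _ _).1 (congrArg Prod.snd hγ).symm
    have hγ1 : (S.coverAction γ p).1 = q.1 := congrArg (fun z : Total n => z.1) hγ
    refine ⟨γ, k, Prod.ext ?_ ?_⟩
    · simp [hγ1]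
    · ext i
      simp [hk]
  · rintro ⟨γ, k, rfl⟩
    have h1 : coverProj (S.coverAction γ p + (0, fun i => (k i : ℝ))) =
        S.rhoTotal γ (coverProj p) := by
      rw [← S.coverProj_coverAction]
      refine Prod.ext ?_ ((toTorus_eq_iff _ _).2 ⟨k, fun i => ?_⟩)
      · simp [coverProj]
      · simp
    rw [coverMap, coverMap, h1, S.toMfd_rhoTotal]

/-- Each point of `ℝⁿ` has a neighbourhood that is disjoint from its translates. -/
lemma exists_wandering_nhd (x : Fin n → ℝ) :
    ∃ V : Set (Fin n → ℝ), IsOpen V ∧ x ∈ V ∧ ∀ γ, ∀ y ∈ V, S.rho γ y ∈ V → γ = 1 := by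
  -- All but finitely many γ move the unit ball off itself; for the others, freeness and the
  -- Hausdorff property separate x from ρ_γ(x).
  have hfin := S.properlyDiscontinuous _ (isCompact_closedBall x 1)
  have h1 : ∀ γ, ∃ V ∈ nhds x, γ ≠ 1 → ∀ y ∈ V, S.rho γ y ∉ V := by
    intro γ
    by_cases hγ : γ = 1
    · exact ⟨Set.univ, Filter.univ_mem, fun h => absurd hγ h⟩
    · obtain ⟨A, B, hA, hB, hxA, hxB, hAB⟩ := t2_separation fun h => hγ (S.free γ x h)
      refine ⟨B ∩ S.rho γ ⁻¹' A, Filter.inter_mem (hB.mem_nhds hxB)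
        ((hA.preimage (S.continuous_rho γ)).mem_nhds hxA), fun _ y hy hy' => ?_⟩
      exact Set.disjoint_left.1 hAB hy.2 hy'.1
  choose V hV hV' using h1
  have h2 : Metric.ball x 1 ∩ ⋂ γ ∈ {γ : Γ | (S.rho γ '' Metric.closedBall x 1 ∩
      Metric.closedBall x 1).Nonempty}, V γ ∈ nhds x :=
    Filter.inter_mem (Metric.ball_mem_nhds x one_pos)
      ((Filter.biInter_mem hfin).2 fun γ _ => hV γ)
  obtain ⟨W, hW, hWo, hxW⟩ := mem_nhds_iff.1 h2
  refine ⟨W, hWo, hxW, fun γ y hy hy' => ?_⟩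
  by_contra hγ
  have hmem : γ ∈ {γ : Γ | (S.rho γ '' Metric.closedBall x 1 ∩
      Metric.closedBall x 1).Nonempty} :=
    ⟨S.rho γ y, ⟨y, Metric.ball_subset_closedBall (hW hy).1, rfl⟩,
      Metric.ball_subset_closedBall (hW hy').1⟩
  exact hV' γ hγ y (Set.mem_iInter₂.1 (hW hy).2 γ hmem) (Set.mem_iInter₂.1 (hW hy').2 γ hmem)

lemma coverMap_locally_injective (p : Cover n) :
    ∃ U : Set (Cover n), IsOpen U ∧ p ∈ U ∧ Set.InjOn S.coverMap U := by
  obtain ⟨V, hV, hpV, hV'⟩ := S.exists_wandering_nhd p.1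
  -- V forces γ = 1, and in a ball of radius 1/2 two points differing by an integer vector coincide.
  refine ⟨V ×ˢ Metric.ball p.2 (1 / 2), hV.prod Metric.isOpen_ball,
    ⟨hpV, Metric.mem_ball_self (by norm_num)⟩, ?_⟩
  rintro q ⟨hq1, hq2⟩ r ⟨hr1, hr2⟩ h
  obtain ⟨γ, hγ⟩ := Quotient.exact h
  have h1 : S.rho γ q.1 = r.1 := congrArg Prod.fst hγ
  have h2 : γ = 1 := hV' γ q.1 hq1 (by rw [h1]; exact hr1)
  have h3 : coverProj q = coverProj r := by
    rw [← S.rhoTotal_one (coverProj q), ← h2]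
    exact hγ
  refine Prod.ext (congrArg (fun z : Total n => z.1) h3) ?_
  obtain ⟨k, hk⟩ := (toTorus_eq_iff _ _).1 (congrArg Prod.snd h3)
  ext i
  have hd : dist q.2 r.2 < 1 := by
    have := dist_triangle_right q.2 r.2 p.2
    have h4 := Metric.mem_ball.1 hq2
    have h5 := Metric.mem_ball.1 hr2
    linarith
  have h6 : |(k i : ℝ)| < 1 := by
    have h7 := (dist_le_pi_dist q.2 r.2 i).trans_lt hd
    rwa [hk i, Real.dist_eq, add_sub_cancel_left] at h7
  have h8 : k i = 0 := by
    rw [← Int.abs_lt_one_iff]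
    exact_mod_cast h6
  rw [hk i, h8]
  simp

variable {S} {Z : Matrix (Fin n) (Fin n) ℂ}

/-- The chart inverts the covering on a small U and applies ζ. On any other sheet it reads ζ after a
deck transformation, whose differential commutes with J. -/
lemma isIntegrable_of_const (hZ : Z ∈ siegel n) (J : S.CompatibleACS)
    (hJ : ∀ p, J.J p = siegelJ Z)
    (hinv : ∀ γ x, S.dRhoTotal γ x * siegelJ Z = siegelJ Z * S.dRhoTotal γ x) :
    S.IsIntegrable J := by
  intro b
  obtain ⟨p₀, rfl⟩ := S.isOpenQuotientMap_coverMap.surjective b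
  obtain ⟨U, hU, hpU, hinj⟩ := S.coverMap_locally_injective p₀
  have hbij := zetaMap_bijective (siegelOmega_im_posDef hZ)
  let ζ : Cover n ≃L[ℝ] (Fin n → ℂ) :=
    (LinearEquiv.ofBijective (zetaMap (siegelOmega Z) : Cover n →ₗ[ℝ] (Fin n → ℂ))
      hbij).toContinuousLinearEquiv
  have hζ : ∀ v, ζ v = zetaMap (siegelOmega Z) v := fun v => rfl
  let φ : OpenPartialHomeomorph (Cover n) S.Mfd := OpenPartialHomeomorph.ofContinuousOpen
    ((Set.InjOn.bijOn_image hinj).toPartialEquiv S.coverMap U (S.coverMap '' U))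
    S.isOpenQuotientMap_coverMap.continuous.continuousOn S.isOpenQuotientMap_coverMap.isOpenMap hU
  have hφ : ∀ q ∈ U, φ.symm (S.coverMap q) = q := fun q hq => φ.left_inv hq
  let e : OpenPartialHomeomorph S.Mfd (Fin n → ℂ) :=
    φ.symm.trans ζ.toHomeomorph.toOpenPartialHomeomorph
  have hsource : e.source = S.coverMap '' U := by
    simp [e]
    rfl
  have he : ∀ q ∈ U, e (S.coverMap q) = zetaMap (siegelOmega Z) q := fun q hq => by
    change ζ (φ.symm (S.coverMap q)) = _
    rw [hφ q hq, hζ]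
  refine ⟨e, by rw [hsource]; exact ⟨p₀, hpU, rfl⟩, fun p hp => ?_⟩
  rw [hsource] at hp
  obtain ⟨p', hp', hpp'⟩ := hp
  -- The point p need not lie in U; the deck transformation given by γ and k carries it there.
  obtain ⟨γ, k, hk⟩ := (S.coverMap_eq_iff p p').1 hpp'.symm
  let w : Cover n := (0, fun i => (k i : ℝ))
  have hev : (fun q => e (S.coverMap q)) =ᶠ[nhds p]
      fun q => zetaMap (siegelOmega Z) (S.coverAction γ q + w) := by
    have hc : Continuous fun q => S.coverAction γ q + w :=
      (S.contDiff_coverAction γ).continuous.add continuous_const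
    have hmem : ∀ᶠ q in nhds p, S.coverAction γ q + w ∈ U :=
      hc.continuousAt.eventually_mem (hU.mem_nhds (by rw [← hk]; exact hp'))
    filter_upwards [hmem] with q hq
    rw [← he _ hq, (S.coverMap_eq_iff q (S.coverAction γ q + w)).2 ⟨γ, k, rfl⟩]
  have hsm : ContDiff ℝ ∞ fun q => zetaMap (siegelOmega Z) (S.coverAction γ q + w) :=
    (zetaMap (siegelOmega Z)).contDiff.comp ((S.contDiff_coverAction γ).add contDiff_const)
  have hder : ∀ v, fderiv ℝ (fun q => e (S.coverMap q)) p v =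
      zetaMap (siegelOmega Z) (applyTangent (S.dRhoTotal γ p.1) v) := by
    intro v
    have h1 := (zetaMap (siegelOmega Z)).hasFDerivAt.comp p
      (((S.contDiff_coverAction γ).differentiable (by simp) p).hasFDerivAt.add_const w)
    rw [hev.fderiv_eq, ← S.fderiv_coverAction]
    exact congrArg (fun L : Cover n →L[ℝ] (Fin n → ℂ) => L v) h1.fderiv
  refine ⟨hsm.contDiffAt.congr_of_eventuallyEq hev, ?_, fun v => ?_⟩
  · have h2 : (fun v => fderiv ℝ (fun q => e (S.coverMap q)) p v) =
        zetaMap (siegelOmega Z) ∘ applyTangent (S.dRhoTotal γ p.1) := funext hder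
    change Function.Bijective (fun v => fderiv ℝ (fun q => e (S.coverMap q)) p v)
    rw [h2]
    refine hbij.comp ?_
    have hB := S.AR_transpose_mul_Ainvt γ
    have hA : IsUnit (S.AR γ).det := by
      have := congrArg Matrix.det hB
      rw [Matrix.det_mul, Matrix.det_transpose, Matrix.det_one] at this
      exact IsUnit.of_mul_eq_one _ this
    have hB' : IsUnit ((S.Ainvt γ).map (Int.cast : ℤ → ℝ)).det := by
      have := congrArg Matrix.det hB
      rw [Matrix.det_mul, Matrix.det_one, mul_comm] at this
      exact IsUnit.of_mul_eq_one _ this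
    have hdet : IsUnit (S.dRhoTotal γ p.1).det := by
      rw [ActionData.dRhoTotal, Matrix.det_fromBlocks_zero₁₂]
      exact hA.mul hB'
    have hone : ∀ v : Cover n, applyTangent (1 : Matrix (Fin n ⊕ Fin n) (Fin n ⊕ Fin n) ℝ) v = v :=
      fun v => by
        refine Prod.ext ?_ ?_ <;> ext i <;> simp [applyTangent]
    refine Function.bijective_iff_has_inverse.2
      ⟨applyTangent (S.dRhoTotal γ p.1)⁻¹, fun v => ?_, fun v => ?_⟩
    · rw [← applyTangent_mul, Matrix.nonsing_inv_mul _ hdet, hone]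
    · rw [← applyTangent_mul, Matrix.mul_nonsing_inv _ hdet, hone]
  · rw [hder, hder, hJ, ← applyTangent_mul, hinv, applyTangent_mul, zetaMap_siegelJ hZ]

/-- If `B` is compact, then there are finitely many lattice points in the fundamental domain. -/
lemma finite_latticePoints (hN : 0 < N) {F : Set (Fin n → ℝ)} (hF : S.IsFundDomain F)
    (hB : CompactSpace S.Base) : Finite (LatticePoints N F) := by
  have hq := isOpenQuotientMap_orbit S.rho S.rho_one S.rho_mul S.continuous_rho
  let π : (Fin n → ℝ) → S.Base := Quotient.mk _
  -- The images of the balls of integer radius form a directed open cover of B, so one ball meets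
  -- every orbit.
  obtain ⟨r, hr⟩ := isCompact_univ.elim_directed_cover
    (fun r : ℕ => π '' Metric.ball 0 r) (fun r => hq.isOpenMap _ Metric.isOpen_ball)
    (fun b _ => by
      obtain ⟨x, rfl⟩ := hq.surjective b
      obtain ⟨r, hr⟩ := exists_nat_gt ‖x‖
      exact Set.mem_iUnion.2 ⟨r, x, by simpa using hr, rfl⟩)
    (directed_of_isDirected_le fun a b hab =>
      Set.image_mono (Metric.ball_subset_ball (by exact_mod_cast hab)))
  have h1 : ∀ m : LatticePoints N F, ∃ γ, S.rho γ (ratPoint N m.1) ∈ Metric.ball 0 (r : ℝ) := by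
    intro m
    obtain ⟨x, hx, hxm⟩ := hr (Set.mem_univ (π (ratPoint N m.1)))
    obtain ⟨γ, hγ⟩ := Quotient.exact hxm.symm
    exact ⟨γ, by rw [hγ]; exact hx⟩
  choose γ hγ using h1
  have hfin : (Set.Icc (fun _ => -((N * r : ℕ) : ℤ)) (fun _ => ((N * r : ℕ) : ℤ)) :
      Set (Fin n → ℤ)).Finite := Set.finite_Icc _ _
  have := hfin.to_subtype
  -- Each lattice point is moved within its orbit into a box of integer vectors; distinct points of
  -- F lie in distinct orbits, so this is injective.
  refine Finite.of_injective (β := (Set.Icc (fun _ => -((N * r : ℕ) : ℤ))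
    (fun _ => ((N * r : ℕ) : ℤ)) : Set (Fin n → ℤ))) (fun m => ⟨S.NrhoInt (γ m) m.1, ?_⟩) ?_
  · have h2 := hγ m
    rw [← S.ratPoint_NrhoInt hN, mem_ball_zero_iff] at h2
    have hN' : (0 : ℝ) < N := by exact_mod_cast hN
    have h3 : ∀ i, |S.NrhoInt (γ m) m.1 i| ≤ ((N * r : ℕ) : ℤ) := by
      intro i
      have h4 := (norm_le_pi_norm (ratPoint N (S.NrhoInt (γ m) m.1)) i).trans h2.le
      rw [ratPoint, Real.norm_eq_abs, abs_div, abs_of_pos hN', div_le_iff₀ hN'] at h4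
      have h5 : |(S.NrhoInt (γ m) m.1 i : ℝ)| ≤ N * r := by linarith
      exact_mod_cast h5
    exact ⟨fun i => (abs_le.1 (h3 i)).1, fun i => (abs_le.1 (h3 i)).2⟩
  · intro m m' h
    exact (S.orbit_injective hN hF (Subtype.ext_iff.1 h)).1

/-- The pullback of sections as a linear map. -/
noncomputable def pullbackLinear (S : PrequantumAction n N Γ) : S.Sect →ₗ[ℂ] (Total n → ℂ) where
  toFun := S.pullback
  map_add' := S.pullback_add
  map_smul' := S.pullback_smul

lemma pullback_injective (S : PrequantumAction n N Γ) : Function.Injective S.pullback :=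
  fun _ _ h => S.sectEquiv.injective (Subtype.ext h)

end PrequantumAction

end LagrangianTorus

/-! ### The theorem -/

theorem mainTheorem9 (n N : ℕ) (hN : 0 < N) {Γ : Type*} [Group Γ]
    (S : LagrangianTorus.PrequantumAction n N Γ)
    (F : Set (Fin n → ℝ)) (hF : S.IsFundDomain F)
    (J : S.CompatibleACS)
    (Z : LagrangianTorus.Total n → Matrix (Fin n) (Fin n) ℂ)
    (hZ : ∀ p, Z p ∈ LagrangianTorus.siegel n)
    (hJ : ∀ p, J.J p = LagrangianTorus.siegelJ (Z p))
    (hconst : ∀ p q, Z p = Z q) :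
    -- (1) `Du_γ` is constant, and the series of `ϑ_{m/N}` is the explicit one
    (∀ γ x, S.Du γ x = S.Du γ 0) ∧
    (∀ (m : LagrangianTorus.LatticePoints N F) (x y : Fin n → ℝ),
      (∀ γ, S.thetaTerm (LagrangianTorus.omegaField Z) m.1 γ (x, LagrangianTorus.toTorus y) =
        S.gaussianTerm (LagrangianTorus.omegaField Z 0) m.1 γ x y) ∧
      HasSum (fun γ => S.gaussianTerm (LagrangianTorus.omegaField Z 0) m.1 γ x y)
        (S.theta (LagrangianTorus.omegaField Z) m.1 (x, LagrangianTorus.toTorus y))) ∧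
    -- (2) convergence
    (∀ m : LagrangianTorus.LatticePoints N F,
      LagrangianTorus.ConvergesOnCompacts (S.thetaTerm (LagrangianTorus.omegaField Z) m.1)
        (S.theta (LagrangianTorus.omegaField Z) m.1)) ∧
    -- (3) integrability, and the basis of the space of holomorphic sections
    S.IsIntegrable J ∧
    ∃ Θ : LagrangianTorus.LatticePoints N F → S.holomorphicSections J,
      (∀ m : LagrangianTorus.LatticePoints N F,
        S.pullback (Θ m).1 = S.theta (LagrangianTorus.omegaField Z) m.1) ∧
      LinearIndependent ℂ Θ ∧
      (∀ σ : S.holomorphicSections J, ∃! a : LagrangianTorus.LatticePoints N F → ℂ,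
        LagrangianTorus.ConvergesOnCompacts (fun m p => a m * S.pullback (Θ m).1 p)
          (S.pullback σ.1)) ∧
      (CompactSpace S.Base →
        Finite (LagrangianTorus.LatticePoints N F) ∧ Submodule.span ℂ (Set.range Θ) = ⊤) := by
  open LagrangianTorus PrequantumAction in
  have hJZ : ∀ p, J.J p = siegelJ (Z 0) := fun p => by rw [hJ, hconst p 0]
  have hinv : ∀ γ x, S.dRhoTotal γ x * siegelJ (Z 0) = siegelJ (Z 0) * S.dRhoTotal γ x :=
    fun γ x => by
      have h := J.invariant γ (x, 0)
      rwa [hJZ, hJZ] at h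
  have hOm : omegaField Z = fun _ => siegelOmega (Z 0) := by
    ext1 x
    rw [omegaField, hconst (x, 0) 0]
  have hD := S.Du_const (hZ 0) hinv
  rw [hOm]
  have hconv := convergesOnCompacts_theta hN (hZ 0) hinv
  have hterm := S.thetaTerm_eq_gaussianTerm hN (siegelOmega_symm (hZ 0)) hD
  refine ⟨hD, fun m x y => ⟨fun γ => hterm m.1 γ x y, ?_⟩, fun m => hconv m.1,
    isIntegrable_of_const (hZ 0) J hJZ hinv, ?_⟩
  · simpa only [hterm] using (hconv m.1).hasSum (x, toTorus y)
  let θ : LatticePoints N F → S.Sect := fun m => S.sectEquiv.symm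
    ⟨S.theta (fun _ => siegelOmega (Z 0)) m.1,
      S.theta_mem_equivariantFunctions hN (siegelOmega_symm (hZ 0)) m.1⟩
  have hθ : ∀ m, S.pullback (θ m) = S.theta (fun _ => siegelOmega (Z 0)) m.1 := fun m =>
    congrArg Subtype.val (S.sectEquiv.apply_symm_apply _)
  have hhol : ∀ m, θ m ∈ S.holomorphicSections J := fun m => by
    obtain ⟨b, hb, hb'⟩ := theta_eq_expSeries hN (hZ 0) hinv m.1
    have h := contDiff_covDeriv_of_expSeries N (hZ 0) hb hb'
    rw [← hθ] at h
    refine ⟨h.1, fun p v => ?_⟩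
    rw [hJZ]
    exact h.2 p v
  have hex : ∀ σ : S.holomorphicSections J, ∃ a : LatticePoints N F → ℂ,
      ConvergesOnCompacts (fun (m : LatticePoints N F) p =>
        a m * S.theta (fun _ => siegelOmega (Z 0)) m.1 p) (S.pullback σ.1) := fun σ =>
    exists_theta_expansion hN (hZ 0) hinv hF σ.2.1
      (fun p v => by have h := σ.2.2 p v; rwa [hJZ] at h) (S.sectEquiv σ.1).2
  have hpull : ∀ (t : Finset (LatticePoints N F)) (a : LatticePoints N F → ℂ) (p : Total n),
      S.pullback (∑ m ∈ t, a m • θ m) p =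
        ∑ m ∈ t, a m * S.theta (fun _ => siegelOmega (Z 0)) m.1 p := by
    intro t a p
    have h := congrFun (map_sum S.pullbackLinear (fun m => a m • θ m) t) p
    simp only [map_smul, Finset.sum_apply, Pi.smul_apply, smul_eq_mul] at h
    exact h.trans (Finset.sum_congr rfl fun m _ => by rw [← hθ]; rfl)
  refine ⟨fun m => ⟨θ m, hhol m⟩, hθ, ?_, fun σ => ?_, fun hB => ?_⟩
  · rw [linearIndependent_iff']
    intro t a h l hl
    -- The l-th Fourier coefficient on the fibre over 0 annihilates every ϑ_{m/N} with m ≠ l.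
    obtain ⟨d, hd, hd'⟩ := exists_mFourierCoeff_theta hN (hZ 0) hinv hF l
    have h1 : ∑ m ∈ t, a m • θ m = 0 := by
      have h2 := congrArg Subtype.val h
      simpa using h2
    have h3 : (fun y => ∑ m ∈ t, a m * S.theta (fun _ => siegelOmega (Z 0)) m.1 (0, y)) =
        fun _ => 0 := by
      ext y
      rw [← hpull, h1, S.pullback_zero]
      rfl
    have h4 := mFourierCoeff_sum t
      (fun (m : LatticePoints N F) y => a m * S.theta (fun _ => siegelOmega (Z 0)) m.1 (0, y))
      (fun m => continuous_const.mul
        ((continuous_theta hN (hZ 0) hinv m.1).comp (by fun_prop))) l.1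
    classical
    simp only [mFourierCoeff_const_mul, hd', mul_ite, mul_zero, Finset.sum_ite_eq', hl, if_true,
      h3] at h4
    rw [mFourierCoeff_eq] at h4
    simp only [mul_zero, MeasureTheory.integral_zero] at h4
    exact (mul_eq_zero.1 h4.symm).resolve_right hd
  · obtain ⟨a, ha⟩ := hex σ
    refine ⟨a, by simpa only [hθ] using ha, fun a' ha' => ?_⟩
    exact theta_expansion_unique hN (hZ 0) hinv hF (by simpa only [hθ] using ha') ha
  · have hfin := finite_latticePoints hN hF hB
    refine ⟨hfin, ?_⟩
    have := Fintype.ofFinite (LatticePoints N F)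
    rw [Submodule.eq_top_iff']
    intro σ
    obtain ⟨a, ha⟩ := hex σ
    have h1 : σ = ∑ m, a m • (⟨θ m, hhol m⟩ : S.holomorphicSections J) := by
      apply Subtype.ext
      apply S.pullback_injective
      ext p
      -- With finitely many lattice points, the convergent expansion is a finite linear combination.
      have h2 := (ha.hasSum p).unique (hasSum_fintype _)
      rw [h2, ← hpull]
      congr 1
      simp
    rw [h1]
    exact Submodule.sum_mem _ fun m _ => Submodule.smul_mem _ _ (Submodule.subset_span ⟨m, rfl⟩)
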